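/- Let $n\ge 1$ and $d\ge 1$ be integers, $\alpha>-1$, $1<p<\infty$, and let $\mathbb B_n$ be the open unit ball of $\mathbb C^n$. Write $\bar z w=\sum_i \overline{z_i}w_i$ and $\|v\|_p=(\sum_i|v_i|^p)^{1/p}$ for $v\in\mathbb C^d$. Let $dv_\alpha=c_\alpha(1-|z|^2)^\alpha dV$, normalized by $v_\alpha(\mathbb B_n)=1$, and let $A^p_\alpha$ be the space of holomorphic $f:\mathbb B_n\to\mathbb C^d$ with $\|f\|_{A^p_\alpha}^p=\int_{\mathbb B_n}\|f\|_p^p\,dv_\alpha<\infty$. Put $$k_\lambda(z)=\frac{(1-|\lambda|^2)^{(n+1+\alpha)/2}}{(1-\bar\lambda z)^{n+1+\alpha}}.$$ Let $D(\lambda,r)$ be the ball with centre $\lambda$ and radius $r$ for the Bergman metric $\beta(z,w)=\frac12\log\frac{1+|\varphi_z(w)|}{1-|\varphi_z(w)|}$, where $\varphi_z$ is the involutive automorphism of $\mathbb B_n$ interchanging $z$ and $0$. A PSD matrix-valued measure on $\mathbb B_n$ is a countably additive function $\mu$ on the Borel sets of $\mathbb B_n$ whose values are positive semidefinite complex $d\times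 d$ matrices. Let $\tau_\mu=\sum_i\mu_{(i,i)}$ be its trace measure, $M_\mu=\big(d\mu_{(i,j)}/d\tau_\mu\big)_{i,j}$ (so that $d\mu=M_\mu\,d\tau_\mu$), $\|M_\mu\|$ the operator norm of $M_\mu$ on Euclidean $\mathbb C^d$, and $|\mu|=\sum_{i,j}|\mu_{(i,j)}|$, where $|\mu_{(i,j)}|$ is the total variation measure of $\mu_{(i,j)}$. Let $$T_\mu f(z)=\int_{\mathbb B_n}\frac{d\mu(w)f(w)}{(1-\bar w z)^{n+1+\alpha}},\qquad T_{|\mu|}f(z)=\int_{\mathbb B_n}\frac{f(w)\,d|\mu|(w)}{(1-\bar w z)^{n+1+\alpha}}.$$ The norm $\|T\|_{\mathcal L(A^p_\alpha)}$ of either operator is the infimum of the $C\in[0,\infty]$ such that for every $f\in A^p_\alpha$ the integral converges absolutely at every point of $\mathbb B_n$, $Tf\in A^p_\alpha$ and $\|Tf\|_{A^p_\alpha}\le C\|f\|_{A^p_\alpha}$; it is $\infty$ if $T$ is not defined and bounded on $A^p_\alpha$. Let $r>0$ and $N\in\mathbb N$. Then there is a constant $C<\infty$, depending only on $n,d,\alpha,p,r,N$,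 such that for every PSD matrix-valued measure $\mu$ on $\mathbb B_n$, any two of the following quantities $X,Y\in[0,\infty]$ satisfy $X\le CY$ and $Y\le CX$ (in particular, all are finite as soon as one is): 1. $\|\mu\|_{RKM}=\sup_{\|e\|_2=1}\sup_{\lambda\in\mathbb B_n}\int_{\mathbb B_n}|k_\lambda|^2\,\langle d\mu\, e,e\rangle$; 2. $\|\iota_{(p,d)}\|^p=\inf\{A:\int_{\mathbb B_n}\|M_\mu^{1/p}f\|_p^p\,d\tau_\mu\le A\|f\|_{A^p_\alpha}^p\ \text{for all } f\in A^p_\alpha\}$; 3. $\|\mu\|_{GEO}=\sup_{\lambda\in\mathbb B_n}(1-|\lambda|^2)^{-(n+1+\alpha)}\int_{D(\lambda,r)}\|M_\mu\|\,d\tau_\mu$; 4. $B=\sup_{k}(1-|\lambda_k|^2)^{-(n+1+\alpha)}\int_{D(\lambda_k,r)}\|M_\mu\|\,d\tau_\mu$, for any sequence $(\lambda_k)$ in $\mathbb B_n$ such that the balls $D(\lambda_k,r)$ cover $\mathbb B_n$, the balls $D(\lambda_k,r/4)$ are pairwise disjoint, and each point of $\mathbb B_n$ belongs to at most $N$ of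 the balls $D(\lambda_k,4r)$; 5. $\|T_\mu\|_{\mathcal L(A^p_\alpha)}$; 6. $\sup_{\lambda\in\mathbb B_n}\int_{\mathbb B_n}|k_\lambda|^2\,d|\mu|$; 7. $\|\kappa_{(p,d)}\|^p=\inf\{A:\int_{\mathbb B_n}\|f\|_p^p\,d|\mu|\le A\|f\|_{A^p_\alpha}^p\ \text{for all } f\in A^p_\alpha\}$; 8. $\sup_{\lambda\in\mathbb B_n}(1-|\lambda|^2)^{-(n+1+\alpha)}\,|\mu|(D(\lambda,r))$; 9. $\|T_{|\mu|}\|_{\mathcal L(A^p_\alpha)}$. -/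

import Mathlib

open MeasureTheory
open scoped ENNReal NNReal ComplexOrder

noncomputable section

namespace Carleson

/-! ### The ball, its automorphisms and the Bergman metric -/

/-- The open Euclidean unit ball `𝔹ⁿ` of `ℂⁿ`. -/
abbrev Ball (n : ℕ) : Type := ↥(Metric.ball (0 : EuclideanSpace ℂ (Fin n)) 1)

/-- The product `conj z · w = ∑ i, conj (z i) * w i`
(Mathlib's inner product is conjugate-linear in its first argument). -/
def hdot {n : ℕ} (z w : EuclideanSpace ℂ (Fin n)) : ℂ := inner ℂ z w

/-- The involutive automorphism `φ_z` of the ball that interchanges `z` and `0`: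
`φ_z(w) = (z - P_z w - (1 - |z|²)^(1/2) Q_z w) / (1 - conj z · w)`, where `P_z` is the orthogonal
projection onto `ℂ z` (so `P_0 = 0`) and `Q_z = I - P_z`. -/
def ballAut {n : ℕ} (z w : EuclideanSpace ℂ (Fin n)) : EuclideanSpace ℂ (Fin n) :=
  let P : EuclideanSpace ℂ (Fin n) := (hdot z w / ((‖z‖ ^ 2 : ℝ) : ℂ)) • z
  (1 - hdot z w)⁻¹ • (z - P - ((Real.sqrt (1 - ‖z‖ ^ 2) : ℝ) : ℂ) • (w - P))

/-- The pseudo-hyperbolic metric `ρ(z, w) = |φ_z(w)|`. -/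
def pseudoDist {n : ℕ} (z w : Ball n) : ℝ := ‖ballAut z.1 w.1‖

/-- The Bergman metric `β(z, w) = (1/2) log ((1 + ρ) / (1 - ρ))`. -/
def bergDist {n : ℕ} (z w : Ball n) : ℝ :=
  1 / 2 * Real.log ((1 + pseudoDist z w) / (1 - pseudoDist z w))

/-- The ball `D(z, r)` of the metric `β`. -/
def bergBall {n : ℕ} (z : Ball n) (r : ℝ) : Set (Ball n) := {w | bergDist z w < r}

/-- A lattice of radius `r` with overlap bound `N`: the balls `D(a_k, r)` cover `𝔹ⁿ`, the balls
`D(a_k, r/4)` are mutually disjoint, and each point lies in at most `N` of the balls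
`D(a_k, 4r)`. -/
structure IsLattice {n : ℕ} (r : ℝ) (N : ℕ) (a : ℕ → Ball n) : Prop where
  cover : ⋃ k, bergBall (a k) r = Set.univ
  separated : Pairwise fun k l => Disjoint (bergBall (a k) (r / 4)) (bergBall (a l) (r / 4))
  overlap : ∀ z, {k | z ∈ bergBall (a k) (4 * r)}.encard ≤ N

/-! ### Weighted volume and Bergman spaces of `ℂᵈ`-valued functions -/

/-- `(1 - |z|²)^α dV(z)` on the ball. -/
def weightedVolume (n : ℕ) (α : ℝ) : Measure (Ball n) :=
  (Measure.comap Subtype.val (volume : Measure (EuclideanSpace ℂ (Fin n)))).withDensity fun z => ENNReal.ofReal ((1 - ‖z.1‖ ^ 2) ^ α)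

/-- `dv_α = c_α (1 - |z|²)^α dV(z)`, normalized to total mass one. -/
def vMeas (n : ℕ) (α : ℝ) : Measure (Ball n) :=
  (weightedVolume n α Set.univ)⁻¹ • weightedVolume n α

/-- `‖v‖_p ^ p = ∑ i, |v i| ^ p`. -/
def lpPow {d : ℕ} (p : ℝ) (v : Fin d → ℂ) : ℝ≥0∞ := ∑ i, ‖v i‖ₑ ^ p

/-- `‖f‖^p = ∫ ‖f(z)‖_p ^ p dv_α(z)`, the `p`-th power of the norm of `L^p_α(𝔹ⁿ; ℂᵈ)`.
Functions on the ball are given as functions on `ℂⁿ`; only their values on the ball matter. -/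
def lpaPow {n d : ℕ} (α p : ℝ) (f : EuclideanSpace ℂ (Fin n) → Fin d → ℂ) : ℝ≥0∞ :=
  ∫⁻ z : Ball n, lpPow p (f z.1) ∂(vMeas n α)

/-- The norm of `L^p_α(𝔹ⁿ; ℂᵈ)`. -/
def lpaNorm {n d : ℕ} (α p : ℝ) (f : EuclideanSpace ℂ (Fin n) → Fin d → ℂ) : ℝ≥0∞ :=
  lpaPow α p f ^ (1 / p)

/-- `f ∈ A^p_α(𝔹ⁿ; ℂᵈ)`: `f` is holomorphic on the ball and has finite norm. -/
def MemBergman {n d : ℕ} (α p : ℝ) (f : EuclideanSpace ℂ (Fin n) → Fin d → ℂ) : Prop :=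
  DifferentiableOn ℂ f (Metric.ball 0 1) ∧ lpaNorm α p f < ∞

/-- The reproducing kernel `K_z(w) = (1 - conj z · w)^(-(n+1+α))` (principal branch; the base has
positive real part for `z`, `w` in the ball). -/
def repKernel {n : ℕ} (α : ℝ) (z w : EuclideanSpace ℂ (Fin n)) : ℂ :=
  1 / (1 - hdot z w) ^ (((n + 1 + α : ℝ)) : ℂ)

/-- The normalized kernel `k_z^{(2,α)}(w) = (1 - |z|²)^((n+1+α)/2) (1 - conj z · w)^(-(n+1+α))`. -/
def normKernel {n : ℕ} (α : ℝ) (z w : EuclideanSpace ℂ (Fin n)) : ℂ :=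
  (((1 - ‖z‖ ^ 2) ^ ((n + 1 + α) / 2) : ℝ) : ℂ) * repKernel α z w

/-! ### Matrix-valued measures -/

/-- A PSD matrix-valued measure on the Borel sets of the ball: a countably additive function with
values in the `d × d` complex matrices, all of whose values are positive semidefinite. -/
structure PSDMeasure (n d : ℕ) where
  toVM : VectorMeasure (Ball n) (Matrix (Fin d) (Fin d) ℂ)
  posSemidef : ∀ s, MeasurableSet s → (toVM s).PosSemidef

/-- The additive map `A ↦ A i j`. -/
def entryHom {d : ℕ} (i j : Fin d) : Matrix (Fin d) (Fin d) ℂ →+ ℂ where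
  toFun A := A i j
  map_zero' := rfl
  map_add' _ _ := rfl

/-- The additive map `A ↦ tr A` (its real part, which is all of it for PSD matrices). -/
def traceHom {d : ℕ} : Matrix (Fin d) (Fin d) ℂ →+ ℝ where
  toFun A := A.trace.re
  map_zero' := by simp
  map_add' A B := by simp

/-- The additive map `A ↦ ⟨A e, e⟩` (its real part, which is all of it for PSD matrices). -/
def quadHom {d : ℕ} (e : EuclideanSpace ℂ (Fin d)) : Matrix (Fin d) (Fin d) ℂ →+ ℝ where
  toFun A := (star e.ofLp ⬝ᵥ A.mulVec e.ofLp).re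
  map_zero' := by simp
  map_add' A B := by simp [Matrix.add_mulVec]

theorem continuous_entryHom {d : ℕ} (i j : Fin d) : Continuous (entryHom i j) :=
  continuous_id.matrix_elem i j

theorem continuous_traceHom {d : ℕ} : Continuous (traceHom (d := d)) :=
  Complex.continuous_re.comp continuous_id.matrix_trace

theorem continuous_quadHom {d : ℕ} (e : EuclideanSpace ℂ (Fin d)) : Continuous (quadHom e) :=
  Complex.continuous_re.comp
    (Continuous.dotProduct continuous_const (Continuous.matrix_mulVec continuous_id continuous_const))

theorem traceHom_nonneg {d : ℕ} (A : Matrix (Fin d) (Fin d) ℂ) (hA : A.PosSemidef) :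
    0 ≤ traceHom A :=
  (Complex.nonneg_iff.1 hA.trace_nonneg).1

theorem quadHom_nonneg {d : ℕ} (e : EuclideanSpace ℂ (Fin d)) (A : Matrix (Fin d) (Fin d) ℂ)
    (hA : A.PosSemidef) : 0 ≤ quadHom e A :=
  (Complex.nonneg_iff.1 (hA.dotProduct_mulVec_nonneg e.ofLp)).1

namespace PSDMeasure

variable {n d : ℕ} (μ : PSDMeasure n d)

/-- The scalar measure `s ↦ L (μ s)`, for an additive continuous `L` that is nonnegative on PSD
matrices. -/
def scalarize (L : Matrix (Fin d) (Fin d) ℂ →+ ℝ) (hc : Continuous L)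
    (hL : ∀ A : Matrix (Fin d) (Fin d) ℂ, A.PosSemidef → 0 ≤ L A) : Measure (Ball n) :=
  SignedMeasure.toMeasureOfZeroLE (μ.toVM.mapRange L hc) Set.univ MeasurableSet.univ
    ((VectorMeasure.le_restrict_univ_iff_le _ _).2 (VectorMeasure.le_iff.2 fun s hs => by
      simpa using hL _ (μ.posSemidef s hs)))

theorem scalarize_apply (L : Matrix (Fin d) (Fin d) ℂ →+ ℝ) (hc : Continuous L)
    (hL : ∀ A : Matrix (Fin d) (Fin d) ℂ, A.PosSemidef → 0 ≤ L A) {s : Set (Ball n)}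
    (hs : MeasurableSet s) : μ.scalarize L hc hL s = ENNReal.ofReal (L (μ.toVM s)) := by
  rw [scalarize, SignedMeasure.toMeasureOfZeroLE_apply _ _ _ hs]
  rw [ENNReal.ofReal, ENNReal.coe_inj]
  apply NNReal.eq
  simp [hL _ (μ.posSemidef s hs)]

/-- The entry `μ_(i,j)`, a complex measure. -/
def entry (i j : Fin d) : ComplexMeasure (Ball n) :=
  μ.toVM.mapRange (entryHom i j) (continuous_entryHom i j)

/-- The trace measure `τ_μ = ∑ i, μ_(i,i)`. -/
def traceMeas : Measure (Ball n) :=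
  μ.scalarize traceHom continuous_traceHom traceHom_nonneg

/-- The measure `⟨dμ e, e⟩`, that is `s ↦ ⟨μ(s) e, e⟩`. -/
def quadMeas (e : EuclideanSpace ℂ (Fin d)) : Measure (Ball n) :=
  μ.scalarize (quadHom e) (continuous_quadHom e) (quadHom_nonneg e)

/-- The density `M_μ`, with entries the Radon-Nikodym derivatives `dμ_(i,j) / dτ_μ`. -/
def density (z : Ball n) : Matrix (Fin d) (Fin d) ℂ :=
  Matrix.of fun i j => (μ.entry i j).rnDeriv μ.traceMeas z

/-- `M_μ(z)^{1/p}`, through the spectral theorem: for a Hermitian matrix `A = U* Λ U` this is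
`U* Λ^{1/p} U`. -/
def densityRoot (p : ℝ) (z : Ball n) : Matrix (Fin d) (Fin d) ℂ :=
  cfc (fun x : ℝ => x ^ (1 / p)) (μ.density z)

/-- The scalar total variation `|μ| = ∑ i, ∑ j, |μ_(i,j)|`. -/
def totalVar : Measure (Ball n) := ∑ i, ∑ j, (μ.entry i j).variation

end PSDMeasure

/-- The operator norm of a matrix on `ℂᵈ` with the Euclidean norm. -/
def matNorm {d : ℕ} (A : Matrix (Fin d) (Fin d) ℂ) : ℝ≥0∞ :=
  ‖Matrix.toEuclideanCLM (n := Fin d) (𝕜 := ℂ) A‖ₑ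

/-! ### Toeplitz operators and their norms -/

/-- `T_ν f(z) = ∫ (1 - conj w · z)^(-(n+1+α)) g(w) dν(w)`. With `g = f` this is the Toeplitz
operator of a scalar measure `ν`; with `ν = τ_μ` and `g = M_μ f` it is that of `μ`. -/
def kernelIntegral {n d : ℕ} (α : ℝ) (ν : Measure (Ball n)) (g : Ball n → Fin d → ℂ)
    (z : EuclideanSpace ℂ (Fin n)) : Fin d → ℂ :=
  ∫ w, repKernel α w.1 z • g w ∂ν

/-- The operator norm on `A^p_α(𝔹ⁿ; ℂᵈ)` of the integral operator
`f ↦ ∫ (1 - conj w · z)^(-(n+1+α)) W(w) f(w) dν(w)`: the infimum of the constants `C` such that for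
every `f ∈ A^p_α` the integral converges absolutely at every point of the ball, the resulting
function lies in `A^p_α`, and its norm is at most `C ‖f‖`. It is `∞` if the operator is not defined
on `A^p_α` or not bounded there. -/
def toeplitzNorm {n d : ℕ} (α p : ℝ) (ν : Measure (Ball n))
    (W : Ball n → Matrix (Fin d) (Fin d) ℂ) : ℝ≥0∞ :=
  sInf {C | ∀ f : EuclideanSpace ℂ (Fin n) → Fin d → ℂ, MemBergman α p f →
    (∀ z : Ball n, Integrable (fun w : Ball n => repKernel α w.1 z.1 • (W w).mulVec (f w.1)) ν) ∧
    MemBergman α p (kernelIntegral α ν fun w => (W w).mulVec (f w.1)) ∧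
    lpaNorm α p (kernelIntegral α ν fun w => (W w).mulVec (f w.1)) ≤ C * lpaNorm α p f}

namespace PSDMeasure

variable {n d : ℕ} (μ : PSDMeasure n d)

/-- `‖μ‖_RKM = sup_e sup_λ ∫ |k_λ^{(2,α)}|² ⟨dμ e, e⟩`. -/
def rkm (α : ℝ) : ℝ≥0∞ :=
  ⨆ e : {e : EuclideanSpace ℂ (Fin d) // ‖e‖ = 1}, ⨆ l : Ball n,
    ∫⁻ z, ‖normKernel α l.1 z.1‖ₑ ^ 2 ∂(μ.quadMeas e.1)

/-- `‖ι_(p,d)‖^p`, the best constant in `∫ ‖M_μ^{1/p} f‖_p^p dτ_μ ≤ C ‖f‖^p`, `f ∈ A^p_α`. -/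
def embConst (α p : ℝ) : ℝ≥0∞ :=
  sInf {C | ∀ f : EuclideanSpace ℂ (Fin n) → Fin d → ℂ, MemBergman α p f →
    ∫⁻ z : Ball n, lpPow p ((μ.densityRoot p z).mulVec (f z.1)) ∂μ.traceMeas ≤ C * lpaPow α p f}

/-- `∫_{D(λ,r)} ‖M_μ‖ dτ_μ · (1 - |λ|²)^(-(n+1+α))`. -/
def geoAvg (α r : ℝ) (l : Ball n) : ℝ≥0∞ :=
  (∫⁻ z in bergBall l r, matNorm (μ.density z) ∂μ.traceMeas) *
    ENNReal.ofReal ((1 - ‖l.1‖ ^ 2) ^ (-(n + 1 + α)))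

/-- `‖μ‖_GEO`, the supremum of the averages over all centres. -/
def geo (α r : ℝ) : ℝ≥0∞ := ⨆ l : Ball n, μ.geoAvg α r l

/-- The supremum of the averages over the points of a sequence. -/
def geoSeq (α r : ℝ) (a : ℕ → Ball n) : ℝ≥0∞ := ⨆ k, μ.geoAvg α r (a k)

/-- `‖T_μ‖` on `A^p_α`, where `T_μ f(z) = ∫ (1 - conj w · z)^(-(n+1+α)) dμ(w) f(w)` and
`dμ = M_μ dτ_μ`. -/
def opNorm (α p : ℝ) : ℝ≥0∞ := toeplitzNorm α p μ.traceMeas μ.density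

end PSDMeasure

/-! ### The corresponding quantities of a scalar measure -/

/-- `sup_λ ∫ |k_λ^{(2,α)}|² dν`. -/
def scalarRkm {n : ℕ} (α : ℝ) (ν : Measure (Ball n)) : ℝ≥0∞ :=
  ⨆ l : Ball n, ∫⁻ z, ‖normKernel α l.1 z.1‖ₑ ^ 2 ∂ν

/-- `‖κ_(p,d)‖^p`, the best constant in `∫ ‖f‖_p^p dν ≤ C ‖f‖^p`, `f ∈ A^p_α(𝔹ⁿ; ℂᵈ)`. -/
def scalarEmbConst {n : ℕ} (d : ℕ) (α p : ℝ) (ν : Measure (Ball n)) : ℝ≥0∞ :=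
  sInf {C | ∀ f : EuclideanSpace ℂ (Fin n) → Fin d → ℂ, MemBergman α p f →
    ∫⁻ z : Ball n, lpPow p (f z.1) ∂ν ≤ C * lpaPow α p f}

/-- `sup_λ ν(D(λ,r)) (1 - |λ|²)^(-(n+1+α))`. -/
def scalarGeo {n : ℕ} (α r : ℝ) (ν : Measure (Ball n)) : ℝ≥0∞ :=
  ⨆ l : Ball n, ν (bergBall l r) * ENNReal.ofReal ((1 - ‖l.1‖ ^ 2) ^ (-(n + 1 + α)))

/-- `‖T_ν‖` on `A^p_α(𝔹ⁿ; ℂᵈ)`, where `T_ν f(z) = ∫ (1 - conj w · z)^(-(n+1+α)) f(w) dν(w)`. -/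
def scalarOpNorm {n : ℕ} (d : ℕ) (α p : ℝ) (ν : Measure (Ball n)) : ℝ≥0∞ :=
  toeplitzNorm (d := d) α p ν fun _ => 1

end Carleson

end

noncomputable section

namespace Carleson

/-! ### Geometry of the ball -/

section Geometry

variable {n : ℕ}

theorem norm_hdot_le (z w : EuclideanSpace ℂ (Fin n)) : ‖hdot z w‖ ≤ ‖z‖ * ‖w‖ :=
  norm_inner_le_norm z w

theorem Ball.norm_lt_one (z : Ball n) : ‖z.1‖ < 1 :=
  mem_ball_zero_iff.1 z.2

theorem Ball.one_sub_norm_sq_pos (z : Ball n) : 0 < 1 - ‖z.1‖ ^ 2 := by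
  have := z.norm_lt_one
  nlinarith [norm_nonneg z.1]

theorem re_one_sub_hdot_pos {z w : EuclideanSpace ℂ (Fin n)} (hz : ‖z‖ ≤ 1) (hw : ‖w‖ < 1) :
    0 < (1 - hdot z w).re := by
  have h1 : (hdot z w).re ≤ ‖hdot z w‖ := Complex.re_le_norm _
  have h2 := norm_hdot_le z w
  have h3 : ‖z‖ * ‖w‖ ≤ ‖w‖ := mul_le_of_le_one_left (norm_nonneg _) hz
  simp only [Complex.sub_re, Complex.one_re]
  linarith

theorem one_sub_hdot_ne_zero {z w : EuclideanSpace ℂ (Fin n)} (hz : ‖z‖ ≤ 1) (hw : ‖w‖ < 1) :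
    1 - hdot z w ≠ 0 := fun h => by
  have := re_one_sub_hdot_pos hz hw
  simp [h] at this

theorem hdot_conj (z w : EuclideanSpace ℂ (Fin n)) :
    (starRingEnd ℂ) (hdot z w) = hdot w z := inner_conj_symm w z

theorem norm_one_sub_hdot_comm (z w : EuclideanSpace ℂ (Fin n)) :
    ‖1 - hdot z w‖ = ‖1 - hdot w z‖ := by
  rw [← hdot_conj w z, ← Complex.norm_conj]
  simp

/-- The numerator of `φ_z(w)`. -/
def autNum (z w : EuclideanSpace ℂ (Fin n)) : EuclideanSpace ℂ (Fin n) :=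
  z - (hdot z w / ((‖z‖ ^ 2 : ℝ) : ℂ)) • z -
    ((Real.sqrt (1 - ‖z‖ ^ 2) : ℝ) : ℂ) • (w - (hdot z w / ((‖z‖ ^ 2 : ℝ) : ℂ)) • z)

theorem ballAut_eq (z w : EuclideanSpace ℂ (Fin n)) :
    ballAut z w = (1 - hdot z w)⁻¹ • autNum z w := rfl

theorem inner_autNum {z : EuclideanSpace ℂ (Fin n)} (hz : ‖z‖ < 1)
    (u w : EuclideanSpace ℂ (Fin n)) :
    inner ℂ (autNum z u) (autNum z w) =
      (1 - hdot u z) * (1 - hdot z w) - (1 - ((‖z‖ ^ 2 : ℝ) : ℂ)) * (1 - hdot u w) := by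
  by_cases h0 : z = 0
  · subst h0
    simp [autNum, hdot]
  have hn : ((‖z‖ ^ 2 : ℝ) : ℂ) ≠ 0 := by
    simpa using h0
  have hzz : inner ℂ z z = ((‖z‖ ^ 2 : ℝ) : ℂ) := by
    rw [inner_self_eq_norm_sq_to_K]; norm_cast
  have hs : ((Real.sqrt (1 - ‖z‖ ^ 2) : ℝ) : ℂ) ^ 2 = 1 - ((‖z‖ ^ 2 : ℝ) : ℂ) := by
    rw [← Complex.ofReal_pow, Real.sq_sqrt (by nlinarith [norm_nonneg z])]
    push_cast; ring
  have hc : (starRingEnd ℂ) (inner ℂ z u) = inner ℂ u z := inner_conj_symm u z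
  simp only [autNum, hdot, inner_sub_left, inner_sub_right, inner_smul_left, inner_smul_right,
    map_div₀, Complex.conj_ofReal, hc, hzz]
  generalize ((Real.sqrt (1 - ‖z‖ ^ 2) : ℝ) : ℂ) = s at *
  generalize ((‖z‖ ^ 2 : ℝ) : ℂ) = t at *
  field_simp
  ring_nf
  have : s ^ 2 = 1 - t := hs
  simp only [this]
  ring

theorem norm_autNum_sq {z : EuclideanSpace ℂ (Fin n)} (hz : ‖z‖ < 1)
    (w : EuclideanSpace ℂ (Fin n)) :
    ‖autNum z w‖ ^ 2 = ‖1 - hdot z w‖ ^ 2 - (1 - ‖z‖ ^ 2) * (1 - ‖w‖ ^ 2) := by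
  have h := inner_autNum hz w w
  have h2 : (1 - hdot w z) * (1 - hdot z w) = ((‖1 - hdot z w‖ ^ 2 : ℝ) : ℂ) := by
    rw [← hdot_conj z w]
    have := Complex.conj_mul' (1 - hdot z w)
    simpa using this
  have h3 : hdot w w = ((‖w‖ ^ 2 : ℝ) : ℂ) := by
    rw [hdot, inner_self_eq_norm_sq_to_K]; norm_cast
  rw [h2, h3, inner_self_eq_norm_sq_to_K] at h
  apply Complex.ofReal_injective
  push_cast at h ⊢
  exact h

theorem pseudoDist_eq (z w : Ball n) : pseudoDist z w = ‖autNum z.1 w.1‖ / ‖1 - hdot z.1 w.1‖ := by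
  rw [pseudoDist, ballAut_eq, norm_smul, norm_inv, inv_mul_eq_div]

theorem norm_one_sub_hdot_pos (z w : Ball n) : 0 < ‖1 - hdot z.1 w.1‖ :=
  norm_pos_iff.2 (one_sub_hdot_ne_zero z.norm_lt_one.le w.norm_lt_one)

theorem one_sub_pseudoDist_sq (z w : Ball n) :
    1 - pseudoDist z w ^ 2 = (1 - ‖z.1‖ ^ 2) * (1 - ‖w.1‖ ^ 2) / ‖1 - hdot z.1 w.1‖ ^ 2 := by
  have := norm_one_sub_hdot_pos z w
  rw [pseudoDist_eq, div_pow, norm_autNum_sq z.norm_lt_one]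
  field_simp
  ring

theorem pseudoDist_nonneg (z w : Ball n) : 0 ≤ pseudoDist z w := norm_nonneg _

theorem pseudoDist_lt_one (z w : Ball n) : pseudoDist z w < 1 := by
  have h := one_sub_pseudoDist_sq z w
  have h1 := z.one_sub_norm_sq_pos
  have h2 := w.one_sub_norm_sq_pos
  have h3 := norm_one_sub_hdot_pos z w
  have : 0 < 1 - pseudoDist z w ^ 2 := by rw [h]; positivity
  nlinarith [pseudoDist_nonneg z w]

theorem pseudoDist_mem (z w : Ball n) : pseudoDist z w ∈ Set.Ioo (-1 : ℝ) 1 :=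
  ⟨by linarith [pseudoDist_nonneg z w], pseudoDist_lt_one z w⟩

theorem pseudoDist_comm (z w : Ball n) : pseudoDist z w = pseudoDist w z := by
  have h := one_sub_pseudoDist_sq z w
  rw [mul_comm, norm_one_sub_hdot_comm, ← one_sub_pseudoDist_sq w z] at h
  exact (pow_left_inj₀ (pseudoDist_nonneg _ _) (pseudoDist_nonneg _ _) two_ne_zero).1 (by linarith)

theorem bergDist_eq (z w : Ball n) : bergDist z w = Real.artanh (pseudoDist z w) :=
  (Real.artanh_eq_half_log (Set.Ioo_subset_Icc_self (pseudoDist_mem z w))).symm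

theorem bergDist_nonneg (z w : Ball n) : 0 ≤ bergDist z w := by
  rw [bergDist_eq]; exact Real.artanh_nonneg (pseudoDist_nonneg _ _)

theorem bergDist_comm (z w : Ball n) : bergDist z w = bergDist w z := by
  rw [bergDist, bergDist, pseudoDist_comm]

theorem cosh_bergDist (z w : Ball n) : Real.cosh (bergDist z w) =
    ‖1 - hdot z.1 w.1‖ / (√(1 - ‖z.1‖ ^ 2) * √(1 - ‖w.1‖ ^ 2)) := by
  have h1 := z.one_sub_norm_sq_pos
  have h2 := w.one_sub_norm_sq_pos
  rw [bergDist_eq, Real.cosh_artanh (pseudoDist_mem z w), one_sub_pseudoDist_sq,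
    Real.sqrt_div (by positivity), Real.sqrt_mul h1.le, Real.sqrt_sq (norm_nonneg _), one_div_div]

theorem sinh_bergDist (z w : Ball n) : Real.sinh (bergDist z w) =
    ‖autNum z.1 w.1‖ / (√(1 - ‖z.1‖ ^ 2) * √(1 - ‖w.1‖ ^ 2)) := by
  have h3 := norm_one_sub_hdot_pos z w
  have := cosh_bergDist z w
  rw [bergDist_eq, Real.cosh_artanh (pseudoDist_mem z w)] at this
  rw [bergDist_eq, Real.sinh_artanh (pseudoDist_mem z w), div_eq_mul_one_div, this, pseudoDist_eq]
  field_simp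

theorem bergDist_triangle (x z y : Ball n) : bergDist x y ≤ bergDist x z + bergDist z y := by
  have hx := Real.sqrt_pos.2 x.one_sub_norm_sq_pos
  have hy := Real.sqrt_pos.2 y.one_sub_norm_sq_pos
  have hz := Real.sqrt_pos.2 z.one_sub_norm_sq_pos
  have hzz := Real.sq_sqrt z.one_sub_norm_sq_pos.le
  have key : (1 - ‖z.1‖ ^ 2) * ‖1 - hdot x.1 y.1‖ ≤
      ‖1 - hdot z.1 x.1‖ * ‖1 - hdot z.1 y.1‖ + ‖autNum z.1 x.1‖ * ‖autNum z.1 y.1‖ := by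
    have h := inner_autNum z.norm_lt_one x.1 y.1
    have h' : (1 - ((‖z.1‖ ^ 2 : ℝ) : ℂ)) * (1 - hdot x.1 y.1) =
        (1 - hdot x.1 z.1) * (1 - hdot z.1 y.1) - inner ℂ (autNum z.1 x.1) (autNum z.1 y.1) := by
      rw [h]; ring
    have h2 : ‖(1 - ((‖z.1‖ ^ 2 : ℝ) : ℂ)) * (1 - hdot x.1 y.1)‖ =
        (1 - ‖z.1‖ ^ 2) * ‖1 - hdot x.1 y.1‖ := by
      rw [norm_mul, ← Complex.ofReal_one, ← Complex.ofReal_sub, Complex.norm_real,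
        Real.norm_of_nonneg z.one_sub_norm_sq_pos.le, Complex.ofReal_one]
    rw [← h2, h', norm_one_sub_hdot_comm z.1 x.1, ← norm_mul]
    exact (norm_sub_le _ _).trans (add_le_add_right (norm_inner_le_norm _ _) _)
  have : Real.cosh (bergDist x y) ≤ Real.cosh (bergDist x z + bergDist z y) := by
    rw [Real.cosh_add, bergDist_comm x z, cosh_bergDist, cosh_bergDist, cosh_bergDist,
      sinh_bergDist, sinh_bergDist]
    rw [div_mul_div_comm, div_mul_div_comm, ← add_div, div_le_div_iff₀ (by positivity)
      (by positivity)]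
    calc ‖1 - hdot x.1 y.1‖ * (√(1 - ‖z.1‖ ^ 2) * √(1 - ‖x.1‖ ^ 2) *
          (√(1 - ‖z.1‖ ^ 2) * √(1 - ‖y.1‖ ^ 2)))
        = ((1 - ‖z.1‖ ^ 2) * ‖1 - hdot x.1 y.1‖) * (√(1 - ‖x.1‖ ^ 2) * √(1 - ‖y.1‖ ^ 2)) := by
          conv_rhs => rw [← hzz]
          ring
      _ ≤ _ := by gcongr
  rw [Real.cosh_le_cosh, abs_of_nonneg (bergDist_nonneg _ _),
    abs_of_nonneg (add_nonneg (bergDist_nonneg _ _) (bergDist_nonneg _ _))] at this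
  exact this

theorem mem_bergBall_iff_cosh {r : ℝ} (hr : 0 < r) (z w : Ball n) : w ∈ bergBall z r ↔
    ‖1 - hdot z.1 w.1‖ ^ 2 < Real.cosh r ^ 2 * ((1 - ‖z.1‖ ^ 2) * (1 - ‖w.1‖ ^ 2)) := by
  have hz := z.one_sub_norm_sq_pos
  have hw := w.one_sub_norm_sq_pos
  have hc := Real.cosh_pos r
  have h : w ∈ bergBall z r ↔ Real.cosh (bergDist z w) < Real.cosh r := by
    rw [Real.cosh_lt_cosh, abs_of_nonneg (bergDist_nonneg _ _), abs_of_pos hr]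
    rfl
  rw [h, cosh_bergDist, div_lt_iff₀ (by positivity),
    ← pow_lt_pow_iff_left₀ (norm_nonneg _) (by positivity) two_ne_zero, mul_pow, mul_pow,
    Real.sq_sqrt hz.le, Real.sq_sqrt hw.le]

theorem mem_bergBall_comm {r : ℝ} (z w : Ball n) : w ∈ bergBall z r ↔ z ∈ bergBall w r := by
  simp only [bergBall, Set.mem_ofPred_eq, bergDist_comm]

theorem continuous_hdot : Continuous fun q : EuclideanSpace ℂ (Fin n) × EuclideanSpace ℂ (Fin n) =>
    hdot q.1 q.2 := continuous_inner

theorem isOpen_bergBall_rel {r : ℝ} (hr : 0 < r) :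
    IsOpen {q : Ball n × Ball n | q.2 ∈ bergBall q.1 r} := by
  simp only [mem_bergBall_iff_cosh hr]
  have : Continuous fun q : Ball n × Ball n => hdot q.1.1 q.2.1 :=
    continuous_hdot.comp (by fun_prop : Continuous fun q : Ball n × Ball n => (q.1.1, q.2.1))
  exact isOpen_lt (by fun_prop) (by fun_prop)

theorem measurableSet_bergBall {r : ℝ} (hr : 0 < r) (z : Ball n) :
    MeasurableSet (bergBall z r) :=
  ((isOpen_bergBall_rel hr).preimage (Continuous.prodMk_right z)).measurableSet

theorem one_sub_norm_sq_le_two_mul (z w : Ball n) : 1 - ‖z.1‖ ^ 2 ≤ 2 * ‖1 - hdot z.1 w.1‖ := by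
  have h1 : 1 - ‖z.1‖ * ‖w.1‖ ≤ ‖1 - hdot z.1 w.1‖ := by
    have := norm_sub_norm_le (1 : ℂ) (hdot z.1 w.1)
    rw [norm_one] at this
    linarith [norm_hdot_le z.1 w.1]
  have hz := z.norm_lt_one
  have hw := w.norm_lt_one
  nlinarith [norm_nonneg z.1, norm_nonneg w.1, mul_le_of_le_one_right (norm_nonneg z.1) hw.le]

theorem one_sub_norm_sq_le_two_mul' (z w : Ball n) : 1 - ‖w.1‖ ^ 2 ≤ 2 * ‖1 - hdot z.1 w.1‖ := by
  rw [norm_one_sub_hdot_comm]; exact one_sub_norm_sq_le_two_mul w z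

/-- On `D(z, r)`, `|1 - conj z · w|` is at most a constant times `1 - |z|²`. -/
theorem norm_one_sub_hdot_le {r : ℝ} (hr : 0 < r) {z w : Ball n} (h : w ∈ bergBall z r) :
    ‖1 - hdot z.1 w.1‖ ≤ 2 * Real.cosh r ^ 2 * (1 - ‖z.1‖ ^ 2) := by
  rw [mem_bergBall_iff_cosh hr] at h
  have h1 := one_sub_norm_sq_le_two_mul' z w
  have hz := z.one_sub_norm_sq_pos
  have hc : 0 < Real.cosh r ^ 2 := by have := Real.cosh_pos r; positivity
  have h0 := norm_one_sub_hdot_pos z w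
  refine le_of_mul_le_mul_right ?_ h0
  calc ‖1 - hdot z.1 w.1‖ * ‖1 - hdot z.1 w.1‖ = ‖1 - hdot z.1 w.1‖ ^ 2 := by ring
    _ ≤ Real.cosh r ^ 2 * ((1 - ‖z.1‖ ^ 2) * (1 - ‖w.1‖ ^ 2)) := h.le
    _ ≤ Real.cosh r ^ 2 * ((1 - ‖z.1‖ ^ 2) * (2 * ‖1 - hdot z.1 w.1‖)) := by gcongr
    _ = _ := by ring

theorem one_sub_norm_sq_comparable {r : ℝ} (hr : 0 < r) {z w : Ball n} (h : w ∈ bergBall z r) :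
    1 - ‖w.1‖ ^ 2 ≤ 4 * Real.cosh r ^ 2 * (1 - ‖z.1‖ ^ 2) := by
  linarith [norm_one_sub_hdot_le hr h, one_sub_norm_sq_le_two_mul' z w]

end Geometry

/-! ### Anisotropic dilations -/

section Stretch

variable {n : ℕ}

/-- For a unit vector `e`, the linear map that multiplies `e` by `c s²` and the orthogonal
complement of `e` by `c s`. -/
def stretch (e : EuclideanSpace ℂ (Fin n)) (c s : ℝ) :
    EuclideanSpace ℂ (Fin n) →ₗ[ℂ] EuclideanSpace ℂ (Fin n) :=
  ((c * s : ℝ) : ℂ) • LinearMap.transvection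
    (((s - 1 : ℝ) : ℂ) • (innerSL ℂ e : EuclideanSpace ℂ (Fin n) →ₗ[ℂ] ℂ)) e

theorem stretch_apply (e : EuclideanSpace ℂ (Fin n)) (c s : ℝ) (ζ : EuclideanSpace ℂ (Fin n)) :
    stretch e c s ζ = ((c * s : ℝ) : ℂ) • (ζ + (((s - 1 : ℝ) : ℂ) * hdot e ζ) • e) := by
  simp [stretch, LinearMap.transvection.apply, hdot]

theorem det_stretch {e : EuclideanSpace ℂ (Fin n)} (he : ‖e‖ = 1) (c s : ℝ) :
    LinearMap.det ((stretch e c s).restrictScalars ℝ) = c ^ (2 * n) * (s ^ 2) ^ (n + 1) := by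
  have : LinearMap.det (stretch e c s) = ((c ^ n * s ^ (n + 1) : ℝ) : ℂ) := by
    rw [stretch, LinearMap.det_smul, LinearMap.transvection.det]
    simp [he]
    ring
  rw [LinearMap.det_restrictScalars, this, Algebra.norm_complex_apply, Complex.normSq_ofReal]
  ring

theorem hdot_stretch {e : EuclideanSpace ℂ (Fin n)} (he : ‖e‖ = 1) (c s : ℝ)
    (ζ : EuclideanSpace ℂ (Fin n)) :
    hdot e (stretch e c s ζ) = ((c * s ^ 2 : ℝ) : ℂ) * hdot e ζ := by
  have hee : inner ℂ e e = (1 : ℂ) := by rw [inner_self_eq_norm_sq_to_K, he]; simp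
  rw [stretch_apply]
  simp only [hdot, inner_smul_right, inner_add_right, hee]
  push_cast
  ring

theorem norm_add_smul_unit_sq {e : EuclideanSpace ℂ (Fin n)} (he : ‖e‖ = 1) (k : ℝ)
    (ζ : EuclideanSpace ℂ (Fin n)) :
    ‖ζ + ((k : ℂ) * hdot e ζ) • e‖ ^ 2 = ‖ζ‖ ^ 2 + ((1 + k) ^ 2 - 1) * ‖hdot e ζ‖ ^ 2 := by
  rw [norm_add_sq (𝕜 := ℂ), norm_smul, he, mul_one, norm_mul, Complex.norm_real, mul_pow,
    inner_smul_right, mul_assoc]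
  have h1 : hdot e ζ * inner ℂ ζ e = ((‖hdot e ζ‖ ^ 2 : ℝ) : ℂ) := by
    have := Complex.mul_conj' (hdot e ζ)
    rw [hdot_conj] at this
    rw [hdot] at this ⊢
    simpa [hdot] using this
  rw [h1]
  simp only [RCLike.re_eq_complex_re, Real.norm_eq_abs, sq_abs, Complex.re_ofReal_mul,
    Complex.ofReal_re]
  ring

theorem norm_stretch_sq {e : EuclideanSpace ℂ (Fin n)} (he : ‖e‖ = 1) (c s : ℝ)
    (ζ : EuclideanSpace ℂ (Fin n)) :
    ‖stretch e c s ζ‖ ^ 2 = (c * s) ^ 2 * (‖ζ‖ ^ 2 + (s ^ 2 - 1) * ‖hdot e ζ‖ ^ 2) := by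
  rw [stretch_apply, norm_smul, mul_pow, norm_add_smul_unit_sq he, Complex.norm_real, Real.norm_eq_abs,
    sq_abs]
  ring

theorem norm_one_sub_real_mul_sq (x : ℝ) (a : ℂ) :
    ‖1 - (x : ℂ) * a‖ ^ 2 = 1 - 2 * x * a.re + x ^ 2 * ‖a‖ ^ 2 := by
  rw [Complex.sq_norm, Complex.sq_norm, Complex.normSq_apply, Complex.normSq_apply]
  simp
  ring

/-- The ellipsoids `w + c (s² P + s Q) 𝔹`, `s² = 1 - |w|²`, lie in `D(w, r)` for small `c`. -/
theorem exists_stretch_mem_bergBall {r : ℝ} (hr : 0 < r) : ∃ c : ℝ, 0 < c ∧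
    ∀ (n : ℕ) (w : Ball n) (e : EuclideanSpace ℂ (Fin n)), ‖e‖ = 1 → w.1 = (‖w.1‖ : ℂ) • e →
    ∀ ζ, ‖ζ‖ ≤ 1 → ∃ u ∈ bergBall w r, w.1 + stretch e c (√(1 - ‖w.1‖ ^ 2)) ζ = u.1 := by
  have hS := Real.sinh_pos_iff.2 hr
  have hC := Real.cosh_pos r
  have hCS := Real.cosh_sq r
  refine ⟨Real.sinh r / (2 * (Real.sinh r + Real.cosh r)), by positivity, ?_⟩
  set c := Real.sinh r / (2 * (Real.sinh r + Real.cosh r)) with hc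
  have hc0 : 0 < c := by positivity
  have hcm : c * (2 * (Real.sinh r + Real.cosh r)) = Real.sinh r := by
    rw [hc]; field_simp
  have hc1 : c < 1 / 2 := by
    rw [hc, div_lt_iff₀ (by positivity)]; nlinarith
  intro n w e he hw ζ hζ
  have hpos := w.one_sub_norm_sq_pos
  set s := √(1 - ‖w.1‖ ^ 2) with hs
  have hs2 : s ^ 2 = 1 - ‖w.1‖ ^ 2 := Real.sq_sqrt hpos.le
  set t := ‖w.1‖ with ht
  have ht0 : 0 ≤ t := norm_nonneg _
  have ht1 : t < 1 := w.norm_lt_one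
  set a := hdot e ζ with ha
  have ha1 : ‖a‖ ≤ ‖ζ‖ := by simpa [he] using norm_hdot_le e ζ
  have hwe : ∀ v, hdot w.1 v = (t : ℂ) * hdot e v := fun v => by
    conv_lhs => rw [hw]
    simp [hdot]
  have hX : 1 - c ≤ ‖1 - ((c * t : ℝ) : ℂ) * a‖ := by
    have h1 := norm_sub_norm_le (1 : ℂ) (((c * t : ℝ) : ℂ) * a)
    rw [norm_one, norm_mul, Complex.norm_real, Real.norm_of_nonneg (by positivity)] at h1
    have : c * t * ‖a‖ ≤ c * 1 * 1 := by gcongr; exact ha1.trans hζ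
    linarith
  have hu : 1 - ‖w.1 + stretch e c s ζ‖ ^ 2 =
      s ^ 2 * (‖1 - ((c * t : ℝ) : ℂ) * a‖ ^ 2 - c ^ 2 * ‖ζ‖ ^ 2) := by
    have h1 : (inner ℂ w.1 (stretch e c s ζ) : ℂ) = ((t * (c * s ^ 2) : ℝ) : ℂ) * a := by
      have := hwe (stretch e c s ζ)
      rw [hdot_stretch he] at this
      rw [← hdot, this]
      push_cast; ring
    rw [norm_add_sq (𝕜 := ℂ), h1, norm_stretch_sq he, norm_one_sub_real_mul_sq, ← ha, ← ht]
    simp only [RCLike.re_eq_complex_re, Complex.re_ofReal_mul]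
    have : t ^ 2 = 1 - s ^ 2 := by linarith
    rw [mul_pow c t, this]
    ring
  have hd : ‖1 - hdot w.1 (w.1 + stretch e c s ζ)‖ = s ^ 2 * ‖1 - ((c * t : ℝ) : ℂ) * a‖ := by
    have h1 : hdot w.1 (w.1 + stretch e c s ζ) = ((t ^ 2 : ℝ) : ℂ) +
        ((t * (c * s ^ 2) : ℝ) : ℂ) * a := by
      have h2 : hdot w.1 w.1 = ((t ^ 2 : ℝ) : ℂ) := by
        rw [hdot, inner_self_eq_norm_sq_to_K]; push_cast; rfl
      have h3 := hwe (stretch e c s ζ)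
      rw [hdot_stretch he] at h3
      rw [hdot, inner_add_right, ← hdot, ← hdot, h2, h3]
      push_cast; ring
    rw [h1]
    have : t ^ 2 = 1 - s ^ 2 := by linarith
    rw [this]
    have h4 : (1 : ℂ) - (((1 - s ^ 2 : ℝ) : ℂ) + ((t * (c * s ^ 2) : ℝ) : ℂ) * a) =
        ((s ^ 2 : ℝ) : ℂ) * (1 - ((c * t : ℝ) : ℂ) * a) := by push_cast; ring
    rw [h4, norm_mul, Complex.norm_real, Real.norm_of_nonneg (by positivity)]
  generalize ‖1 - ((c * t : ℝ) : ℂ) * a‖ = X at *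
  have hζ2 : ‖ζ‖ ^ 2 ≤ 1 := by nlinarith [norm_nonneg ζ]
  have hcS : c * Real.cosh r < Real.sinh r * (1 - c) := by nlinarith
  have hX2 : Real.cosh r ^ 2 * (c ^ 2 * ‖ζ‖ ^ 2) < Real.sinh r ^ 2 * X ^ 2 := by
    calc Real.cosh r ^ 2 * (c ^ 2 * ‖ζ‖ ^ 2) ≤ Real.cosh r ^ 2 * (c ^ 2 * 1) := by gcongr
      _ = (c * Real.cosh r) ^ 2 := by ring
      _ < (Real.sinh r * (1 - c)) ^ 2 := by gcongr
      _ = Real.sinh r ^ 2 * (1 - c) ^ 2 := by ring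
      _ ≤ _ := by gcongr; linarith
  have hs0 : 0 < s ^ 2 := hs2 ▸ hpos
  have hY : 0 < X ^ 2 - c ^ 2 * ‖ζ‖ ^ 2 := by nlinarith [sq_nonneg (c * ‖ζ‖)]
  have hball : ‖w.1 + stretch e c s ζ‖ < 1 := by
    have : 0 < 1 - ‖w.1 + stretch e c s ζ‖ ^ 2 := by rw [hu]; positivity
    nlinarith [norm_nonneg (w.1 + stretch e c s ζ)]
  refine ⟨⟨_, mem_ball_zero_iff.2 hball⟩, ?_, rfl⟩
  rw [mem_bergBall_iff_cosh hr, hu, hd, ← hs2]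
  have : X ^ 2 < Real.cosh r ^ 2 * (X ^ 2 - c ^ 2 * ‖ζ‖ ^ 2) := by rw [hCS] at hX2 ⊢; nlinarith
  calc (s ^ 2 * X) ^ 2 = s ^ 2 * s ^ 2 * X ^ 2 := by ring
    _ < s ^ 2 * s ^ 2 * (Real.cosh r ^ 2 * (X ^ 2 - c ^ 2 * ‖ζ‖ ^ 2)) := by gcongr
    _ = _ := by ring

end Stretch

/-! ### The sub-mean value property -/

section MeanValue

variable {n : ℕ}

theorem enorm_le_lintegral_circle {g : ℂ → ℂ} (hg : DiffContOnCl ℂ g (Metric.ball 0 1)) :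
    ‖g 0‖ₑ * ENNReal.ofReal (2 * Real.pi) ≤
      ∫⁻ θ in Set.Ioc 0 (2 * Real.pi), ‖g (circleMap 0 1 θ)‖ₑ := by
  have h := DiffContOnCl.circleAverage (f := g) (c := 0) (R := 1) (by simpa using hg)
  have hpi := Real.two_pi_pos
  have h2 : (2 * Real.pi) • g 0 = ∫ θ in (0)..(2 * Real.pi), g (circleMap 0 1 θ) := by
    rw [← h, Real.circleAverage, smul_smul, mul_inv_cancel₀ hpi.ne', one_smul]
  rw [intervalIntegral.integral_of_le hpi.le] at h2
  calc ‖g 0‖ₑ * ENNReal.ofReal (2 * Real.pi) = ‖(2 * Real.pi) • g 0‖ₑ := by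
        rw [enorm_smul, Real.enorm_of_nonneg hpi.le, mul_comm]
    _ ≤ _ := by rw [h2]; exact enorm_integral_le_lintegral_enorm _

theorem lintegral_closedBall_smul_circle (F : EuclideanSpace ℂ (Fin n) → ℝ≥0∞) (θ : ℝ) :
    ∫⁻ ζ in Metric.closedBall 0 1, F (circleMap 0 1 θ • ζ) =
      ∫⁻ ζ in Metric.closedBall 0 1, F ζ := by
  have hc : ‖circleMap 0 1 θ‖ = 1 := by simp
  have hc0 : circleMap 0 1 θ ≠ 0 := by rw [← norm_ne_zero_iff, hc]; exact one_ne_zero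
  let e : EuclideanSpace ℂ (Fin n) ≃ₗᵢ[ℝ] EuclideanSpace ℂ (Fin n) :=
    { (LinearEquiv.smulOfNeZero ℂ (EuclideanSpace ℂ (Fin n)) _ hc0).restrictScalars ℝ with
      norm_map' := fun x => by
        change ‖circleMap 0 1 θ • x‖ = ‖x‖
        rw [norm_smul, hc, one_mul] }
  have he := e.measurePreserving.restrict_preimage_emb
    e.toMeasurableEquiv.measurableEmbedding (Metric.closedBall 0 1)
  have hpre : e ⁻¹' Metric.closedBall 0 1 = Metric.closedBall 0 1 := by
    ext x; simp
  rw [hpre] at he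
  exact he.lintegral_comp_emb e.toMeasurableEquiv.measurableEmbedding F

theorem enorm_mul_volume_le_lintegral {h : EuclideanSpace ℂ (Fin n) → ℂ}
    (hh : DifferentiableOn ℂ h (Metric.ball 0 1)) (w : EuclideanSpace ℂ (Fin n))
    (L : EuclideanSpace ℂ (Fin n) →ₗ[ℂ] EuclideanSpace ℂ (Fin n))
    (hL : ∀ ζ, ‖ζ‖ ≤ 1 → w + L ζ ∈ Metric.ball (0 : EuclideanSpace ℂ (Fin n)) 1) :
    ‖h w‖ₑ * volume (Metric.closedBall (0 : EuclideanSpace ℂ (Fin n)) 1) ≤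
      ∫⁻ ζ in Metric.closedBall 0 1, ‖h (w + L ζ)‖ₑ := by
  have hpi := Real.two_pi_pos
  have hLc : Continuous L := L.continuous_of_finiteDimensional
  have hLd : Differentiable ℂ L := (LinearMap.toContinuousLinearMap L).differentiable
  have h1 : ∀ ζ ∈ Metric.closedBall (0 : EuclideanSpace ℂ (Fin n)) 1,
      ‖h w‖ₑ * ENNReal.ofReal (2 * Real.pi) ≤
        ∫⁻ θ in Set.Ioc 0 (2 * Real.pi), ‖h (w + L (circleMap 0 1 θ • ζ))‖ₑ := by
    intro ζ hζ
    have hmaps : Set.MapsTo (fun ξ : ℂ => w + L (ξ • ζ)) (Metric.closedBall 0 1)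
        (Metric.ball 0 1) := fun ξ hξ => hL _ (by
      rw [norm_smul]
      rw [mem_closedBall_zero_iff] at hξ hζ
      exact mul_le_one₀ hξ (norm_nonneg _) hζ)
    have hd : Differentiable ℂ (fun ξ : ℂ => w + L (ξ • ζ)) :=
      (differentiable_const w).add (hLd.comp (differentiable_id.smul_const ζ))
    have hdo : DifferentiableOn ℂ (fun ξ : ℂ => h (w + L (ξ • ζ))) (Metric.closedBall 0 1) :=
      hh.comp hd.differentiableOn hmaps
    have := enorm_le_lintegral_circle (g := fun ξ : ℂ => h (w + L (ξ • ζ)))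
      (DifferentiableOn.diffContOnCl (by rwa [closure_ball _ one_ne_zero]))
    simpa using this
  set H : EuclideanSpace ℂ (Fin n) → ℝ≥0∞ := (Metric.ball 0 1).indicator fun u => ‖h u‖ₑ with hH
  have hHm : Measurable H := by
    classical
    rw [hH, ← Set.piecewise_eq_indicator]
    exact ContinuousOn.measurable_piecewise hh.continuousOn.enorm continuousOn_const
      Metric.isOpen_ball.measurableSet
  have hHh : ∀ ζ ∈ Metric.closedBall (0 : EuclideanSpace ℂ (Fin n)) 1,
      H (w + L ζ) = ‖h (w + L ζ)‖ₑ := fun ζ hζ =>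
    Set.indicator_of_mem (hL ζ (mem_closedBall_zero_iff.1 hζ)) _
  have hmB := Metric.isClosed_closedBall (x := (0 : EuclideanSpace ℂ (Fin n))) (ε := 1)
    |>.measurableSet
  rw [← setLIntegral_congr_fun hmB hHh]
  have h2 : ∫⁻ _ζ in Metric.closedBall (0 : EuclideanSpace ℂ (Fin n)) 1,
      ‖h w‖ₑ * ENNReal.ofReal (2 * Real.pi) ≤
      ∫⁻ ζ in Metric.closedBall (0 : EuclideanSpace ℂ (Fin n)) 1,
        ∫⁻ θ in Set.Ioc 0 (2 * Real.pi), H (w + L (circleMap 0 1 θ • ζ)) := by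
    refine setLIntegral_mono' hmB fun ζ hζ => (h1 ζ hζ).trans (lintegral_mono fun θ => ?_)
    rw [hHh]
    simpa [norm_smul] using hζ
  rw [lintegral_lintegral_swap, lintegral_congr fun θ =>
    lintegral_closedBall_smul_circle (fun ζ => H (w + L ζ)) θ] at h2
  · simp only [lintegral_const, Measure.restrict_apply_univ, Real.volume_Ioc, sub_zero] at h2
    rw [mul_right_comm] at h2
    exact (ENNReal.mul_le_mul_iff_left (by simpa using hpi) ENNReal.ofReal_ne_top).1 h2
  · refine (hHm.comp ?_).aemeasurable
    have : Continuous fun q : EuclideanSpace ℂ (Fin n) × ℝ => w + L (circleMap 0 1 q.2 • q.1) := by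
      have := continuous_circleMap 0 1
      fun_prop
    exact this.measurable

theorem rpow_enorm_mul_volume_le_lintegral {h : EuclideanSpace ℂ (Fin n) → ℂ}
    (hh : DifferentiableOn ℂ h (Metric.ball 0 1)) (w : EuclideanSpace ℂ (Fin n))
    (L : EuclideanSpace ℂ (Fin n) →ₗ[ℂ] EuclideanSpace ℂ (Fin n))
    (hL : ∀ ζ, ‖ζ‖ ≤ 1 → w + L ζ ∈ Metric.ball (0 : EuclideanSpace ℂ (Fin n)) 1)
    {q : ℝ} (hq : 1 ≤ q) :
    ‖h w‖ₑ ^ q * volume (Metric.closedBall (0 : EuclideanSpace ℂ (Fin n)) 1) ≤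
      ∫⁻ ζ in Metric.closedBall 0 1, ‖h (w + L ζ)‖ₑ ^ q := by
  have hq0 : 0 < q := by linarith
  have h1 := enorm_mul_volume_le_lintegral hh w L hL
  set V := volume (Metric.closedBall (0 : EuclideanSpace ℂ (Fin n)) 1) with hV
  have hV0 : V ≠ 0 := (Metric.measure_closedBall_pos _ _ one_pos).ne'
  have hVt : V ≠ ∞ := measure_closedBall_lt_top.ne
  have hmB := Metric.isClosed_closedBall (x := (0 : EuclideanSpace ℂ (Fin n))) (ε := 1)
    |>.measurableSet
  have hc : ContinuousOn (fun ζ => h (w + L ζ)) (Metric.closedBall 0 1) := by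
    refine hh.continuousOn.comp ?_ fun ζ hζ => hL ζ (mem_closedBall_zero_iff.1 hζ)
    exact (continuous_const.add L.continuous_of_finiteDimensional).continuousOn
  have h2 := eLpNorm'_le_eLpNorm'_mul_rpow_measure_univ (p := 1) (q := q) one_pos hq
    (hc.aestronglyMeasurable (μ := volume) hmB)
  simp only [eLpNorm', ENNReal.rpow_one, div_one, Measure.restrict_apply_univ, ← hV] at h2
  set I := ∫⁻ ζ in Metric.closedBall 0 1, ‖h (w + L ζ)‖ₑ ^ q
  have h3 : (‖h w‖ₑ * V) ^ q ≤ (I ^ (1 / q) * V ^ (1 - 1 / q)) ^ q :=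
    ENNReal.rpow_le_rpow (h1.trans h2) hq0.le
  rw [ENNReal.mul_rpow_of_nonneg _ _ hq0.le, ENNReal.mul_rpow_of_nonneg _ _ hq0.le,
    ← ENNReal.rpow_mul, ← ENNReal.rpow_mul, one_div_mul_cancel hq0.ne', ENNReal.rpow_one, sub_mul,
    one_div_mul_cancel hq0.ne', one_mul] at h3
  have h4 : V ^ q = V * V ^ (q - 1) := by
    rw [ENNReal.rpow_sub _ _ hV0 hVt, ENNReal.rpow_one, ENNReal.mul_div_cancel hV0 hVt]
  rw [h4, ← mul_assoc] at h3
  exact (ENNReal.mul_le_mul_iff_left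
    (ENNReal.rpow_pos (pos_iff_ne_zero.2 hV0) hVt).ne' (ENNReal.rpow_ne_top_of_nonneg (by linarith) hVt)).1 h3

theorem rpow_le_of_comparable {x y K : ℝ} (hx : 0 < x) (hy : 0 < y) (hK : 1 ≤ K)
    (hxy : x ≤ K * y) (hyx : y ≤ K * x) (β : ℝ) : x ^ β ≤ K ^ |β| * y ^ β := by
  have hK0 : 0 < K := by linarith
  rcases le_total 0 β with hβ | hβ
  · rw [abs_of_nonneg hβ, ← Real.mul_rpow hK0.le hy.le]
    exact Real.rpow_le_rpow hx.le hxy hβ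
  · rw [abs_of_nonpos hβ, Real.rpow_neg hK0.le, ← Real.inv_rpow hK0.le,
      ← Real.mul_rpow (inv_nonneg.2 hK0.le) hy.le]
    refine Real.rpow_le_rpow_of_nonpos (by positivity) ?_ hβ
    rwa [inv_mul_le_iff₀ hK0]

theorem rpow_one_sub_norm_sq_le {r : ℝ} (hr : 0 < r) {z w : Ball n} (h : w ∈ bergBall z r)
    (β : ℝ) :
    (1 - ‖w.1‖ ^ 2) ^ β ≤ (4 * Real.cosh r ^ 2) ^ |β| * (1 - ‖z.1‖ ^ 2) ^ β := by
  refine rpow_le_of_comparable w.one_sub_norm_sq_pos z.one_sub_norm_sq_pos ?_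
    (one_sub_norm_sq_comparable hr h) ?_ β
  · nlinarith [Real.one_le_cosh r]
  · exact one_sub_norm_sq_comparable hr ((mem_bergBall_comm _ _).1 h)

theorem Ball.continuous_rpow (β : ℝ) : Continuous fun z : Ball n => (1 - ‖z.1‖ ^ 2) ^ β := by
  refine Continuous.rpow_const (by fun_prop) fun z => Or.inl z.one_sub_norm_sq_pos.ne'

theorem setLIntegral_weightedVolume (α : ℝ) {s : Set (Ball n)} (hs : MeasurableSet s)
    {f : Ball n → ℝ≥0∞} (hf : Measurable f) :
    ∫⁻ z in s, f z ∂weightedVolume n α =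
      ∫⁻ z in s, ENNReal.ofReal ((1 - ‖z.1‖ ^ 2) ^ α) * f z
        ∂(Measure.comap Subtype.val (volume : Measure (EuclideanSpace ℂ (Fin n)))) := by
  have hm : Measurable fun z : Ball n => ENNReal.ofReal ((1 - ‖z.1‖ ^ 2) ^ α) :=
    (Ball.continuous_rpow α).measurable.ennreal_ofReal
  rw [weightedVolume, restrict_withDensity hs, lintegral_withDensity_eq_lintegral_mul _ hm hf]
  rfl

theorem lintegral_comp_stretch {e : EuclideanSpace ℂ (Fin n)} (he : ‖e‖ = 1) {c s : ℝ}
    (hc : 0 < c) (hs : 0 < s) (w : EuclideanSpace ℂ (Fin n))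
    {F : EuclideanSpace ℂ (Fin n) → ℝ≥0∞} (hF : Measurable F) :
    ENNReal.ofReal (c ^ (2 * n) * (s ^ 2) ^ (n + 1)) * ∫⁻ ζ, F (w + stretch e c s ζ) =
      ∫⁻ x, F x := by
  have hd := det_stretch he c s
  have hpos : 0 < c ^ (2 * n) * (s ^ 2) ^ (n + 1) := by positivity
  have hmap := Measure.map_linearMap_addHaar_eq_smul_addHaar
    (volume : Measure (EuclideanSpace ℂ (Fin n)))
    (f := (stretch e c s).restrictScalars ℝ) (by rw [hd]; exact hpos.ne')
  rw [hd, abs_of_pos (inv_pos.2 hpos)] at hmap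
  have hLm : Measurable (stretch e c s) := (stretch e c s).continuous_of_finiteDimensional.measurable
  have h1 : ∫⁻ ζ, F (w + stretch e c s ζ) =
      ∫⁻ y, F (w + y) ∂(Measure.map ((stretch e c s).restrictScalars ℝ) volume) :=
    (lintegral_map (hF.comp (measurable_const_add w)) hLm).symm
  rw [h1, hmap, lintegral_smul_measure, lintegral_add_left_eq_self, smul_eq_mul, ← mul_assoc,
    ← ENNReal.ofReal_mul hpos.le, mul_inv_cancel₀ hpos.ne', ENNReal.ofReal_one, one_mul]

theorem exists_unit_vector (hn : 1 ≤ n) (w : EuclideanSpace ℂ (Fin n)) :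
    ∃ e : EuclideanSpace ℂ (Fin n), ‖e‖ = 1 ∧ w = (‖w‖ : ℂ) • e := by
  by_cases h : w = 0
  · refine ⟨EuclideanSpace.single ⟨0, hn⟩ 1, by simp, by simp [h]⟩
  · have hw : ‖w‖ ≠ 0 := norm_ne_zero_iff.2 h
    refine ⟨((‖w‖⁻¹ : ℝ) : ℂ) • w, ?_, ?_⟩
    · rw [norm_smul, Complex.norm_real, norm_inv, norm_norm, inv_mul_cancel₀ hw]
    · rw [smul_smul, ← Complex.ofReal_mul, mul_inv_cancel₀ hw, Complex.ofReal_one, one_smul]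

/-- The sub-mean value property of `|h|^q` over the balls of the Bergman metric. -/
theorem exists_rpow_enorm_le_lintegral_bergBall (hn : 1 ≤ n) (α : ℝ) {r : ℝ} (hr : 0 < r) {q : ℝ}
    (hq : 1 ≤ q) : ∃ C : ℝ≥0, ∀ h : EuclideanSpace ℂ (Fin n) → ℂ,
      DifferentiableOn ℂ h (Metric.ball 0 1) → ∀ w : Ball n,
      ENNReal.ofReal ((1 - ‖w.1‖ ^ 2) ^ (n + 1 + α)) * ‖h w.1‖ₑ ^ q ≤
        C * ∫⁻ u in bergBall w r, ‖h u.1‖ₑ ^ q ∂weightedVolume n α := by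
  obtain ⟨c, hc, hE⟩ := exists_stretch_mem_bergBall hr
  set V := volume (Metric.closedBall (0 : EuclideanSpace ℂ (Fin n)) 1) with hV
  have hV0 : V ≠ 0 := (Metric.measure_closedBall_pos _ _ one_pos).ne'
  have hVt : V ≠ ∞ := measure_closedBall_lt_top.ne
  set K := (4 * Real.cosh r ^ 2) ^ |α| with hK
  have hK0 : 0 < K := by have := Real.cosh_pos r; positivity
  refine ⟨(ENNReal.ofReal K * (V * ENNReal.ofReal (c ^ (2 * n)))⁻¹).toNNReal, fun h hh w => ?_⟩
  have hfin : ENNReal.ofReal K * (V * ENNReal.ofReal (c ^ (2 * n)))⁻¹ ≠ ∞ :=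
    ENNReal.mul_ne_top ENNReal.ofReal_ne_top
      (ENNReal.inv_ne_top.2 (mul_ne_zero hV0 (by simpa using by positivity)))
  rw [ENNReal.coe_toNNReal hfin]
  obtain ⟨e, he, hwe⟩ := exists_unit_vector hn w.1
  have hE' := hE n w e he hwe
  have hpos := w.one_sub_norm_sq_pos
  set s := √(1 - ‖w.1‖ ^ 2) with hs
  have hs0 : 0 < s := Real.sqrt_pos.2 hpos
  have hs2 : s ^ 2 = 1 - ‖w.1‖ ^ 2 := Real.sq_sqrt hpos.le
  have h1 := rpow_enorm_mul_volume_le_lintegral hh w.1 (stretch e c s)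
    (fun ζ hζ => by obtain ⟨u, -, hu⟩ := hE' ζ hζ; rw [hu]; exact u.2) hq
  set D : Set (EuclideanSpace ℂ (Fin n)) := Subtype.val '' bergBall w r with hD
  have hDm : MeasurableSet D :=
    (MeasurableEmbedding.subtype_coe Metric.isOpen_ball.measurableSet).measurableSet_image.2
      (measurableSet_bergBall hr w)
  set F : EuclideanSpace ℂ (Fin n) → ℝ≥0∞ := D.indicator fun u => ‖h u‖ₑ ^ q with hF
  have hFm : Measurable F := by
    classical
    rw [hF, ← Set.piecewise_eq_indicator]
    exact ContinuousOn.measurable_piecewise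
      ((ENNReal.continuous_rpow_const.comp_continuousOn hh.continuousOn.enorm).mono
        (by rintro _ ⟨u, -, rfl⟩; exact u.2)) continuousOn_const hDm
  have h2 : ∫⁻ ζ in Metric.closedBall 0 1, ‖h (w.1 + stretch e c s ζ)‖ₑ ^ q ≤
      ∫⁻ ζ, F (w.1 + stretch e c s ζ) := by
    refine le_trans (le_of_eq ?_) (setLIntegral_le_lintegral (Metric.closedBall 0 1) _)
    refine setLIntegral_congr_fun Metric.isClosed_closedBall.measurableSet fun ζ hζ => ?_
    obtain ⟨u, hu, huw⟩ := hE' ζ (mem_closedBall_zero_iff.1 hζ)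
    exact (Set.indicator_of_mem (s := D) (a := w.1 + stretch e c s ζ) ⟨u, hu, huw.symm⟩
      fun u => ‖h u‖ₑ ^ q).symm
  have h3 : ENNReal.ofReal (c ^ (2 * n) * (s ^ 2) ^ (n + 1)) * (‖h w.1‖ₑ ^ q * V) ≤
      ∫⁻ u in bergBall w r, ‖h u.1‖ₑ ^ q
        ∂(Measure.comap Subtype.val (volume : Measure (EuclideanSpace ℂ (Fin n)))) := by
    calc _ ≤ ENNReal.ofReal (c ^ (2 * n) * (s ^ 2) ^ (n + 1)) *
          ∫⁻ ζ, F (w.1 + stretch e c s ζ) := by gcongr; exact h1.trans h2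
      _ = ∫⁻ x in D, ‖h x‖ₑ ^ q := by
        rw [lintegral_comp_stretch he hc hs0 w.1 hFm, hF, lintegral_indicator hDm]
      _ = _ := (setLIntegral_subtype Metric.isOpen_ball.measurableSet (bergBall w r)
          fun x => ‖h x‖ₑ ^ q).symm
  have hcm : Continuous fun u : Ball n => ‖h u.1‖ₑ ^ q :=
    ENNReal.continuous_rpow_const.comp
      (continuousOn_iff_continuous_domRestrict.1 hh.continuousOn).enorm
  rw [setLIntegral_weightedVolume α (measurableSet_bergBall hr w) hcm.measurable]
  have h4 : ENNReal.ofReal ((s ^ 2) ^ α) * ∫⁻ u in bergBall w r, ‖h u.1‖ₑ ^ q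
        ∂(Measure.comap Subtype.val (volume : Measure (EuclideanSpace ℂ (Fin n)))) ≤
      ENNReal.ofReal K * ∫⁻ z in bergBall w r, ENNReal.ofReal ((1 - ‖z.1‖ ^ 2) ^ α) * ‖h z.1‖ₑ ^ q
        ∂(Measure.comap Subtype.val (volume : Measure (EuclideanSpace ℂ (Fin n)))) := by
    rw [← lintegral_const_mul' _ _ ENNReal.ofReal_ne_top,
      ← lintegral_const_mul' _ _ ENNReal.ofReal_ne_top]
    refine setLIntegral_mono' (measurableSet_bergBall hr w) fun u hu => ?_
    rw [← mul_assoc, ← ENNReal.ofReal_mul hK0.le]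
    gcongr
    rw [hs2]
    exact rpow_one_sub_norm_sq_le hr ((mem_bergBall_comm _ _).1 hu) α
  have hA0 : V * ENNReal.ofReal (c ^ (2 * n)) ≠ 0 := mul_ne_zero hV0 (by simpa using by positivity)
  have hAt : V * ENNReal.ofReal (c ^ (2 * n)) ≠ ∞ := ENNReal.mul_ne_top hVt ENNReal.ofReal_ne_top
  rw [mul_right_comm, ← div_eq_mul_inv, ENNReal.le_div_iff_mul_le (Or.inl hA0)
    (Or.inl hAt)]
  refine le_trans (le_of_eq ?_) ((mul_le_mul_right h3 (ENNReal.ofReal ((s ^ 2) ^ α))).trans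
    h4)
  have h5 : (1 - ‖w.1‖ ^ 2) ^ ((n : ℝ) + 1 + α) = (s ^ 2) ^ α * (s ^ 2) ^ (n + 1) := by
    rw [hs2, Real.rpow_add hpos, mul_comm]
    congr 1
    rw [← Real.rpow_natCast (1 - ‖w.1‖ ^ 2) (n + 1), Nat.cast_add_one]
  rw [h5, ENNReal.ofReal_mul (by positivity), ENNReal.ofReal_mul (by positivity)]
  ring

end MeanValue

/-! ### The Forelli–Rudin estimate -/

section ForelliRudin

variable {n : ℕ}

theorem hdot_smul_right (z w : EuclideanSpace ℂ (Fin n)) (c : ℂ) :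
    hdot z (c • w) = c * hdot z w := inner_smul_right _ _ _

/-- The volume of the nonisotropic ball `{|1 - conj z · w| < δ}`. -/
theorem volume_nonisotropic_le (hn : 1 ≤ n) {z : EuclideanSpace ℂ (Fin n)} (hz : ‖z‖ ≤ 1) {δ : ℝ}
    (hδ : 0 < δ) :
    volume {w : EuclideanSpace ℂ (Fin n) | ‖w‖ ≤ 1 ∧ ‖1 - hdot z w‖ < δ} ≤
      ENNReal.ofReal (2 ^ (2 * n) * δ ^ (n + 1)) *
        volume (Metric.closedBall (0 : EuclideanSpace ℂ (Fin n)) 2) := by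
  obtain ⟨e, he, hze⟩ := exists_unit_vector hn z
  set S := {w : EuclideanSpace ℂ (Fin n) | ‖w‖ ≤ 1 ∧ ‖1 - hdot z w‖ < δ} with hS
  have hSm : MeasurableSet S := by
    have hc : Continuous fun w => hdot z w := continuous_hdot.comp (Continuous.prodMk_right z)
    exact (isClosed_le continuous_norm continuous_const).measurableSet.inter
      (isOpen_lt (continuous_const.sub hc).norm continuous_const).measurableSet
  have hs2 : √δ ^ 2 = δ := Real.sq_sqrt hδ.le
  have h1 := lintegral_comp_stretch he (c := 2) two_pos (Real.sqrt_pos.2 hδ) e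
    (F := S.indicator 1) (measurable_one.indicator hSm)
  rw [lintegral_indicator_one hSm, hs2] at h1
  rw [← h1]
  gcongr
  rw [← lintegral_indicator_one Metric.isClosed_closedBall.measurableSet]
  refine lintegral_mono fun ζ => ?_
  by_cases hζ : e + stretch e 2 (√δ) ζ ∈ S
  swap
  · rw [Set.indicator_of_notMem hζ]; exact zero_le
  suffices hmem : ζ ∈ Metric.closedBall (0 : EuclideanSpace ℂ (Fin n)) 2 by
    rw [Set.indicator_of_mem hζ, Set.indicator_of_mem hmem]
    exact le_rfl
  obtain ⟨hw1, hw2⟩ := hζ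
  set w := e + stretch e 2 (√δ) ζ with hw
  have hee : hdot e e = 1 := by rw [hdot, inner_self_eq_norm_sq_to_K, he]; simp
  have hb : hdot e w = 1 + ((2 * δ : ℝ) : ℂ) * hdot e ζ := by
    have := hdot_stretch he 2 (√δ) ζ
    rw [hs2] at this
    rw [hw, hdot, inner_add_right, ← hdot, ← hdot, hee, this]
  have hzw : hdot z w = (‖z‖ : ℂ) * hdot e w := by
    conv_lhs => rw [hze]
    simp [hdot]
  have hb1 : ‖hdot e w‖ ≤ 1 := (norm_hdot_le e w).trans (by rw [he, one_mul]; exact hw1)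
  have hz1 : 1 - ‖z‖ ≤ δ := by
    have h2 := norm_sub_norm_le (1 : ℂ) (hdot z w)
    rw [hzw, norm_one, norm_mul, Complex.norm_real, norm_norm, ← hzw] at h2
    nlinarith [norm_nonneg z]
  have hbδ : ‖1 - hdot e w‖ ≤ 2 * δ := by
    have h3 : 1 - hdot e w = (1 - hdot z w) - ((1 - ‖z‖ : ℝ) : ℂ) * hdot e w := by
      rw [hzw]; push_cast; ring
    rw [h3]
    refine (norm_sub_le _ _).trans ?_
    rw [norm_mul, Complex.norm_real, Real.norm_of_nonneg (by linarith)]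
    nlinarith [norm_nonneg (hdot e w)]
  have ha : ‖hdot e ζ‖ ≤ 1 := by
    rw [hb, sub_add_cancel_left, norm_neg, norm_mul, Complex.norm_real,
      Real.norm_of_nonneg (by positivity)] at hbδ
    exact le_of_mul_le_mul_left (by linarith) (by positivity : 0 < 2 * δ)
  have hwe : ‖stretch e 2 (√δ) ζ‖ ^ 2 ≤ 4 * δ := by
    have h4 : stretch e 2 (√δ) ζ = w - e := by rw [hw]; abel
    have h5 : (inner ℂ w e : ℂ).re = (hdot e w).re := by
      rw [← hdot_conj w e]; rfl
    rw [h4, norm_sub_sq (𝕜 := ℂ), he, RCLike.re_eq_complex_re, h5]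
    have h6 : (1 - hdot e w).re ≤ 2 * δ := (Complex.re_le_norm _).trans hbδ
    simp only [Complex.sub_re, Complex.one_re] at h6
    nlinarith [norm_nonneg w]
  rw [norm_stretch_sq he, mul_pow, hs2] at hwe
  have h7 : ‖ζ‖ ^ 2 + (δ - 1) * ‖hdot e ζ‖ ^ 2 ≤ 1 := by
    refine le_of_mul_le_mul_left ?_ (by positivity : 0 < 2 ^ 2 * δ)
    linarith
  have h8 : ‖hdot e ζ‖ ^ 2 ≤ 1 := by nlinarith [norm_nonneg (hdot e ζ)]
  rw [mem_closedBall_zero_iff]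
  nlinarith [norm_nonneg ζ, sq_nonneg ‖hdot e ζ‖]

theorem lintegral_eq_lintegral_polar {F : EuclideanSpace ℂ (Fin n) → ℝ≥0∞} (hF : Measurable F)
    (hn : 1 ≤ n) :
    ∫⁻ x, F x = ∫⁻ s : Set.Ioi (0 : ℝ),
      ∫⁻ ζ : Metric.sphere (0 : EuclideanSpace ℂ (Fin n)) 1, F (s.1 • ζ.1)
        ∂(volume : Measure (EuclideanSpace ℂ (Fin n))).toSphere
        ∂Measure.volumeIoiPow (Module.finrank ℝ (EuclideanSpace ℂ (Fin n)) - 1) := by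
  have : Nonempty (Fin n) := ⟨⟨0, hn⟩⟩
  have hcm : Continuous fun q : Metric.sphere (0 : EuclideanSpace ℂ (Fin n)) 1 × Set.Ioi (0 : ℝ) =>
      q.2.1 • q.1.1 := by fun_prop
  rw [← lintegral_prod_symm' (fun q : Metric.sphere (0 : EuclideanSpace ℂ (Fin n)) 1 ×
      Set.Ioi (0 : ℝ) => F (q.2.1 • q.1.1)) (hF.comp hcm.measurable),
    ← (Measure.measurePreserving_homeomorphUnitSphereProd volume).lintegral_comp_emb
      (Homeomorph.measurableEmbedding _)]
  have h1 : ∀ a : ({0}ᶜ : Set (EuclideanSpace ℂ (Fin n))),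
      F ((homeomorphUnitSphereProd _ a).2.1 • (homeomorphUnitSphereProd _ a).1.1) = F a := by
    intro a
    have : a.1 ≠ 0 := a.2
    simp [homeomorphUnitSphereProd, norm_ne_zero_iff.2 this]
  rw [lintegral_congr h1, lintegral_subtype_comap (measurableSet_singleton _).compl,
    restrict_compl_singleton]

theorem le_volumeIoiPow_Ico (m : ℕ) {a : ℝ} (ha : 0 < a) (ha1 : a < 1) :
    ENNReal.ofReal ((1 - a) / (m + 1)) ≤ Measure.volumeIoiPow m
      (Set.Ico ⟨a, Set.mem_Ioi.2 ha⟩ ⟨1, Set.mem_Ioi.2 one_pos⟩ : Set (Set.Ioi (0 : ℝ))) := by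
  have h : (Set.Ico ⟨a, Set.mem_Ioi.2 ha⟩ ⟨1, Set.mem_Ioi.2 one_pos⟩ : Set (Set.Ioi (0 : ℝ))) =
      Set.Iio ⟨1, Set.mem_Ioi.2 one_pos⟩ \ Set.Iio ⟨a, Set.mem_Ioi.2 ha⟩ := by
    ext x; simp
  rw [h, measure_sdiff (Set.Iio_subset_Iio (by exact_mod_cast ha1.le))
    measurableSet_Iio.nullMeasurableSet (by rw [Measure.volumeIoiPow_apply_Iio]; simp),
    Measure.volumeIoiPow_apply_Iio, Measure.volumeIoiPow_apply_Iio,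
    ← ENNReal.ofReal_sub _ (by positivity)]
  apply ENNReal.ofReal_le_ofReal
  rw [← sub_div, one_pow]
  have : a ^ (m + 1) ≤ a := pow_le_of_le_one ha.le ha1.le (by simp)
  gcongr

theorem toSphere_nonisotropic_le (hn : 1 ≤ n) : ∃ C : ℝ≥0, ∀ z : EuclideanSpace ℂ (Fin n),
    ‖z‖ ≤ 1 → ∀ δ : ℝ, 0 < δ →
    (volume : Measure (EuclideanSpace ℂ (Fin n))).toSphere {ζ | ‖1 - hdot z ζ.1‖ < δ} ≤
      C * ENNReal.ofReal (δ ^ n) := by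
  set σ := (volume : Measure (EuclideanSpace ℂ (Fin n))).toSphere with hσ
  set V := volume (Metric.closedBall (0 : EuclideanSpace ℂ (Fin n)) 2) with hV
  have hVt : V ≠ ∞ := measure_closedBall_lt_top.ne
  set m := Module.finrank ℝ (EuclideanSpace ℂ (Fin n)) - 1 with hm
  set A : ℝ≥0∞ := ENNReal.ofReal (2 ^ (2 * n) * 2 ^ (n + 1) * (m + 1)) * V with hA
  have hAt : A ≠ ∞ := ENNReal.mul_ne_top ENNReal.ofReal_ne_top hVt
  have hσt : σ Set.univ ≠ ∞ := measure_ne_top _ _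
  refine ⟨(A + σ Set.univ).toNNReal, fun z hz δ hδ => ?_⟩
  rw [ENNReal.coe_toNNReal (ENNReal.add_ne_top.2 ⟨hAt, hσt⟩), add_mul]
  rcases le_or_gt 1 δ with h1 | h1
  · refine le_trans ?_ le_add_self
    have : 1 ≤ ENNReal.ofReal (δ ^ n) := by
      rw [ENNReal.one_le_ofReal]; exact one_le_pow₀ h1
    calc _ ≤ σ Set.univ := measure_mono (Set.subset_univ _)
      _ = σ Set.univ * 1 := (mul_one _).symm
      _ ≤ _ := by gcongr
  refine le_trans ?_ le_self_add
  have hc : Continuous fun w => hdot z w := continuous_hdot.comp (Continuous.prodMk_right z)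
  set T : Set (Metric.sphere (0 : EuclideanSpace ℂ (Fin n)) 1) := {ζ | ‖1 - hdot z ζ.1‖ < δ} with hT
  have hTm : MeasurableSet T := (isOpen_lt
    (continuous_const.sub (hc.comp continuous_subtype_val)).norm continuous_const).measurableSet
  set S := {w : EuclideanSpace ℂ (Fin n) | ‖w‖ ≤ 1 ∧ ‖1 - hdot z w‖ < 2 * δ} with hS
  have hSm : MeasurableSet S :=
    (isClosed_le continuous_norm continuous_const).measurableSet.inter
      (isOpen_lt (continuous_const.sub hc).norm continuous_const).measurableSet
  have hvol := volume_nonisotropic_le hn hz (δ := 2 * δ) (by positivity)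
  rw [← hS, ← lintegral_indicator_one hSm,
    lintegral_eq_lintegral_polar (measurable_one.indicator hSm) hn, ← hσ, ← hm, ← hV] at hvol
  have hδ1 : 0 < 1 - δ := by linarith
  set J : Set (Set.Ioi (0 : ℝ)) := Set.Ico ⟨1 - δ, hδ1⟩ ⟨1, Set.mem_Ioi.2 one_pos⟩ with hJ
  have hlow : ENNReal.ofReal (δ / (m + 1)) * σ T ≤ ∫⁻ s : Set.Ioi (0 : ℝ),
      ∫⁻ ζ, S.indicator 1 (s.1 • ζ.1) ∂σ ∂Measure.volumeIoiPow m := by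
    have hJm := le_volumeIoiPow_Ico m hδ1 (by linarith : 1 - δ < 1)
    rw [sub_sub_cancel] at hJm
    calc _ ≤ Measure.volumeIoiPow m J * σ T := by gcongr
      _ = ∫⁻ _s in J, σ T ∂Measure.volumeIoiPow m := by
        rw [setLIntegral_const, mul_comm]
      _ ≤ ∫⁻ s in J, ∫⁻ ζ, S.indicator 1 (s.1 • ζ.1) ∂σ ∂Measure.volumeIoiPow m := by
        refine setLIntegral_mono' measurableSet_Ico fun s hs => ?_
        rw [← lintegral_indicator_one hTm]
        refine lintegral_mono fun ζ => ?_
        by_cases hζ : ζ ∈ T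
        swap
        · rw [Set.indicator_of_notMem hζ]; exact zero_le
        have hs0 : 0 < s.1 := s.2
        have hs1 : 1 - δ ≤ s.1 := hs.1
        have hs2 : s.1 < 1 := hs.2
        have hζ1 : ‖ζ.1‖ = 1 := by simp
        have hmem : s.1 • ζ.1 ∈ S := by
          refine ⟨by rw [norm_smul, hζ1, Real.norm_of_nonneg hs0.le]; linarith, ?_⟩
          have h2 : ‖1 - hdot z ζ.1‖ < δ := hζ
          have h3 : hdot z (s.1 • ζ.1) = (s.1 : ℂ) * hdot z ζ.1 := by
            rw [← hdot_smul_right]; rfl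
          have h4 : 1 - (s.1 : ℂ) * hdot z ζ.1 =
              (1 - hdot z ζ.1) + ((1 - s.1 : ℝ) : ℂ) * hdot z ζ.1 := by push_cast; ring
          have h5 : ‖hdot z ζ.1‖ ≤ 1 := (norm_hdot_le _ _).trans (by rw [hζ1, mul_one]; exact hz)
          rw [h3, h4]
          refine (norm_add_le _ _).trans_lt ?_
          rw [norm_mul, Complex.norm_real, Real.norm_of_nonneg (by linarith)]
          nlinarith [norm_nonneg (hdot z ζ.1)]
        rw [Set.indicator_of_mem hζ, Set.indicator_of_mem hmem]
        exact le_rfl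
      _ ≤ _ := setLIntegral_le_lintegral _ _
  have h6 := hlow.trans hvol
  have hpos : (0 : ℝ) < δ / (m + 1) := by positivity
  refine (ENNReal.mul_le_mul_iff_right (a := ENNReal.ofReal (δ / (m + 1))) (by simpa using hpos)
    ENNReal.ofReal_ne_top).1 (h6.trans (le_of_eq ?_))
  rw [hA, mul_right_comm, ← mul_assoc, ← ENNReal.ofReal_mul (by positivity),
    ← ENNReal.ofReal_mul (by positivity)]
  congr 2
  field_simp
  ring

theorem lintegral_one_sub_rpow {t : ℝ} (ht : -1 < t) {δ : ℝ} (hδ : 0 < δ) :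
    ∫⁻ s in Set.Ioo (1 - δ) 1, ENNReal.ofReal ((1 - s) ^ t) =
      ENNReal.ofReal (δ ^ (t + 1) / (t + 1)) := by
  have h1 : IntervalIntegrable (fun s : ℝ => (1 - s) ^ t) volume (1 - δ) 1 := by
    have := (intervalIntegral.intervalIntegrable_rpow' (a := δ) (b := 0) ht).comp_sub_left 1
    simpa using this
  have h2 : ∫ s in (1 - δ)..1, (1 - s) ^ t = δ ^ (t + 1) / (t + 1) := by
    rw [intervalIntegral.integral_comp_sub_left (fun x => x ^ t) 1, sub_self, sub_sub_cancel,
      integral_rpow (Or.inl ht), Real.zero_rpow (by linarith), sub_zero]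
  have hle : 1 - δ ≤ 1 := by linarith
  rw [setLIntegral_congr Ioo_ae_eq_Ioc, ← ofReal_integral_eq_lintegral_ofReal h1.1,
    ← intervalIntegral.integral_of_le hle, h2]
  filter_upwards [ae_restrict_mem measurableSet_Ioc] with s hs
  exact Real.rpow_nonneg (by linarith [hs.2]) t

theorem lintegral_volumeIoiPow (m : ℕ) {G : ℝ → ℝ≥0∞} (hG : Measurable G) :
    ∫⁻ s : Set.Ioi (0 : ℝ), G s.1 ∂Measure.volumeIoiPow m =
      ∫⁻ s in Set.Ioi (0 : ℝ), ENNReal.ofReal (s ^ m) * G s := by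
  have hm : Measurable fun s : ℝ => ENNReal.ofReal (s ^ m) := by fun_prop
  rw [Measure.volumeIoiPow, lintegral_withDensity_eq_lintegral_mul _
    (f := fun r : Set.Ioi (0 : ℝ) => ENNReal.ofReal (r.1 ^ m)) (g := fun r => G r.1)
    (hm.comp measurable_subtype_coe) (hG.comp measurable_subtype_coe)]
  exact lintegral_subtype_comap measurableSet_Ioi fun s => ENNReal.ofReal (s ^ m) * G s

theorem weightedVolume_nonisotropic_le (hn : 1 ≤ n) {t : ℝ} (ht : -1 < t) : ∃ C : ℝ≥0,
    ∀ z : Ball n, ∀ δ : ℝ, 0 < δ →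
    weightedVolume n t {w | ‖1 - hdot z.1 w.1‖ < δ} ≤ C * ENNReal.ofReal (δ ^ (n + 1 + t)) := by
  obtain ⟨C, hC⟩ := toSphere_nonisotropic_le hn
  set σ := (volume : Measure (EuclideanSpace ℂ (Fin n))).toSphere with hσ
  set m := Module.finrank ℝ (EuclideanSpace ℂ (Fin n)) - 1 with hm
  refine ⟨Real.toNNReal (2 ^ |t| / (t + 1)) * C, fun z δ hδ => ?_⟩
  have hc : Continuous fun w => hdot z.1 w := continuous_hdot.comp (Continuous.prodMk_right z.1)
  set S' : Set (Ball n) := {w | ‖1 - hdot z.1 w.1‖ < δ} with hS'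
  have hSm' : MeasurableSet S' := (isOpen_lt
    (continuous_const.sub (hc.comp continuous_subtype_val)).norm continuous_const).measurableSet
  set S := {w : EuclideanSpace ℂ (Fin n) | ‖w‖ < 1 ∧ ‖1 - hdot z.1 w‖ < δ} with hS
  have hSm : MeasurableSet S := (isOpen_lt continuous_norm continuous_const).measurableSet.inter
    (isOpen_lt (continuous_const.sub hc).norm continuous_const).measurableSet
  have hSS : Subtype.val '' S' = S := by
    ext x
    constructor
    · rintro ⟨u, hu, rfl⟩
      exact ⟨mem_ball_zero_iff.1 u.2, hu⟩
    · rintro ⟨h1, h2⟩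
      exact ⟨⟨x, mem_ball_zero_iff.2 h1⟩, h2, rfl⟩
  have hwm : Measurable fun x : EuclideanSpace ℂ (Fin n) => ENNReal.ofReal ((1 - ‖x‖ ^ 2) ^ t) := by
    fun_prop
  set F : EuclideanSpace ℂ (Fin n) → ℝ≥0∞ :=
    S.indicator fun x => ENNReal.ofReal ((1 - ‖x‖ ^ 2) ^ t) with hF
  have h1 : weightedVolume n t S' = ∫⁻ x, F x := by
    rw [← setLIntegral_one, setLIntegral_weightedVolume t hSm' measurable_const]
    simp only [mul_one]
    rw [setLIntegral_subtype Metric.isOpen_ball.measurableSet S'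
      fun x => ENNReal.ofReal ((1 - ‖x‖ ^ 2) ^ t), hSS, lintegral_indicator hSm]
  set G : ℝ → ℝ≥0∞ := (Set.Ioo (1 - δ) 1).indicator fun s =>
    ENNReal.ofReal ((1 - s ^ 2) ^ t) * (C * ENNReal.ofReal (δ ^ n)) with hG
  have hGm : Measurable G := by
    refine Measurable.indicator ?_ measurableSet_Ioo
    fun_prop
  have h2 : ∀ s : Set.Ioi (0 : ℝ), ∫⁻ ζ, F (s.1 • ζ.1) ∂σ ≤ G s.1 := by
    intro s
    have hs0 : 0 < s.1 := s.2
    have hnorm : ∀ ζ : Metric.sphere (0 : EuclideanSpace ℂ (Fin n)) 1, ‖s.1 • ζ.1‖ = s.1 := by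
      intro ζ
      rw [norm_smul, Real.norm_of_nonneg hs0.le]
      simp
    by_cases hs : s.1 ∈ Set.Ioo (1 - δ) 1
    · have hT : MeasurableSet {ζ : Metric.sphere (0 : EuclideanSpace ℂ (Fin n)) 1 |
          ‖1 - hdot ((s.1 : ℂ) • z.1) ζ.1‖ < δ} :=
        (isOpen_lt (continuous_const.sub ((continuous_hdot.comp (Continuous.prodMk_right _)).comp
          continuous_subtype_val)).norm continuous_const).measurableSet
      have hsz : ‖(s.1 : ℂ) • z.1‖ ≤ 1 := by
        rw [norm_smul, Complex.norm_real, Real.norm_of_nonneg hs0.le]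
        exact mul_le_one₀ hs.2.le (norm_nonneg _) z.norm_lt_one.le
      rw [hG, Set.indicator_of_mem hs]
      refine le_trans ?_ (mul_le_mul_right (hC _ hsz δ hδ) _)
      rw [← lintegral_indicator_one hT, ← lintegral_const_mul' _ _ ENNReal.ofReal_ne_top]
      refine lintegral_mono fun ζ => ?_
      by_cases hmem : s.1 • ζ.1 ∈ S
      swap
      · rw [hF, Set.indicator_of_notMem hmem]; exact zero_le
      have hmem' : ζ ∈ {ζ : Metric.sphere (0 : EuclideanSpace ℂ (Fin n)) 1 |
          ‖1 - hdot ((s.1 : ℂ) • z.1) ζ.1‖ < δ} := by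
        have h3 := hmem.2
        have h4 : hdot ((s.1 : ℂ) • z.1) ζ.1 = hdot z.1 (s.1 • ζ.1) := by
          have : s.1 • ζ.1 = (s.1 : ℂ) • ζ.1 := rfl
          rw [this, hdot, hdot, inner_smul_left, inner_smul_right, Complex.conj_ofReal]
        change ‖1 - hdot ((s.1 : ℂ) • z.1) ζ.1‖ < δ
        rwa [h4]
      rw [hF, Set.indicator_of_mem hmem, Set.indicator_of_mem hmem', hnorm ζ]
      simp
    · rw [hG, Set.indicator_of_notMem hs]
      refine le_of_eq ?_
      rw [← lintegral_zero (μ := σ)]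
      refine lintegral_congr fun ζ => ?_
      refine Set.indicator_of_notMem (fun hmem => hs ?_) _
      obtain ⟨h3, h4⟩ := hmem
      rw [hnorm] at h3
      refine ⟨?_, h3⟩
      have h5 := norm_sub_norm_le (1 : ℂ) (hdot z.1 (s.1 • ζ.1))
      have h6 := norm_hdot_le z.1 (s.1 • ζ.1)
      rw [hnorm] at h6
      rw [norm_one] at h5
      nlinarith [z.norm_lt_one]
  rw [h1, lintegral_eq_lintegral_polar (hF ▸ hwm.indicator hSm) hn, ← hσ, ← hm]
  refine (lintegral_mono h2).trans ?_
  rw [lintegral_volumeIoiPow m hGm]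
  have hδn : ENNReal.ofReal (δ ^ n) ≠ ∞ := ENNReal.ofReal_ne_top
  calc ∫⁻ s in Set.Ioi (0 : ℝ), ENNReal.ofReal (s ^ m) * G s
      ≤ ∫⁻ s, (Set.Ioo (1 - δ) 1).indicator (fun s => ENNReal.ofReal (2 ^ |t|) *
          (C * ENNReal.ofReal (δ ^ n)) * ENNReal.ofReal ((1 - s) ^ t)) s := by
        refine le_trans (setLIntegral_mono' measurableSet_Ioi fun s hs => ?_)
          (setLIntegral_le_lintegral (Set.Ioi 0) _)
        by_cases hs1 : s ∈ Set.Ioo (1 - δ) 1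
        swap
        · rw [hG, Set.indicator_of_notMem hs1]; simp
        have hs0 : 0 < s := hs
        have hs2 : s < 1 := hs1.2
        rw [hG, Set.indicator_of_mem hs1, Set.indicator_of_mem hs1]
        have h7 : s ^ m ≤ 1 := pow_le_one₀ hs0.le hs2.le
        have h8 : (1 - s ^ 2) ^ t ≤ 2 ^ |t| * (1 - s) ^ t :=
          rpow_le_of_comparable (by nlinarith) (by linarith) one_le_two (by nlinarith)
            (by nlinarith) t
        have h9 : 0 ≤ (1 - s ^ 2) ^ t := Real.rpow_nonneg (by nlinarith) t
        calc ENNReal.ofReal (s ^ m) * (ENNReal.ofReal ((1 - s ^ 2) ^ t) *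
              (C * ENNReal.ofReal (δ ^ n)))
            = ENNReal.ofReal (s ^ m * (1 - s ^ 2) ^ t) * (C * ENNReal.ofReal (δ ^ n)) := by
              rw [ENNReal.ofReal_mul (by positivity), mul_assoc]
          _ ≤ ENNReal.ofReal (2 ^ |t| * (1 - s) ^ t) * (C * ENNReal.ofReal (δ ^ n)) := by
              exact mul_le_mul_left (ENNReal.ofReal_le_ofReal
                ((mul_le_of_le_one_left h9 h7).trans h8)) _
          _ = _ := by rw [ENNReal.ofReal_mul (by positivity)]; ring
    _ = ENNReal.ofReal (2 ^ |t|) * (C * ENNReal.ofReal (δ ^ n)) *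
          ENNReal.ofReal (δ ^ (t + 1) / (t + 1)) := by
        rw [lintegral_indicator measurableSet_Ioo, lintegral_const_mul' _ _ (by finiteness),
          lintegral_one_sub_rpow ht hδ]
    _ = _ := by
        have ht1 : 0 < t + 1 := by linarith
        have h10 : δ ^ ((n : ℝ) + 1 + t) = δ ^ n * δ ^ (t + 1) := by
          rw [add_assoc, Real.rpow_add hδ, Real.rpow_natCast, add_comm 1 t]
        rw [h10, ENNReal.coe_mul, ← ENNReal.ofReal.eq_1, ENNReal.ofReal_mul (by positivity),
          div_eq_mul_inv (2 ^ |t|), div_eq_mul_inv (δ ^ (t + 1)),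
          ENNReal.ofReal_mul (by positivity), ENNReal.ofReal_mul (by positivity)]
        ring

theorem weightedVolume_univ_lt_top (hn : 1 ≤ n) {t : ℝ} (ht : -1 < t) :
    weightedVolume n t Set.univ < ∞ := by
  obtain ⟨C, hC⟩ := weightedVolume_nonisotropic_le hn ht
  have h := hC ⟨0, by simp⟩ 2 two_pos
  refine (measure_mono fun w _ => ?_).trans_lt (h.trans_lt (by finiteness))
  simp [hdot]

theorem weightedVolume_univ_ne_zero (hn : 1 ≤ n) (t : ℝ) : weightedVolume n t Set.univ ≠ 0 := by
  intro h0
  obtain ⟨C, hC⟩ := exists_rpow_enorm_le_lintegral_bergBall hn t one_pos le_rfl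
  have h := hC (fun _ => 1) (differentiableOn_const 1) ⟨0, by simp⟩
  simp only [enorm_one, ENNReal.one_rpow, lintegral_const, Measure.restrict_apply_univ,
    measure_mono_null (Set.subset_univ _) h0] at h
  simp at h

/-- The Forelli–Rudin estimate. -/
theorem exists_lintegral_rpow_le (hn : 1 ≤ n) {t c : ℝ} (ht : -1 < t) (hc : 0 < c) :
    ∃ C : ℝ≥0, ∀ z : Ball n,
    ∫⁻ w, ENNReal.ofReal (‖1 - hdot z.1 w.1‖ ^ (-(n + 1 + t + c))) ∂weightedVolume n t ≤
      C * ENNReal.ofReal ((1 - ‖z.1‖ ^ 2) ^ (-c)) := by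
  obtain ⟨C, hC⟩ := weightedVolume_nonisotropic_le hn ht
  set b : ℝ := n + 1 + t + c with hb
  have hb0 : 0 < b := by have : (0 : ℝ) ≤ n := Nat.cast_nonneg n; linarith
  have hgeo : ∑' k : ℕ, ENNReal.ofReal (2 ^ (-c)) ^ k ≠ ∞ := by
    rw [ENNReal.tsum_geometric]
    refine ENNReal.inv_ne_top.2 (tsub_pos_iff_lt.2 ?_).ne'
    rw [ENNReal.ofReal_lt_one]
    exact Real.rpow_lt_one_of_one_lt_of_neg one_lt_two (by linarith)
  refine ⟨(C * ENNReal.ofReal (2 ^ (n + 1 + t + c)) *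
    ∑' k : ℕ, ENNReal.ofReal (2 ^ (-c)) ^ k).toNNReal, fun z => ?_⟩
  rw [ENNReal.coe_toNNReal (ENNReal.mul_ne_top (by finiteness) hgeo)]
  set ε := (1 - ‖z.1‖ ^ 2) / 2 with hε
  have hε0 : 0 < ε := by have := z.one_sub_norm_sq_pos; positivity
  have hcz : Continuous fun w : Ball n => hdot z.1 w.1 :=
    (continuous_hdot.comp (Continuous.prodMk_right z.1)).comp continuous_subtype_val
  have hSm : ∀ k : ℕ, MeasurableSet {w : Ball n | ‖1 - hdot z.1 w.1‖ < 2 ^ (k + 1) * ε} :=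
    fun k => (isOpen_lt (continuous_const.sub hcz).norm continuous_const).measurableSet
  calc ∫⁻ w, ENNReal.ofReal (‖1 - hdot z.1 w.1‖ ^ (-b)) ∂weightedVolume n t
      ≤ ∫⁻ w, ∑' k : ℕ, {w : Ball n | ‖1 - hdot z.1 w.1‖ < 2 ^ (k + 1) * ε}.indicator
          (fun _ => ENNReal.ofReal ((2 ^ k * ε) ^ (-b))) w ∂weightedVolume n t := by
        refine lintegral_mono fun w => ?_
        have hX : ε ≤ ‖1 - hdot z.1 w.1‖ := by
          have := one_sub_norm_sq_le_two_mul z w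
          rw [hε]; linarith
        obtain ⟨k, hk1, hk2⟩ := exists_nat_pow_near ((one_le_div hε0).2 hX) one_lt_two
        rw [le_div_iff₀ hε0] at hk1
        rw [div_lt_iff₀ hε0] at hk2
        refine le_trans ?_ (ENNReal.le_tsum k)
        rw [Set.indicator_of_mem (by exact hk2)]
        exact ENNReal.ofReal_le_ofReal
          (Real.rpow_le_rpow_of_nonpos (by positivity) hk1 (by linarith))
    _ = ∑' k : ℕ, ENNReal.ofReal ((2 ^ k * ε) ^ (-b)) *
          weightedVolume n t {w : Ball n | ‖1 - hdot z.1 w.1‖ < 2 ^ (k + 1) * ε} := by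
        rw [lintegral_tsum fun k => (measurable_const.indicator (hSm k)).aemeasurable]
        congr 1
        ext k
        rw [lintegral_indicator_const (hSm k)]
    _ ≤ ∑' k : ℕ, ENNReal.ofReal ((2 ^ k * ε) ^ (-b)) *
          (C * ENNReal.ofReal ((2 ^ (k + 1) * ε) ^ (n + 1 + t))) := by
        gcongr with k
        exact hC z _ (by positivity)
    _ = ∑' k : ℕ, (C * ENNReal.ofReal (2 ^ (n + 1 + t) * ε ^ (-c))) *
          ENNReal.ofReal (2 ^ (-c)) ^ k := by
        congr 1
        ext k
        rw [mul_left_comm, ← ENNReal.ofReal_mul (by positivity),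
          ← ENNReal.ofReal_pow (by positivity), mul_assoc, ← ENNReal.ofReal_mul (by positivity)]
        congr 2
        rw [← Real.rpow_natCast 2 k, ← Real.rpow_natCast 2 (k + 1),
          ← Real.rpow_natCast (2 ^ (-c)) k, Real.mul_rpow (by positivity) hε0.le,
          Real.mul_rpow (by positivity) hε0.le, ← Real.rpow_mul zero_le_two,
          ← Real.rpow_mul zero_le_two, ← Real.rpow_mul zero_le_two,
          mul_mul_mul_comm, ← Real.rpow_add two_pos, ← Real.rpow_add hε0, mul_right_comm,
          ← Real.rpow_add two_pos]
        congr 2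
        · push_cast; rw [hb]; ring
        · rw [hb]; ring
    _ = _ := by
        have h2c : (0 : ℝ) < 2 ^ c := by positivity
        have h12 : (2 : ℝ) ^ ((n : ℝ) + 1 + t) * ε ^ (-c) =
            2 ^ ((n : ℝ) + 1 + t + c) * (1 - ‖z.1‖ ^ 2) ^ (-c) := by
          rw [hε, Real.div_rpow z.one_sub_norm_sq_pos.le zero_le_two, Real.rpow_add two_pos _ c,
            Real.rpow_neg zero_le_two]
          field_simp
        rw [ENNReal.tsum_mul_left, h12, ENNReal.ofReal_mul (by positivity)]
        ring

end ForelliRudin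

/-! ### Integral estimates for `v_α` -/

section Estimates

variable {n : ℕ}

theorem weightedVolume_eq_smul_vMeas (hn : 1 ≤ n) {α : ℝ} (hα : -1 < α) :
    weightedVolume n α = weightedVolume n α Set.univ • vMeas n α := by
  rw [vMeas, smul_smul, ENNReal.mul_inv_cancel (weightedVolume_univ_ne_zero hn α)
    (weightedVolume_univ_lt_top hn hα).ne, one_smul]

theorem isProbabilityMeasure_vMeas (hn : 1 ≤ n) {α : ℝ} (hα : -1 < α) :
    IsProbabilityMeasure (vMeas n α) :=
  ⟨by rw [vMeas, Measure.smul_apply, smul_eq_mul,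
    ENNReal.inv_mul_cancel (weightedVolume_univ_ne_zero hn α)
      (weightedVolume_univ_lt_top hn hα).ne]⟩

theorem exists_rpow_enorm_le_lintegral_vMeas (hn : 1 ≤ n) {α : ℝ} (hα : -1 < α) {r : ℝ}
    (hr : 0 < r) {q : ℝ} (hq : 1 ≤ q) : ∃ C : ℝ≥0, ∀ h : EuclideanSpace ℂ (Fin n) → ℂ,
      DifferentiableOn ℂ h (Metric.ball 0 1) → ∀ w : Ball n,
      ENNReal.ofReal ((1 - ‖w.1‖ ^ 2) ^ (n + 1 + α)) * ‖h w.1‖ₑ ^ q ≤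
        C * ∫⁻ u in bergBall w r, ‖h u.1‖ₑ ^ q ∂vMeas n α := by
  obtain ⟨C, hC⟩ := exists_rpow_enorm_le_lintegral_bergBall hn α hr hq
  refine ⟨C * (weightedVolume n α Set.univ).toNNReal, fun h hh w => (hC h hh w).trans ?_⟩
  rw [ENNReal.coe_mul, ENNReal.coe_toNNReal (weightedVolume_univ_lt_top hn hα).ne]
  conv_lhs => rw [weightedVolume_eq_smul_vMeas hn hα]
  rw [Measure.restrict_smul, lintegral_smul_measure, smul_eq_mul, mul_assoc]

theorem exists_lintegral_rpow_mul_rpow_le (hn : 1 ≤ n) {α s c : ℝ} (hs : s < α + 1) (hc : 0 < c) :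
    ∃ C : ℝ≥0, ∀ z : Ball n, ∫⁻ w : Ball n, ENNReal.ofReal ((1 - ‖w.1‖ ^ 2) ^ (-s)) *
        ENNReal.ofReal (‖1 - hdot z.1 w.1‖ ^ (-(n + 1 + α - s + c))) ∂vMeas n α ≤
      C * ENNReal.ofReal ((1 - ‖z.1‖ ^ 2) ^ (-c)) := by
  obtain ⟨C, hC⟩ := exists_lintegral_rpow_le hn (t := α - s) (by linarith) hc
  have hi : (weightedVolume n α Set.univ)⁻¹ ≠ ∞ :=
    ENNReal.inv_ne_top.2 (weightedVolume_univ_ne_zero hn α)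
  refine ⟨((weightedVolume n α Set.univ)⁻¹).toNNReal * C, fun z => ?_⟩
  rw [ENNReal.coe_mul, ENNReal.coe_toNNReal hi, vMeas, lintegral_smul_measure, smul_eq_mul,
    mul_assoc]
  refine mul_le_mul_right (le_trans (le_of_eq ?_) (hC z)) _
  have hcz : Continuous fun w : Ball n => ‖1 - hdot z.1 w.1‖ :=
    (continuous_const.sub ((continuous_hdot.comp (Continuous.prodMk_right z.1)).comp
      continuous_subtype_val)).norm
  have hm : ∀ b : ℝ, Measurable fun w : Ball n => ENNReal.ofReal (‖1 - hdot z.1 w.1‖ ^ b) :=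
    fun b => (hcz.measurable.pow_const b).ennreal_ofReal
  have hm' : ∀ b : ℝ, Measurable fun w : Ball n => ENNReal.ofReal ((1 - ‖w.1‖ ^ 2) ^ b) :=
    fun b => (Ball.continuous_rpow b).measurable.ennreal_ofReal
  have hm2 : Measurable fun w : Ball n => ENNReal.ofReal ((1 - ‖w.1‖ ^ 2) ^ (-s)) *
      ENNReal.ofReal (‖1 - hdot z.1 w.1‖ ^ (-(n + 1 + α - s + c))) := (hm' _).mul (hm _)
  rw [← setLIntegral_univ, ← setLIntegral_univ (μ := weightedVolume n (α - s)),
    setLIntegral_weightedVolume _ MeasurableSet.univ hm2,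
    setLIntegral_weightedVolume _ MeasurableSet.univ (hm _)]
  refine lintegral_congr fun w : Ball n => ?_
  have hw := w.one_sub_norm_sq_pos
  rw [← mul_assoc, ← ENNReal.ofReal_mul (by positivity), ← Real.rpow_add hw, ← sub_eq_add_neg]
  congr 5
  ring

theorem scalarGeo_apply_le {α r : ℝ} (ν : Measure (Ball n)) (u : Ball n) :
    ENNReal.ofReal ((1 - ‖u.1‖ ^ 2) ^ (-(n + 1 + α))) * ν (bergBall u r) ≤ scalarGeo α r ν := by
  rw [mul_comm]
  exact le_iSup (fun l : Ball n =>
    ν (bergBall l r) * ENNReal.ofReal ((1 - ‖l.1‖ ^ 2) ^ (-(n + 1 + α)))) u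

/-- The Carleson embedding theorem for a single holomorphic function. -/
theorem exists_lintegral_rpow_enorm_le_scalarGeo (hn : 1 ≤ n) {α : ℝ} (hα : -1 < α) {r : ℝ}
    (hr : 0 < r) {q : ℝ} (hq : 1 ≤ q) : ∃ C : ℝ≥0, ∀ (ν : Measure (Ball n)) [SFinite ν]
      (h : EuclideanSpace ℂ (Fin n) → ℂ), DifferentiableOn ℂ h (Metric.ball 0 1) →
      ∫⁻ w : Ball n, ‖h w.1‖ₑ ^ q ∂ν ≤
        C * scalarGeo α r ν * ∫⁻ u : Ball n, ‖h u.1‖ₑ ^ q ∂vMeas n α := by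
  obtain ⟨C, hC⟩ := exists_rpow_enorm_le_lintegral_vMeas hn hα hr hq
  have := isProbabilityMeasure_vMeas hn hα
  set K := (4 * Real.cosh r ^ 2) ^ |-((n : ℝ) + 1 + α)| with hK
  have hK0 : 0 < K := by have := Real.cosh_pos r; positivity
  refine ⟨C * K.toNNReal, fun ν _ h hh => ?_⟩
  have hm : Measurable fun w : Ball n => ENNReal.ofReal ((1 - ‖w.1‖ ^ 2) ^ (-((n : ℝ) + 1 + α))) :=
    (Ball.continuous_rpow _).measurable.ennreal_ofReal
  have hhm : Measurable fun u : Ball n => ‖h u.1‖ₑ ^ q :=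
    (ENNReal.continuous_rpow_const.comp
      (continuousOn_iff_continuous_domRestrict.1 hh.continuousOn).enorm).measurable
  set R : Set (Ball n × Ball n) := {x | x.2 ∈ bergBall x.1 r} with hR
  have hRm : MeasurableSet R := (isOpen_bergBall_rel hr).measurableSet
  have hpt : ∀ w : Ball n, ‖h w.1‖ₑ ^ q ≤ ∫⁻ u : Ball n, R.indicator (fun x =>
      C * ENNReal.ofReal ((1 - ‖x.1.1‖ ^ 2) ^ (-((n : ℝ) + 1 + α))) * ‖h x.2.1‖ₑ ^ q) (w, u)
        ∂vMeas n α := by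
    intro w
    have hw := w.one_sub_norm_sq_pos
    have h1 := hC h hh w
    have h2 : ENNReal.ofReal ((1 - ‖w.1‖ ^ 2) ^ (-((n : ℝ) + 1 + α))) *
        ENNReal.ofReal ((1 - ‖w.1‖ ^ 2) ^ ((n : ℝ) + 1 + α)) = 1 := by
      rw [← ENNReal.ofReal_mul (by positivity), ← Real.rpow_add hw, neg_add_cancel,
        Real.rpow_zero, ENNReal.ofReal_one]
    calc ‖h w.1‖ₑ ^ q = ENNReal.ofReal ((1 - ‖w.1‖ ^ 2) ^ (-((n : ℝ) + 1 + α))) *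
          (ENNReal.ofReal ((1 - ‖w.1‖ ^ 2) ^ ((n : ℝ) + 1 + α)) * ‖h w.1‖ₑ ^ q) := by
          rw [← mul_assoc, h2, one_mul]
      _ ≤ ENNReal.ofReal ((1 - ‖w.1‖ ^ 2) ^ (-((n : ℝ) + 1 + α))) *
          (C * ∫⁻ u in bergBall w r, ‖h u.1‖ₑ ^ q ∂vMeas n α) := by gcongr
      _ = ∫⁻ u in bergBall w r, C * ENNReal.ofReal ((1 - ‖w.1‖ ^ 2) ^ (-((n : ℝ) + 1 + α))) *
          ‖h u.1‖ₑ ^ q ∂vMeas n α := by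
          rw [lintegral_const_mul _ hhm]; ring
      _ = _ := by
          rw [← lintegral_indicator (measurableSet_bergBall hr w)]
          rfl
  have hjm : Measurable (R.indicator (fun x : Ball n × Ball n =>
      C * ENNReal.ofReal ((1 - ‖x.1.1‖ ^ 2) ^ (-((n : ℝ) + 1 + α))) * ‖h x.2.1‖ₑ ^ q)) :=
    ((measurable_const.mul (hm.comp measurable_fst)).mul (hhm.comp measurable_snd)).indicator hRm
  refine (lintegral_mono hpt).trans ?_
  rw [lintegral_lintegral_swap (f := fun w u => R.indicator (fun x : Ball n × Ball n =>
      C * ENNReal.ofReal ((1 - ‖x.1.1‖ ^ 2) ^ (-((n : ℝ) + 1 + α))) * ‖h x.2.1‖ₑ ^ q) (w, u))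
    hjm.aemeasurable, ← lintegral_const_mul _ hhm]
  refine lintegral_mono fun u => ?_
  calc ∫⁻ w, R.indicator (fun x : Ball n × Ball n =>
        C * ENNReal.ofReal ((1 - ‖x.1.1‖ ^ 2) ^ (-((n : ℝ) + 1 + α))) * ‖h x.2.1‖ₑ ^ q) (w, u) ∂ν
      = ∫⁻ w in bergBall u r,
          C * ENNReal.ofReal ((1 - ‖w.1‖ ^ 2) ^ (-((n : ℝ) + 1 + α))) * ‖h u.1‖ₑ ^ q ∂ν := by
        rw [← lintegral_indicator (measurableSet_bergBall hr u)]
        refine lintegral_congr fun w => ?_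
        have : (w, u) ∈ R ↔ w ∈ bergBall u r := mem_bergBall_comm _ _
        by_cases hwu : w ∈ bergBall u r
        · rw [Set.indicator_of_mem hwu, Set.indicator_of_mem (this.2 hwu)]
        · rw [Set.indicator_of_notMem hwu, Set.indicator_of_notMem fun h => hwu (this.1 h)]
    _ ≤ ∫⁻ _w in bergBall u r, C * (ENNReal.ofReal K *
          ENNReal.ofReal ((1 - ‖u.1‖ ^ 2) ^ (-((n : ℝ) + 1 + α)))) * ‖h u.1‖ₑ ^ q ∂ν := by
        refine setLIntegral_mono' (measurableSet_bergBall hr u) fun w hw => ?_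
        gcongr
        rw [← ENNReal.ofReal_mul hK0.le]
        exact ENNReal.ofReal_le_ofReal (rpow_one_sub_norm_sq_le hr hw _)
    _ = C * ENNReal.ofReal K * (ENNReal.ofReal ((1 - ‖u.1‖ ^ 2) ^ (-((n : ℝ) + 1 + α))) *
          ν (bergBall u r)) * ‖h u.1‖ₑ ^ q := by
        rw [setLIntegral_const]; ring
    _ ≤ _ := by
        rw [ENNReal.coe_mul, ENNReal.ofReal]
        gcongr
        exact scalarGeo_apply_le ν u

theorem enorm_repKernel {α : ℝ} (w z : EuclideanSpace ℂ (Fin n)) :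
    ‖repKernel α w z‖ₑ = ENNReal.ofReal (‖1 - hdot w z‖ ^ (-((n : ℝ) + 1 + α))) := by
  rw [← ofReal_norm, repKernel, norm_div, norm_one, Complex.norm_cpow_real,
    Real.rpow_neg (norm_nonneg _), one_div]

theorem enorm_repKernel_comm {α : ℝ} (w z : EuclideanSpace ℂ (Fin n)) :
    ‖repKernel α w z‖ₑ = ‖repKernel α z w‖ₑ := by
  rw [enorm_repKernel, enorm_repKernel, norm_one_sub_hdot_comm]

theorem measurable_enorm_repKernel {α : ℝ} :
    Measurable fun x : Ball n × Ball n => ‖repKernel α x.1.1 x.2.1‖ₑ := by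
  simp only [enorm_repKernel]
  have h : Continuous fun q : Ball n × Ball n => ‖1 - hdot q.1.1 q.2.1‖ :=
    (continuous_const.sub (continuous_hdot.comp
      (by fun_prop : Continuous fun q : Ball n × Ball n => (q.1.1, q.2.1)))).norm
  exact (h.measurable.pow_const _).ennreal_ofReal

/-- Schur's test for a symmetric positive kernel. -/
theorem lintegral_rpow_le_of_schur {X : Type*} [MeasurableSpace X] (v : Measure X) [SFinite v]
    {k : X → X → ℝ≥0∞} (hkm : Measurable (Function.uncurry k)) (hk_comm : ∀ z w, k z w = k w z)
    (hk0 : ∀ z w, k z w ≠ 0) (hkt : ∀ z w, k z w ≠ ∞) {H : X → ℝ≥0∞} (hHm : Measurable H)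
    (hH0 : ∀ w, H w ≠ 0) (hHt : ∀ w, H w ≠ ∞) {p p' : ℝ} (hpq : p.HolderConjugate p')
    {C₁ C₂ : ℝ≥0∞} (h₁ : ∀ z, ∫⁻ w, H w ^ p * k z w ∂v ≤ C₁ * H z ^ p)
    (h₂ : ∀ z, ∫⁻ w, H w ^ p' * k z w ∂v ≤ C₂ * H z ^ p') {g : X → ℝ≥0∞} (hg : Measurable g) :
    ∫⁻ z, (∫⁻ w, k w z * g w ∂v) ^ p ∂v ≤ C₂ ^ (p / p') * C₁ * ∫⁻ w, g w ^ p ∂v := by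
  have hp0 : 0 < p := hpq.pos
  have hp'0 : 0 < p' := hpq.symm.pos
  have hkz : ∀ z, Measurable (k z) := fun z => hkm.comp measurable_prodMk_left
  have hpt : ∀ z, (∫⁻ w, k w z * g w ∂v) ^ p ≤ C₂ ^ (p / p') *
      ∫⁻ w, H z ^ p * (g w ^ p * k z w * (H w ^ p)⁻¹) ∂v := by
    intro z
    have e0 : ∀ w, k w z * g w =
        ((fun w => g w * k z w ^ (1 / p) * (H w)⁻¹) * fun w => H w * k z w ^ (1 / p')) w := fun w => by
      have e1 : k z w ^ (1 / p) * k z w ^ (1 / p') = k z w := by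
        rw [← ENNReal.rpow_add _ _ (hk0 z w) (hkt z w), one_div, one_div,
          hpq.inv_add_inv_eq_one, ENNReal.rpow_one]
      have e2 : (H w)⁻¹ * H w = 1 := ENNReal.inv_mul_cancel (hH0 w) (hHt w)
      simp only [Pi.mul_apply]
      calc k w z * g w = g w * (k z w ^ (1 / p) * k z w ^ (1 / p')) * ((H w)⁻¹ * H w) := by
            rw [e1, e2, mul_one, hk_comm, mul_comm]
        _ = _ := by ring
    have e3 := ENNReal.lintegral_mul_le_Lp_mul_Lq v hpq
      (f := fun w => g w * k z w ^ (1 / p) * (H w)⁻¹) (g := fun w => H w * k z w ^ (1 / p'))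
      ((hg.mul ((hkz z).pow_const _)).mul hHm.inv).aemeasurable
      (hHm.mul ((hkz z).pow_const _)).aemeasurable
    rw [← lintegral_congr e0] at e3
    have e4 : ∀ w, (g w * k z w ^ (1 / p) * (H w)⁻¹) ^ p = g w ^ p * k z w * (H w ^ p)⁻¹ := fun w => by
      rw [ENNReal.mul_rpow_of_nonneg _ _ hp0.le, ENNReal.mul_rpow_of_nonneg _ _ hp0.le,
        ← ENNReal.rpow_mul, one_div_mul_cancel hp0.ne', ENNReal.rpow_one, ENNReal.inv_rpow]
    have e5 : ∀ w, (H w * k z w ^ (1 / p')) ^ p' = H w ^ p' * k z w := fun w => by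
      rw [ENNReal.mul_rpow_of_nonneg _ _ hp'0.le, ← ENNReal.rpow_mul,
        one_div_mul_cancel hp'0.ne', ENNReal.rpow_one]
    rw [lintegral_congr e4, lintegral_congr e5] at e3
    calc (∫⁻ w, k w z * g w ∂v) ^ p
        ≤ ((∫⁻ w, g w ^ p * k z w * (H w ^ p)⁻¹ ∂v) ^ (1 / p) *
            (C₂ * H z ^ p') ^ (1 / p')) ^ p := by
          refine ENNReal.rpow_le_rpow (e3.trans ?_) hp0.le
          gcongr
          exact h₂ z
      _ = C₂ ^ (p / p') * (H z ^ p * ∫⁻ w, g w ^ p * k z w * (H w ^ p)⁻¹ ∂v) := by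
          rw [ENNReal.mul_rpow_of_nonneg _ _ hp0.le, ← ENNReal.rpow_mul, ← ENNReal.rpow_mul,
            one_div_mul_cancel hp0.ne', ENNReal.rpow_one, one_div_mul_eq_div,
            ENNReal.mul_rpow_of_nonneg _ _ (by positivity), ← ENNReal.rpow_mul,
            mul_div_cancel₀ _ hp'0.ne']
          ring
      _ = _ := by
          rw [lintegral_const_mul' _ _ (ENNReal.rpow_ne_top_of_nonneg hp0.le (hHt z))]
  have hsm : Measurable (Function.uncurry fun z w => H z ^ p * (g w ^ p * k z w * (H w ^ p)⁻¹)) :=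
    ((hHm.comp measurable_fst).pow_const p).mul ((((hg.comp measurable_snd).pow_const p).mul
      hkm).mul ((hHm.comp measurable_snd).pow_const p).inv)
  calc ∫⁻ z, (∫⁻ w, k w z * g w ∂v) ^ p ∂v
      ≤ ∫⁻ z, C₂ ^ (p / p') * ∫⁻ w, H z ^ p * (g w ^ p * k z w * (H w ^ p)⁻¹) ∂v ∂v :=
        lintegral_mono hpt
    _ = C₂ ^ (p / p') * ∫⁻ w, ∫⁻ z, H z ^ p * (g w ^ p * k z w * (H w ^ p)⁻¹) ∂v ∂v := by
        rw [← lintegral_lintegral_swap hsm.aemeasurable]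
        exact lintegral_const_mul _ hsm.lintegral_prod_right'
    _ = C₂ ^ (p / p') * ∫⁻ w, (g w ^ p * (H w ^ p)⁻¹) * ∫⁻ z, H z ^ p * k w z ∂v ∂v := by
        congr 1
        refine lintegral_congr fun w => ?_
        refine Eq.trans ?_ (lintegral_const_mul _ ((hHm.pow_const p).mul (hkz w)))
        refine lintegral_congr fun z => ?_
        rw [hk_comm z w]
        ring
    _ ≤ C₂ ^ (p / p') * ∫⁻ w, (g w ^ p * (H w ^ p)⁻¹) * (C₁ * H w ^ p) ∂v := by
        gcongr with w
        exact h₁ w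
    _ = C₂ ^ (p / p') * ∫⁻ w, C₁ * g w ^ p ∂v := by
        congr 1
        refine lintegral_congr fun w => ?_
        have e6 : (H w ^ p)⁻¹ * H w ^ p = 1 := ENNReal.inv_mul_cancel
          (ENNReal.rpow_pos (pos_iff_ne_zero.2 (hH0 w)) (hHt w)).ne'
          (ENNReal.rpow_ne_top_of_nonneg hp0.le (hHt w))
        calc _ = C₁ * g w ^ p * ((H w ^ p)⁻¹ * H w ^ p) := by ring
          _ = _ := by rw [e6, mul_one]
    _ = _ := by
        rw [lintegral_const_mul _ (hg.pow_const p), mul_assoc]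

/-- The operator with kernel `|1 - conj w · z|^(-(n+1+α))` is bounded on `L^p(v_α)`. -/
theorem exists_lintegral_kernel_rpow_le (hn : 1 ≤ n) {α p : ℝ} (hα : -1 < α) (hp : 1 < p) :
    ∃ C : ℝ≥0, ∀ g : Ball n → ℝ≥0∞, Measurable g →
      ∫⁻ z, (∫⁻ w, ‖repKernel α w.1 z.1‖ₑ * g w ∂vMeas n α) ^ p ∂vMeas n α ≤
        C * ∫⁻ w, g w ^ p ∂vMeas n α := by
  have := isProbabilityMeasure_vMeas hn hα
  set p' := Real.conjExponent p with hp'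
  have hpq : p.HolderConjugate p' := Real.HolderConjugate.conjExponent hp
  have hp0 : 0 < p := hpq.pos
  have hp'1 : 1 < p' := hpq.symm.lt
  have hp'0 : 0 < p' := hpq.symm.pos
  have hα1 : 0 < α + 1 := by linarith
  set s := (α + 1) / (2 * p * p') with hs
  have hs0 : 0 < s := by positivity
  have hsp : s * p < α + 1 := by
    rw [hs, div_mul_eq_mul_div, div_lt_iff₀ (by positivity)]
    have : 0 < (α + 1) * p := by positivity
    nlinarith
  have hsp' : s * p' < α + 1 := by
    rw [hs, div_mul_eq_mul_div, div_lt_iff₀ (by positivity)]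
    have : 0 < (α + 1) * p' := by positivity
    nlinarith
  obtain ⟨C₁, hC₁⟩ := exists_lintegral_rpow_mul_rpow_le hn (c := s * p) hsp (by positivity)
  obtain ⟨C₂, hC₂⟩ := exists_lintegral_rpow_mul_rpow_le hn (c := s * p') hsp' (by positivity)
  simp only [sub_add_cancel, ← enorm_repKernel] at hC₁ hC₂
  have hHpow : ∀ c (w : Ball n), 0 < c → ENNReal.ofReal ((1 - ‖w.1‖ ^ 2) ^ (-s)) ^ c =
      ENNReal.ofReal ((1 - ‖w.1‖ ^ 2) ^ (-(s * c))) := fun c w hc => by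
    have hw := w.one_sub_norm_sq_pos
    rw [ENNReal.ofReal_rpow_of_nonneg (by positivity) hc.le, ← Real.rpow_mul hw.le, neg_mul]
  refine ⟨C₂ ^ (p / p') * C₁, fun g hg => ?_⟩
  rw [ENNReal.coe_mul, ENNReal.coe_rpow_of_nonneg _ (by positivity)]
  refine lintegral_rpow_le_of_schur (vMeas n α) (k := fun z w => ‖repKernel α z.1 w.1‖ₑ)
    (H := fun w => ENNReal.ofReal ((1 - ‖w.1‖ ^ 2) ^ (-s))) measurable_enorm_repKernel
    (fun z w => enorm_repKernel_comm _ _) (fun z w => ?_) (fun z w => enorm_ne_top)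
    (Ball.continuous_rpow _).measurable.ennreal_ofReal (fun w => ?_)
    (fun w => ENNReal.ofReal_ne_top) hpq (fun z => ?_) (fun z => ?_) hg
  · have := norm_one_sub_hdot_pos z w
    rw [enorm_repKernel]
    simpa using by positivity
  · have := w.one_sub_norm_sq_pos
    simpa using by positivity
  · simpa only [hHpow p _ hp0] using hC₁ z
  · simpa only [hHpow p' _ hp'0] using hC₂ z

end Estimates

/-! ### Holomorphy of kernels and of kernel integrals -/

section Holomorphy

variable {n : ℕ}

theorem one_sub_hdot_mem_slitPlane {w z : EuclideanSpace ℂ (Fin n)} (hw : ‖w‖ ≤ 1) (hz : ‖z‖ < 1) :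
    1 - hdot w z ∈ Complex.slitPlane :=
  Complex.mem_slitPlane_iff.2 (Or.inl (re_one_sub_hdot_pos hw hz))

theorem repKernel_eq_cpow (α : ℝ) (w z : EuclideanSpace ℂ (Fin n)) :
    repKernel α w z = (1 - hdot w z) ^ ((-((n : ℝ) + 1 + α) : ℝ) : ℂ) := by
  rw [repKernel, Complex.ofReal_neg, Complex.cpow_neg, one_div]

theorem hasFDerivAt_one_sub_hdot_cpow (b : ℝ) {w z : EuclideanSpace ℂ (Fin n)} (hw : ‖w‖ ≤ 1)
    (hz : ‖z‖ < 1) :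
    HasFDerivAt (fun z => (1 - hdot w z) ^ (b : ℂ))
      ((-(b : ℂ) * (1 - hdot w z) ^ ((b - 1 : ℝ) : ℂ)) • innerSL ℂ w) z := by
  have h1 : HasFDerivAt (fun z => 1 - hdot w z) (-(innerSL ℂ w)) z :=
    ((innerSL ℂ w).hasFDerivAt (x := z)).const_sub 1
  have h2 : HasDerivAt (fun x : ℂ => x ^ (b : ℂ))
      ((b : ℂ) * (1 - hdot w z) ^ ((b : ℂ) - 1)) (1 - hdot w z) :=
    (Complex.hasStrictDerivAt_cpow_const (one_sub_hdot_mem_slitPlane hw hz)).hasDerivAt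
  refine (h2.comp_hasFDerivAt z h1).congr_fderiv ?_
  ext v
  simp

theorem differentiableOn_one_sub_hdot_cpow (b : ℝ) {w : EuclideanSpace ℂ (Fin n)} (hw : ‖w‖ ≤ 1) :
    DifferentiableOn ℂ (fun z => (1 - hdot w z) ^ (b : ℂ)) (Metric.ball 0 1) := fun _ hz =>
  (hasFDerivAt_one_sub_hdot_cpow b hw
    (mem_ball_zero_iff.1 hz)).differentiableAt.differentiableWithinAt

theorem continuous_one_sub_hdot_cpow (b : ℝ) {z : EuclideanSpace ℂ (Fin n)} (hz : ‖z‖ < 1) :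
    Continuous fun w : Ball n => (1 - hdot w.1 z) ^ (b : ℂ) :=
  Continuous.cpow (continuous_const.sub ((continuous_hdot.comp
    (Continuous.prodMk_left z)).comp continuous_subtype_val)) continuous_const
    fun w => one_sub_hdot_mem_slitPlane w.norm_lt_one.le hz

theorem norm_one_sub_hdot_cpow_le {b δ : ℝ} (hb : b ≤ 0) (hδ : 0 < δ)
    {w z : EuclideanSpace ℂ (Fin n)} (hw : ‖w‖ ≤ 1) (hz : δ ≤ 1 - ‖z‖) :
    ‖(1 - hdot w z) ^ (b : ℂ)‖ ≤ δ ^ b := by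
  rw [Complex.norm_cpow_real]
  refine Real.rpow_le_rpow_of_nonpos hδ ?_ hb
  have h1 := norm_sub_norm_le (1 : ℂ) (hdot w z)
  have h2 := norm_hdot_le w z
  rw [norm_one] at h1
  nlinarith [norm_nonneg z]

theorem differentiableOn_integral_repKernel_mul {α : ℝ} (hα : -1 < α) {ν : Measure (Ball n)}
    {g : Ball n → ℂ} (hg : Integrable g ν) :
    DifferentiableOn ℂ (fun z => ∫ w, repKernel α w.1 z * g w ∂ν) (Metric.ball 0 1) := by
  intro z₀ hz₀
  have hz₁ : ‖z₀‖ < 1 := mem_ball_zero_iff.1 hz₀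
  set β : ℝ := (n : ℝ) + 1 + α with hβ
  have hβ0 : 0 < β := by have : (0 : ℝ) ≤ n := Nat.cast_nonneg n; linarith
  set δ := (1 - ‖z₀‖) / 2 with hδ
  have hδ0 : 0 < δ := by rw [hδ]; linarith
  have hball : ∀ z ∈ Metric.ball z₀ δ, δ ≤ 1 - ‖z‖ := by
    intro z hz
    rw [mem_ball_iff_norm] at hz
    have := norm_sub_norm_le z z₀
    rw [hδ] at hz ⊢
    linarith
  simp only [repKernel_eq_cpow]
  have hmeas : ∀ b : ℝ, ∀ z : EuclideanSpace ℂ (Fin n), ‖z‖ < 1 →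
      AEStronglyMeasurable (fun w : Ball n => (1 - hdot w.1 z) ^ (b : ℂ)) ν := fun b z hz =>
    (continuous_one_sub_hdot_cpow b hz).aestronglyMeasurable
  refine (hasFDerivAt_integral_of_dominated_of_fderiv_le (Metric.ball_mem_nhds z₀ hδ0)
    (bound := fun w => β * δ ^ (-β - 1) * ‖g w‖)
    (F' := fun z w => g w • ((-((-β : ℝ) : ℂ) * (1 - hdot w.1 z) ^ ((-β - 1 : ℝ) : ℂ)) •
      innerSL ℂ w.1)) ?_ ?_ ?_ ?_ ?_ ?_).differentiableAt.differentiableWithinAt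
  · filter_upwards [Metric.ball_mem_nhds z₀ hδ0] with z hz
    exact (hmeas _ z (by linarith [hball z hz])).mul hg.aestronglyMeasurable
  · refine (hg.norm.const_mul (δ ^ (-β))).mono' ((hmeas _ z₀ hz₁).mul hg.aestronglyMeasurable) ?_
    refine Filter.Eventually.of_forall fun w => ?_
    rw [norm_mul]
    gcongr
    exact norm_one_sub_hdot_cpow_le (by linarith) hδ0 w.norm_lt_one.le
      (hball z₀ (Metric.mem_ball_self hδ0))
  · refine hg.aestronglyMeasurable.smul (((hmeas _ z₀ hz₁).const_mul _).smul ?_)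
    exact ((innerSL ℂ).continuous.comp continuous_subtype_val).aestronglyMeasurable
  · refine Filter.Eventually.of_forall fun w z hz => ?_
    have h1 : ‖innerSL ℂ w.1‖ ≤ 1 := by rw [innerSL_apply_norm]; exact w.norm_lt_one.le
    have h2 := norm_one_sub_hdot_cpow_le (b := -β - 1) (by linarith) hδ0 w.norm_lt_one.le
      (hball z hz)
    rw [norm_smul, norm_smul, norm_mul, norm_neg, Complex.norm_real, norm_neg,
      Real.norm_of_nonneg hβ0.le, mul_comm]
    refine mul_le_mul_of_nonneg_right ?_ (norm_nonneg _)
    calc β * ‖(1 - hdot w.1 z) ^ ((-β - 1 : ℝ) : ℂ)‖ * ‖innerSL ℂ w.1‖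
        ≤ β * δ ^ (-β - 1) * 1 := by gcongr
      _ = _ := mul_one _
  · exact hg.norm.const_mul _
  · refine Filter.Eventually.of_forall fun w z hz => ?_
    have := (hasFDerivAt_one_sub_hdot_cpow (-β) w.norm_lt_one.le
      (by linarith [hball z hz] : ‖z‖ < 1)).mul_const (g w)
    exact this

end Holomorphy

/-! ### Upper bounds -/

section UpperBounds

variable {n d : ℕ}

theorem MemBergman.differentiableOn_apply {α p : ℝ} {f : EuclideanSpace ℂ (Fin n) → Fin d → ℂ}
    (hf : MemBergman α p f) (i : Fin d) :
    DifferentiableOn ℂ (fun z => f z i) (Metric.ball 0 1) :=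
  differentiableOn_pi.1 hf.1 i

theorem measurable_enorm_of_differentiableOn {h : EuclideanSpace ℂ (Fin n) → ℂ}
    (hh : DifferentiableOn ℂ h (Metric.ball 0 1)) : Measurable fun u : Ball n => ‖h u.1‖ₑ :=
  (continuousOn_iff_continuous_domRestrict.1 hh.continuousOn).enorm.measurable

theorem lpaPow_eq_sum {α p : ℝ} {f : EuclideanSpace ℂ (Fin n) → Fin d → ℂ}
    (hf : DifferentiableOn ℂ f (Metric.ball 0 1)) :
    lpaPow α p f = ∑ i, ∫⁻ z : Ball n, ‖f z.1 i‖ₑ ^ p ∂vMeas n α := by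
  rw [lpaPow]
  simp only [lpPow]
  exact lintegral_finsetSum _ fun i _ =>
    (measurable_enorm_of_differentiableOn (differentiableOn_pi.1 hf i)).pow_const p

theorem sum_rpow_le {p : ℝ} (hp : 1 ≤ p) (g : Fin d → ℝ≥0∞) :
    (∑ i, g i) ^ p ≤ (d : ℝ≥0∞) ^ (p - 1) * ∑ i, g i ^ p := by
  simpa using ENNReal.rpow_sum_le_const_mul_sum_rpow Finset.univ g hp

theorem enorm_mulVec_le {A : Matrix (Fin d) (Fin d) ℂ} (hA : ∀ i j, ‖A i j‖ ≤ 1) (v : Fin d → ℂ)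
    (i : Fin d) : ‖A.mulVec v i‖ₑ ≤ ∑ j, ‖v j‖ₑ := by
  rw [Matrix.mulVec, dotProduct]
  refine (enorm_sum_le _ _).trans (Finset.sum_le_sum fun j _ => ?_)
  rw [enorm_mul]
  refine mul_le_of_le_one_left zero_le ?_
  rw [← ofReal_norm, ENNReal.ofReal_le_one]
  exact hA i j

theorem lpPow_le_of_forall_enorm_le {p : ℝ} (hp : 1 ≤ p) {u : Fin d → ℂ} {g : Fin d → ℝ≥0∞}
    (h : ∀ i, ‖u i‖ₑ ≤ ∑ j, g j) :
    lpPow p u ≤ d * (d : ℝ≥0∞) ^ (p - 1) * ∑ j, g j ^ p := by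
  calc lpPow p u ≤ ∑ _i : Fin d, (d : ℝ≥0∞) ^ (p - 1) * ∑ j, g j ^ p :=
        Finset.sum_le_sum fun i _ =>
          (ENNReal.rpow_le_rpow (h i) (by linarith)).trans (sum_rpow_le hp g)
    _ = _ := by simp [mul_assoc]

/-- The `p`-th power of the norm of the embedding `f ↦ R f` of `A^p_α` into `L^p(ν)`. -/
def weightedEmbConst (α p : ℝ) (ν : Measure (Ball n)) (R : Ball n → Matrix (Fin d) (Fin d) ℂ) :
    ℝ≥0∞ :=
  sInf {C | ∀ f : EuclideanSpace ℂ (Fin n) → Fin d → ℂ, MemBergman α p f →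
    ∫⁻ z : Ball n, lpPow p ((R z).mulVec (f z.1)) ∂ν ≤ C * lpaPow α p f}

theorem exists_weightedEmbConst_le_scalarGeo (d : ℕ) (hn : 1 ≤ n) {α p r : ℝ} (hα : -1 < α)
    (hp : 1 < p) (hr : 0 < r) : ∃ C : ℝ≥0, ∀ (ν : Measure (Ball n)) [SFinite ν]
      (R : Ball n → Matrix (Fin d) (Fin d) ℂ), (∀ᵐ z ∂ν, ∀ i j, ‖R z i j‖ ≤ 1) →
      weightedEmbConst α p ν R ≤ C * scalarGeo α r ν := by
  obtain ⟨C, hC⟩ := exists_lintegral_rpow_enorm_le_scalarGeo hn hα hr hp.le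
  refine ⟨d * (d : ℝ≥0) ^ (p - 1) * C, fun ν _ R hR => sInf_le fun f hf => ?_⟩
  have hfm : ∀ j, Measurable fun z : Ball n => ‖f z.1 j‖ₑ ^ p := fun j =>
    (measurable_enorm_of_differentiableOn (hf.differentiableOn_apply j)).pow_const p
  calc ∫⁻ z : Ball n, lpPow p ((R z).mulVec (f z.1)) ∂ν
      ≤ ∫⁻ z : Ball n, d * (d : ℝ≥0∞) ^ (p - 1) * ∑ j, ‖f z.1 j‖ₑ ^ p ∂ν := by
        refine lintegral_mono_ae ?_
        filter_upwards [hR] with z hz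
        exact lpPow_le_of_forall_enorm_le hp.le (enorm_mulVec_le hz _)
    _ = d * (d : ℝ≥0∞) ^ (p - 1) * ∑ j, ∫⁻ z : Ball n, ‖f z.1 j‖ₑ ^ p ∂ν := by
        rw [lintegral_const_mul _ (Finset.measurable_sum _ fun j _ => hfm j),
          lintegral_finsetSum _ fun j _ => hfm j]
    _ ≤ d * (d : ℝ≥0∞) ^ (p - 1) * ∑ j, C * scalarGeo α r ν *
          ∫⁻ z : Ball n, ‖f z.1 j‖ₑ ^ p ∂vMeas n α := by
        gcongr with j
        exact hC ν _ (hf.differentiableOn_apply j)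
    _ = _ := by
        rw [lpaPow_eq_sum hf.1, ← Finset.mul_sum]
        push_cast [ENNReal.coe_rpow_of_nonneg _ (by linarith : 0 ≤ p - 1)]
        ring

theorem enorm_repKernel_le {α : ℝ} (hα : -1 < α) (z w : Ball n) :
    ‖repKernel α w.1 z.1‖ₑ ≤ ENNReal.ofReal ((1 - ‖z.1‖) ^ (-((n : ℝ) + 1 + α))) := by
  rw [repKernel_eq_cpow, ← ofReal_norm]
  have : (0 : ℝ) ≤ n := Nat.cast_nonneg n
  exact ENNReal.ofReal_le_ofReal (norm_one_sub_hdot_cpow_le (by linarith)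
    (by linarith [z.norm_lt_one]) w.norm_lt_one.le le_rfl)

theorem lintegral_le_rpow_lintegral_rpow {X : Type*} [MeasurableSpace X] (v : Measure X)
    [IsProbabilityMeasure v] {p : ℝ} (hp : 1 ≤ p) {g : X → ℝ≥0∞} (hg : Measurable g) :
    ∫⁻ x, g x ∂v ≤ (∫⁻ x, g x ^ p ∂v) ^ (1 / p) := by
  have := eLpNorm'_le_eLpNorm'_of_exponent_le one_pos hp v hg.aestronglyMeasurable
  simpa [eLpNorm'] using this

theorem continuous_repKernel_left (α : ℝ) {z : EuclideanSpace ℂ (Fin n)} (hz : ‖z‖ < 1) :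
    Continuous fun w : Ball n => repKernel α w.1 z := by
  simp only [repKernel_eq_cpow]
  exact continuous_one_sub_hdot_cpow _ hz

theorem differentiableOn_repKernel (α : ℝ) {z : EuclideanSpace ℂ (Fin n)} (hz : ‖z‖ ≤ 1) :
    DifferentiableOn ℂ (repKernel α z) (Metric.ball 0 1) := by
  have : repKernel α z = fun w => (1 - hdot z w) ^ ((-((n : ℝ) + 1 + α) : ℝ) : ℂ) :=
    funext fun w => repKernel_eq_cpow α z w
  rw [this]
  exact differentiableOn_one_sub_hdot_cpow _ hz

theorem lintegral_rpow_enorm_lt_top {α p : ℝ} (hp : 0 < p)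
    {f : EuclideanSpace ℂ (Fin n) → Fin d → ℂ} (hf : MemBergman α p f) (j : Fin d) :
    ∫⁻ z : Ball n, ‖f z.1 j‖ₑ ^ p ∂vMeas n α < ∞ := by
  have h1 : lpaPow α p f < ∞ := by
    have := hf.2
    rwa [lpaNorm, ENNReal.rpow_lt_top_iff_of_pos (by positivity)] at this
  rw [lpaPow_eq_sum hf.1] at h1
  exact (Finset.single_le_sum (f := fun i => ∫⁻ z : Ball n, ‖f z.1 i‖ₑ ^ p ∂vMeas n α)
    (fun i _ => zero_le) (Finset.mem_univ j)).trans_lt h1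

/-- A matrix-valued weight with measurable entries, almost everywhere bounded by one. -/
structure IsUnitWeight (ν : Measure (Ball n)) (W : Ball n → Matrix (Fin d) (Fin d) ℂ) : Prop where
  aestronglyMeasurable : ∀ i j, AEStronglyMeasurable (fun w => W w i j) ν
  norm_le : ∀ᵐ w ∂ν, ∀ i j, ‖W w i j‖ ≤ 1

theorem IsUnitWeight.aestronglyMeasurable_mulVec {ν : Measure (Ball n)}
    {W : Ball n → Matrix (Fin d) (Fin d) ℂ} (hW : IsUnitWeight ν W)
    {f : EuclideanSpace ℂ (Fin n) → Fin d → ℂ} (hf : DifferentiableOn ℂ f (Metric.ball 0 1))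
    (i : Fin d) : AEStronglyMeasurable (fun w : Ball n => (W w).mulVec (f w.1) i) ν := by
  simp only [Matrix.mulVec, dotProduct]
  refine Finset.aestronglyMeasurable_fun_sum _ fun j _ => (hW.aestronglyMeasurable i j).mul ?_
  exact (continuousOn_iff_continuous_domRestrict.1
    (differentiableOn_pi.1 hf j).continuousOn).aestronglyMeasurable

theorem exists_toeplitzNorm_le_scalarGeo (d : ℕ) (hn : 1 ≤ n) {α p r : ℝ} (hα : -1 < α)
    (hp : 1 < p) (hr : 0 < r) : ∃ C : ℝ≥0, ∀ (ν : Measure (Ball n)) [SFinite ν]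
      (W : Ball n → Matrix (Fin d) (Fin d) ℂ), IsUnitWeight ν W →
      toeplitzNorm α p ν W ≤ C * scalarGeo α r ν := by
  have hp0 : 0 < p := by linarith
  have := isProbabilityMeasure_vMeas hn hα
  obtain ⟨C₁, hC₁⟩ := exists_lintegral_rpow_enorm_le_scalarGeo hn hα hr le_rfl
  obtain ⟨C₂, hC₂⟩ := exists_lintegral_kernel_rpow_le hn hα hp
  set A : ℝ≥0 := d * (d : ℝ≥0) ^ (p - 1) * C₂ with hA
  refine ⟨C₁ * A ^ (1 / p) + 1, fun ν _ W hW => ?_⟩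
  rcases eq_or_ne (scalarGeo α r ν) ∞ with hG | hG
  · rw [hG, ENNReal.mul_top (by simp)]
    exact le_top
  refine le_trans ?_ (mul_le_mul_left (ENNReal.coe_le_coe.2 le_self_add) _)
  refine sInf_le fun f hf => ?_
  set G := scalarGeo α r ν with hGdef
  set P : Fin d → Ball n → ℝ≥0∞ := fun j z =>
    ∫⁻ w : Ball n, ‖repKernel α w.1 z.1‖ₑ * ‖f w.1 j‖ₑ ∂vMeas n α with hP
  have hfm : ∀ j, Measurable fun w : Ball n => ‖f w.1 j‖ₑ := fun j =>
    measurable_enorm_of_differentiableOn (hf.differentiableOn_apply j)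
  have hPm : ∀ j, Measurable (P j) := fun j => by
    have : Measurable (Function.uncurry fun z w : Ball n => ‖repKernel α w.1 z.1‖ₑ * ‖f w.1 j‖ₑ) :=
      (measurable_enorm_repKernel.comp measurable_swap).mul ((hfm j).comp measurable_snd)
    exact this.lintegral_prod_right'
  have hPt : ∀ j z, P j z < ∞ := fun j z => by
    calc P j z ≤ ∫⁻ w : Ball n, ENNReal.ofReal ((1 - ‖z.1‖) ^ (-((n : ℝ) + 1 + α))) *
          ‖f w.1 j‖ₑ ∂vMeas n α := by
          refine lintegral_mono fun w => ?_
          gcongr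
          exact enorm_repKernel_le hα z w
      _ = ENNReal.ofReal ((1 - ‖z.1‖) ^ (-((n : ℝ) + 1 + α))) *
          ∫⁻ w : Ball n, ‖f w.1 j‖ₑ ∂vMeas n α := lintegral_const_mul _ (hfm j)
      _ < ∞ := by
          refine ENNReal.mul_lt_top ENNReal.ofReal_lt_top
            ((lintegral_le_rpow_lintegral_rpow _ hp.le (hfm j)).trans_lt ?_)
          exact ENNReal.rpow_lt_top_of_nonneg (by positivity)
            (lintegral_rpow_enorm_lt_top hp0 hf j).ne
  have hI : ∀ (z : Ball n) i, ∫⁻ w : Ball n, ‖repKernel α w.1 z.1 * (W w).mulVec (f w.1) i‖ₑ ∂ν ≤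
      ∑ j, C₁ * G * P j z := by
    intro z i
    have hkm : Measurable fun w : Ball n => ‖repKernel α w.1 z.1‖ₑ :=
      (continuous_repKernel_left α z.norm_lt_one).enorm.measurable
    calc ∫⁻ w : Ball n, ‖repKernel α w.1 z.1 * (W w).mulVec (f w.1) i‖ₑ ∂ν
        ≤ ∫⁻ w : Ball n, ∑ j, ‖repKernel α w.1 z.1‖ₑ * ‖f w.1 j‖ₑ ∂ν := by
          refine lintegral_mono_ae ?_
          filter_upwards [hW.norm_le] with w hw
          rw [enorm_mul, ← Finset.mul_sum]
          gcongr
          exact enorm_mulVec_le hw _ i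
      _ = ∑ j, ∫⁻ w : Ball n, ‖repKernel α w.1 z.1‖ₑ * ‖f w.1 j‖ₑ ∂ν :=
          lintegral_finsetSum _ fun j _ => hkm.mul (hfm j)
      _ ≤ _ := by
          refine Finset.sum_le_sum fun j _ => ?_
          have h1 := hC₁ ν (fun w => repKernel α z.1 w * f w j)
            ((differentiableOn_repKernel α z.norm_lt_one.le).mul (hf.differentiableOn_apply j))
          simpa only [ENNReal.rpow_one, enorm_mul, enorm_repKernel_comm (α := α) z.1] using h1
  have hint : ∀ (z : Ball n) i,
      Integrable (fun w : Ball n => repKernel α w.1 z.1 * (W w).mulVec (f w.1) i) ν := fun z i =>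
    ⟨((continuous_repKernel_left α z.norm_lt_one).aestronglyMeasurable).mul
      (hW.aestronglyMeasurable_mulVec hf.1 i), (hI z i).trans_lt (ENNReal.sum_lt_top.2 fun j _ =>
        ENNReal.mul_lt_top (ENNReal.mul_lt_top ENNReal.coe_lt_top hG.lt_top) (hPt j z))⟩
  have hint' : ∀ z : Ball n,
      Integrable (fun w : Ball n => repKernel α w.1 z.1 • (W w).mulVec (f w.1)) ν := fun z =>
    Integrable.of_eval fun i => by simpa using hint z i
  have hTi : ∀ z : Ball n, ∀ i, kernelIntegral α ν (fun w => (W w).mulVec (f w.1)) z.1 i =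
      ∫ w, repKernel α w.1 z.1 * (W w).mulVec (f w.1) i ∂ν := fun z i => by
    rw [kernelIntegral, eval_integral fun i => by simpa using hint z i]
    simp
  have hdiff : DifferentiableOn ℂ (kernelIntegral α ν fun w => (W w).mulVec (f w.1))
      (Metric.ball 0 1) := by
    rw [differentiableOn_pi]
    intro i
    have hg : Integrable (fun w : Ball n => (W w).mulVec (f w.1) i) ν := by
      have := hint ⟨0, by simp⟩ i
      simpa [repKernel, hdot] using this
    refine (differentiableOn_integral_repKernel_mul hα hg).congr fun z hz => ?_
    exact hTi ⟨z, hz⟩ i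
  have hpow : lpaPow α p (kernelIntegral α ν fun w => (W w).mulVec (f w.1)) ≤
      (C₁ * G) ^ p * A * lpaPow α p f := by
    calc lpaPow α p (kernelIntegral α ν fun w => (W w).mulVec (f w.1))
        ≤ ∫⁻ z, d * (d : ℝ≥0∞) ^ (p - 1) * ∑ j, (C₁ * G * P j z) ^ p ∂vMeas n α := by
          refine lintegral_mono fun z => lpPow_le_of_forall_enorm_le hp.le fun i => ?_
          rw [hTi z i]
          exact (enorm_integral_le_lintegral_enorm _).trans (hI z i)
      _ = d * (d : ℝ≥0∞) ^ (p - 1) * ((C₁ * G) ^ p * ∑ j, ∫⁻ z, P j z ^ p ∂vMeas n α) := by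
          have hm : ∀ j, Measurable fun z => (C₁ * G * P j z) ^ p := fun j =>
            ((hPm j).const_mul _).pow_const p
          rw [lintegral_const_mul _ (Finset.measurable_sum _ fun j _ => hm j),
            lintegral_finsetSum _ fun j _ => hm j, Finset.mul_sum Finset.univ _ ((C₁ * G) ^ p)]
          congr 1
          refine Finset.sum_congr rfl fun j _ => ?_
          rw [← lintegral_const_mul _ ((hPm j).pow_const p)]
          exact lintegral_congr fun z => ENNReal.mul_rpow_of_nonneg _ _ hp0.le
      _ ≤ d * (d : ℝ≥0∞) ^ (p - 1) * ((C₁ * G) ^ p *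
            ∑ j, C₂ * ∫⁻ w : Ball n, ‖f w.1 j‖ₑ ^ p ∂vMeas n α) := by
          gcongr with j
          exact hC₂ _ (hfm j)
      _ = _ := by
          rw [lpaPow_eq_sum hf.1, ← Finset.mul_sum, hA]
          push_cast [ENNReal.coe_rpow_of_nonneg _ (by linarith : 0 ≤ p - 1)]
          ring
  have hnorm : lpaNorm α p (kernelIntegral α ν fun w => (W w).mulVec (f w.1)) ≤
      ((C₁ * A ^ (1 / p) : ℝ≥0) : ℝ≥0∞) * G * lpaNorm α p f := by
    have hp1 : 0 ≤ 1 / p := by positivity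
    have hcoe : ((C₁ * A ^ (1 / p) : ℝ≥0) : ℝ≥0∞) = C₁ * (A : ℝ≥0∞) ^ (1 / p) := by
      rw [ENNReal.coe_mul, ENNReal.coe_rpow_of_nonneg _ hp1]
    refine (ENNReal.rpow_le_rpow hpow hp1).trans (le_of_eq ?_)
    rw [ENNReal.mul_rpow_of_nonneg _ _ hp1, ENNReal.mul_rpow_of_nonneg _ _ hp1,
      ← ENNReal.rpow_mul, mul_one_div_cancel hp0.ne', ENNReal.rpow_one, hcoe, lpaNorm]
    ring
  exact ⟨hint', ⟨hdiff, hnorm.trans_lt (ENNReal.mul_lt_top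
    (ENNReal.mul_lt_top ENNReal.coe_lt_top hG.lt_top) hf.2)⟩, hnorm⟩

end UpperBounds

/-! ### Lower bounds -/

section LowerBounds

variable {n d : ℕ}

theorem enorm_normKernel_sq {α : ℝ} (l w : Ball n) : ‖normKernel α l.1 w.1‖ₑ ^ 2 =
    ENNReal.ofReal ((1 - ‖l.1‖ ^ 2) ^ ((n : ℝ) + 1 + α)) * ‖repKernel α l.1 w.1‖ₑ ^ 2 := by
  have hl := l.one_sub_norm_sq_pos
  rw [normKernel, enorm_mul, mul_pow]
  congr 1
  rw [← ofReal_norm, Complex.norm_real, Real.norm_of_nonneg (by positivity),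
    ← ENNReal.ofReal_pow (by positivity), ← Real.rpow_natCast, ← Real.rpow_mul hl.le]
  congr 2
  push_cast
  ring

theorem enorm_repKernel_sq {α : ℝ} (l w : Ball n) : ‖repKernel α l.1 w.1‖ₑ ^ 2 =
    ENNReal.ofReal (‖1 - hdot l.1 w.1‖ ^ (-(2 * ((n : ℝ) + 1 + α)))) := by
  have := norm_one_sub_hdot_pos l w
  rw [enorm_repKernel, ← ENNReal.ofReal_pow (by positivity), ← Real.rpow_natCast,
    ← Real.rpow_mul this.le]
  congr 2
  push_cast
  ring

theorem le_mul_sInf {S : Set ℝ≥0∞} {x : ℝ≥0∞} {K : ℝ≥0} (h : ∀ A ∈ S, x ≤ K * A) :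
    x ≤ (K + 1 : ℝ≥0) * sInf S := by
  have hK : ((K + 1 : ℝ≥0) : ℝ≥0∞) ≠ 0 := by simp
  rw [mul_comm, ← ENNReal.div_le_iff hK ENNReal.coe_ne_top]
  refine le_sInf fun A hA => ?_
  rw [ENNReal.div_le_iff hK ENNReal.coe_ne_top, mul_comm]
  refine (h A hA).trans (mul_le_mul_left (ENNReal.coe_le_coe.2 le_self_add) _)

theorem exists_scalarGeo_le_scalarRkm {α r : ℝ} (hα : -1 < α) (hr : 0 < r) : ∃ C : ℝ≥0,
    ∀ ν : Measure (Ball n), scalarGeo α r ν ≤ C * scalarRkm α ν := by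
  set β : ℝ := (n : ℝ) + 1 + α with hβ
  have hβ0 : 0 < β := by have : (0 : ℝ) ≤ n := Nat.cast_nonneg n; linarith
  set K : ℝ := 2 * Real.cosh r ^ 2 with hK
  have hK0 : 0 < K := by have := Real.cosh_pos r; positivity
  refine ⟨Real.toNNReal (K ^ (2 * β)), fun ν => iSup_le fun l => ?_⟩
  have hl := l.one_sub_norm_sq_pos
  have hpt : ∀ w ∈ bergBall l r, ENNReal.ofReal ((1 - ‖l.1‖ ^ 2) ^ (-β)) ≤
      ENNReal.ofReal (K ^ (2 * β)) * ‖normKernel α l.1 w.1‖ₑ ^ 2 := by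
    intro w hw
    have hX0 := norm_one_sub_hdot_pos l w
    have hX := norm_one_sub_hdot_le hr hw
    rw [← hK] at hX
    rw [enorm_normKernel_sq, enorm_repKernel_sq, ← ENNReal.ofReal_mul (by positivity),
      ← ENNReal.ofReal_mul (by positivity), ← hβ]
    refine ENNReal.ofReal_le_ofReal ?_
    have h1 : (K * (1 - ‖l.1‖ ^ 2)) ^ (-(2 * β)) ≤ ‖1 - hdot l.1 w.1‖ ^ (-(2 * β)) :=
      Real.rpow_le_rpow_of_nonpos hX0 hX (by linarith)
    calc (1 - ‖l.1‖ ^ 2) ^ (-β) = K ^ (2 * β) * ((1 - ‖l.1‖ ^ 2) ^ β *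
          (K * (1 - ‖l.1‖ ^ 2)) ^ (-(2 * β))) := by
          rw [Real.mul_rpow hK0.le hl.le, mul_left_comm ((1 - ‖l.1‖ ^ 2) ^ β), ← mul_assoc,
            ← Real.rpow_add hK0, ← Real.rpow_add hl, add_neg_cancel, Real.rpow_zero, one_mul]
          congr 1
          ring
      _ ≤ _ := by gcongr
  calc ν (bergBall l r) * ENNReal.ofReal ((1 - ‖l.1‖ ^ 2) ^ (-β))
      = ∫⁻ _w in bergBall l r, ENNReal.ofReal ((1 - ‖l.1‖ ^ 2) ^ (-β)) ∂ν := by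
        rw [setLIntegral_const, mul_comm]
    _ ≤ ∫⁻ w in bergBall l r, ENNReal.ofReal (K ^ (2 * β)) * ‖normKernel α l.1 w.1‖ₑ ^ 2 ∂ν :=
        setLIntegral_mono' (measurableSet_bergBall hr l) hpt
    _ ≤ ∫⁻ w, ENNReal.ofReal (K ^ (2 * β)) * ‖normKernel α l.1 w.1‖ₑ ^ 2 ∂ν :=
        setLIntegral_le_lintegral _ _
    _ = ENNReal.ofReal (K ^ (2 * β)) * ∫⁻ w, ‖normKernel α l.1 w.1‖ₑ ^ 2 ∂ν :=
        lintegral_const_mul' _ _ ENNReal.ofReal_ne_top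
    _ ≤ _ := by
        rw [ENNReal.ofReal]
        gcongr
        exact le_iSup (fun l : Ball n => ∫⁻ w, ‖normKernel α l.1 w.1‖ₑ ^ 2 ∂ν) l

theorem lpPow_single {p : ℝ} (hp : 0 < p) (i : Fin d) (c : ℂ) :
    lpPow p (Pi.single i c) = ‖c‖ₑ ^ p := by
  rw [lpPow, Finset.sum_eq_single i]
  · simp
  · intro j _ hj
    simp [Pi.single_eq_of_ne hj, hp]
  · simp

theorem lpPow_smul {p : ℝ} (hp : 0 < p) (c : ℂ) (v : Fin d → ℂ) :
    lpPow p (c • v) = ‖c‖ₑ ^ p * lpPow p v := by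
  rw [lpPow, lpPow, Finset.mul_sum]
  refine Finset.sum_congr rfl fun i _ => ?_
  rw [Pi.smul_apply, smul_eq_mul, enorm_mul, ENNReal.mul_rpow_of_nonneg _ _ hp.le]

/-- `g e_i` for a scalar function `g`. -/
def singleFun (g : EuclideanSpace ℂ (Fin n) → ℂ) (i : Fin d) (w : EuclideanSpace ℂ (Fin n)) :
    Fin d → ℂ :=
  Pi.single i (g w)

theorem singleFun_eq_smul (g : EuclideanSpace ℂ (Fin n) → ℂ) (i : Fin d)
    (w : EuclideanSpace ℂ (Fin n)) : singleFun g i w = g w • Pi.single i (1 : ℂ) := by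
  rw [singleFun, ← Pi.single_smul, smul_eq_mul, mul_one]

theorem lpaPow_singleFun {α p : ℝ} (hp : 0 < p) (g : EuclideanSpace ℂ (Fin n) → ℂ) (i : Fin d) :
    lpaPow α p (singleFun g i) = ∫⁻ z : Ball n, ‖g z.1‖ₑ ^ p ∂vMeas n α := by
  rw [lpaPow]
  exact lintegral_congr fun z => lpPow_single hp i _

theorem memBergman_singleFun {α p : ℝ} (hp : 0 < p) {g : EuclideanSpace ℂ (Fin n) → ℂ}
    (hg : DifferentiableOn ℂ g (Metric.ball 0 1))
    (hgt : ∫⁻ z : Ball n, ‖g z.1‖ₑ ^ p ∂vMeas n α < ∞) (i : Fin d) :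
    MemBergman α p (singleFun g i) := by
  refine ⟨?_, ?_⟩
  · rw [differentiableOn_pi]
    intro j
    by_cases hj : j = i
    · subst hj
      simpa [singleFun] using hg
    · simp [singleFun, Pi.single_eq_of_ne hj]
  · rw [lpaNorm, lpaPow_singleFun hp]
    exact ENNReal.rpow_lt_top_of_nonneg (by positivity) hgt.ne

theorem exists_lintegral_rpow_vMeas_le (hn : 1 ≤ n) {α c : ℝ} (hα : -1 < α) (hc : 0 < c) :
    ∃ C : ℝ≥0, ∀ z : Ball n,
      ∫⁻ w : Ball n, ENNReal.ofReal (‖1 - hdot z.1 w.1‖ ^ (-(n + 1 + α + c))) ∂vMeas n α ≤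
        C * ENNReal.ofReal ((1 - ‖z.1‖ ^ 2) ^ (-c)) := by
  obtain ⟨C, hC⟩ := exists_lintegral_rpow_mul_rpow_le hn (α := α) (s := 0) (by linarith) hc
  exact ⟨C, fun z => by simpa using hC z⟩

theorem ofReal_rpow_mul_ofReal_rpow_neg (l : Ball n) (β : ℝ) :
    ENNReal.ofReal ((1 - ‖l.1‖ ^ 2) ^ β) * ENNReal.ofReal ((1 - ‖l.1‖ ^ 2) ^ (-β)) = 1 := by
  have hl := l.one_sub_norm_sq_pos
  rw [← ENNReal.ofReal_mul (by positivity), ← Real.rpow_add hl, add_neg_cancel, Real.rpow_zero,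
    ENNReal.ofReal_one]

theorem exists_scalarRkm_le_weightedEmbConst (d : ℕ) (hn : 1 ≤ n) {α p : ℝ} (hα : -1 < α)
    (hp : 1 < p) (B : ℝ≥0) : ∃ C : ℝ≥0, ∀ (ν : Measure (Ball n))
      (R : Ball n → Matrix (Fin d) (Fin d) ℂ)
      (φ : Fin d → Ball n → ℝ≥0∞), (∀ i, AEMeasurable (φ i) ν) →
      (∀ᵐ z ∂ν, ∀ i, φ i z ≤ lpPow p ((R z).mulVec (Pi.single i 1))) →
      (∀ᵐ z ∂ν, 1 ≤ B * ∑ i, φ i z) →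
      scalarRkm α ν ≤ C * weightedEmbConst α p ν R := by
  have hp0 : 0 < p := by linarith
  set β : ℝ := (n : ℝ) + 1 + α with hβ
  have hβ0 : 0 < β := by have : (0 : ℝ) ≤ n := Nat.cast_nonneg n; linarith
  obtain ⟨C, hC⟩ := exists_lintegral_rpow_vMeas_le hn hα hβ0
  refine ⟨B * d * C + 1, fun ν R φ hφm hφR hφ => le_mul_sInf fun A hA => iSup_le fun l => ?_⟩
  set g : EuclideanSpace ℂ (Fin n) → ℂ := fun w => (1 - hdot l.1 w) ^ ((-(2 * β / p) : ℝ) : ℂ)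
    with hg
  have hgp : ∀ w : Ball n, ‖g w.1‖ₑ ^ p = ‖repKernel α l.1 w.1‖ₑ ^ 2 := fun w => by
    have h1 := norm_one_sub_hdot_pos l w
    rw [enorm_repKernel_sq, hg, ← ofReal_norm, Complex.norm_cpow_real,
      ENNReal.ofReal_rpow_of_nonneg (by positivity) hp0.le, ← Real.rpow_mul h1.le, neg_mul,
      div_mul_cancel₀ _ hp0.ne']
  have hgd : DifferentiableOn ℂ g (Metric.ball 0 1) :=
    differentiableOn_one_sub_hdot_cpow _ l.norm_lt_one.le
  have hgI : ∫⁻ w : Ball n, ‖g w.1‖ₑ ^ p ∂vMeas n α ≤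
      C * ENNReal.ofReal ((1 - ‖l.1‖ ^ 2) ^ (-β)) := by
    refine le_trans (le_of_eq (lintegral_congr fun w => ?_)) (hC l)
    rw [hgp, enorm_repKernel_sq]
    congr 3
    ring
  have hgm : Measurable fun w : Ball n => ‖g w.1‖ₑ ^ p :=
    (measurable_enorm_of_differentiableOn hgd).pow_const p
  have hstep : ∀ i : Fin d, ∫⁻ w : Ball n, ‖g w.1‖ₑ ^ p * φ i w ∂ν ≤
        A * (C * ENNReal.ofReal ((1 - ‖l.1‖ ^ 2) ^ (-β))) := fun i => by
    have h2 := hA (singleFun g i) (memBergman_singleFun hp0 hgd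
      (hgI.trans_lt (ENNReal.mul_lt_top ENNReal.coe_lt_top ENNReal.ofReal_lt_top)) i)
    rw [lpaPow_singleFun hp0] at h2
    refine le_trans (lintegral_mono_ae ?_) (h2.trans (by gcongr))
    filter_upwards [hφR] with w hw
    rw [singleFun_eq_smul, Matrix.mulVec_smul, lpPow_smul hp0]
    gcongr
    exact hw i
  have hI : ∫⁻ w : Ball n, ‖repKernel α l.1 w.1‖ₑ ^ 2 ∂ν ≤
      B * (d * (A * (C * ENNReal.ofReal ((1 - ‖l.1‖ ^ 2) ^ (-β))))) := by
    calc ∫⁻ w : Ball n, ‖repKernel α l.1 w.1‖ₑ ^ 2 ∂ν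
        ≤ ∫⁻ w : Ball n, B * ∑ i, ‖g w.1‖ₑ ^ p * φ i w ∂ν := by
          refine lintegral_mono_ae ?_
          filter_upwards [hφ] with w hw
          rw [← hgp, ← Finset.mul_sum, mul_left_comm]
          exact le_mul_of_one_le_right zero_le hw
      _ = B * ∑ i, ∫⁻ w : Ball n, ‖g w.1‖ₑ ^ p * φ i w ∂ν := by
          rw [lintegral_const_mul' _ _ ENNReal.coe_ne_top,
            lintegral_finsetSum' (f := fun i w => ‖g w.1‖ₑ ^ p * φ i w)
              _ fun i _ => hgm.aemeasurable.mul (hφm i)]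
      _ ≤ B * ∑ _i : Fin d, A * (C * ENNReal.ofReal ((1 - ‖l.1‖ ^ 2) ^ (-β))) := by
          gcongr with i
          exact hstep i
      _ = _ := by simp
  calc ∫⁻ w : Ball n, ‖normKernel α l.1 w.1‖ₑ ^ 2 ∂ν
      = ENNReal.ofReal ((1 - ‖l.1‖ ^ 2) ^ β) * ∫⁻ w : Ball n, ‖repKernel α l.1 w.1‖ₑ ^ 2 ∂ν := by
        rw [← lintegral_const_mul' _ _ ENNReal.ofReal_ne_top]
        exact lintegral_congr fun w => enorm_normKernel_sq l w
    _ ≤ ENNReal.ofReal ((1 - ‖l.1‖ ^ 2) ^ β) *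
          (B * (d * (A * (C * ENNReal.ofReal ((1 - ‖l.1‖ ^ 2) ^ (-β)))))) := by gcongr
    _ = (ENNReal.ofReal ((1 - ‖l.1‖ ^ 2) ^ β) * ENNReal.ofReal ((1 - ‖l.1‖ ^ 2) ^ (-β))) *
          (B * d * C * A) := by ring
    _ = _ := by
        rw [ofReal_rpow_mul_ofReal_rpow_neg, one_mul]
        push_cast
        rfl

theorem conj_repKernel {α : ℝ} (z w : Ball n) :
    (starRingEnd ℂ) (repKernel α z.1 w.1) = repKernel α w.1 z.1 := by
  have h : 1 - hdot w.1 z.1 = (starRingEnd ℂ) (1 - hdot z.1 w.1) := by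
    rw [map_sub, map_one, hdot_conj]
  have harg := (Complex.mem_slitPlane_iff_arg.1
    (one_sub_hdot_mem_slitPlane z.norm_lt_one.le w.norm_lt_one)).1
  rw [repKernel_eq_cpow, repKernel_eq_cpow, h, Complex.conj_cpow _ _ harg, Complex.conj_ofReal]

theorem exists_scalarRkm_le_toeplitzNorm (d : ℕ) (hn : 1 ≤ n) {α p : ℝ} (hα : -1 < α)
    (hp : 1 < p) : ∃ C : ℝ≥0, ∀ (ν : Measure (Ball n)) (W : Ball n → Matrix (Fin d) (Fin d) ℂ),
      (∀ᵐ w ∂ν, 1 ≤ (W w).trace.re) → scalarRkm α ν ≤ C * toeplitzNorm α p ν W := by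
  have hp0 : 0 < p := by linarith
  set β : ℝ := (n : ℝ) + 1 + α with hβ
  have hβ0 : 0 < β := by have : (0 : ℝ) ≤ n := Nat.cast_nonneg n; linarith
  obtain ⟨C₁, hC₁⟩ := exists_lintegral_rpow_vMeas_le hn (c := β * (p - 1)) hα
    (mul_pos hβ0 (by linarith))
  obtain ⟨C₂, hC₂⟩ := exists_rpow_enorm_le_lintegral_vMeas hn hα one_pos hp.le
  refine ⟨d * (C₂ * C₁) ^ (1 / p) + 1, fun ν W hW => le_mul_sInf fun A hA => iSup_le fun l => ?_⟩
  have hl := l.one_sub_norm_sq_pos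
  have hp1 : 0 ≤ 1 / p := by positivity
  set Λ : ℝ → ℝ≥0∞ := fun b => ENNReal.ofReal ((1 - ‖l.1‖ ^ 2) ^ b) with hΛ
  have hgd := differentiableOn_repKernel α l.norm_lt_one.le
  have hgI : ∫⁻ w : Ball n, ‖repKernel α l.1 w.1‖ₑ ^ p ∂vMeas n α ≤ C₁ * Λ (-(β * (p - 1))) := by
    refine le_trans (le_of_eq (lintegral_congr fun w => ?_)) (hC₁ l)
    have h1 := norm_one_sub_hdot_pos l w
    rw [enorm_repKernel, ENNReal.ofReal_rpow_of_nonneg (by positivity) hp0.le,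
      ← Real.rpow_mul h1.le]
    congr 2
    rw [hβ]; ring
  have hmem : ∀ i : Fin d, MemBergman α p (singleFun (repKernel α l.1) i) := fun i =>
    memBergman_singleFun hp0 hgd
      (hgI.trans_lt (ENNReal.mul_lt_top ENNReal.coe_lt_top ENNReal.ofReal_lt_top)) i
  have hcomp : ∀ (i : Fin d) (w : Ball n),
      (repKernel α w.1 l.1 • (W w).mulVec (singleFun (repKernel α l.1) i w.1)) i =
        ((‖repKernel α l.1 w.1‖ ^ 2 : ℝ) : ℂ) * W w i i := fun i w => by
    rw [singleFun_eq_smul, Matrix.mulVec_smul, Matrix.mulVec_single_one, Pi.smul_apply,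
      Pi.smul_apply, ← conj_repKernel, smul_eq_mul, smul_eq_mul, ← mul_assoc, Complex.conj_mul']
    simp
  have hint : ∀ i : Fin d,
      Integrable (fun w : Ball n => ((‖repKernel α l.1 w.1‖ ^ 2 : ℝ) : ℂ) * W w i i) ν := fun i => by
    have h2 := Integrable.eval ((hA _ (hmem i)).1 l) i
    simpa only [hcomp] using h2
  have hbound : ∀ i : Fin d, ‖∫ w : Ball n, ((‖repKernel α l.1 w.1‖ ^ 2 : ℝ) : ℂ) * W w i i ∂ν‖ₑ ≤
      (C₂ * C₁) ^ (1 / p) * A * Λ (-β) := fun i => by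
    obtain ⟨h3, h4, h5⟩ := hA _ (hmem i)
    set T := kernelIntegral α ν fun w : Ball n =>
      (W w).mulVec (singleFun (repKernel α l.1) i w.1) with hT
    have h6 : ∫ w : Ball n, ((‖repKernel α l.1 w.1‖ ^ 2 : ℝ) : ℂ) * W w i i ∂ν = T l.1 i := by
      rw [hT, kernelIntegral, eval_integral fun i => Integrable.eval (h3 l) i]
      simp only [hcomp]
    have h7 := hC₂ (fun z => T z i) (h4.differentiableOn_apply i) l
    have h8 : ∫⁻ u in bergBall l 1, ‖T u.1 i‖ₑ ^ p ∂vMeas n α ≤ lpaPow α p T := by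
      refine (setLIntegral_le_lintegral _ _).trans (lintegral_mono fun z => ?_)
      exact Finset.single_le_sum (f := fun i => ‖T z.1 i‖ₑ ^ p) (fun i _ => zero_le)
        (Finset.mem_univ i)
    have h9 : lpaPow α p T ≤ A ^ p * (C₁ * Λ (-(β * (p - 1)))) := by
      rw [lpaNorm, lpaNorm, lpaPow_singleFun hp0] at h5
      have h10 := ENNReal.rpow_le_rpow h5 hp0.le
      rw [ENNReal.mul_rpow_of_nonneg _ _ hp0.le, ← ENNReal.rpow_mul, ← ENNReal.rpow_mul,
        one_div_mul_cancel hp0.ne', ENNReal.rpow_one, ENNReal.rpow_one] at h10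
      exact h10.trans (by gcongr)
    have h11 : ‖T l.1 i‖ₑ ^ p ≤ ((C₂ * C₁) ^ (1 / p) * A * Λ (-β)) ^ p := by
      calc ‖T l.1 i‖ₑ ^ p = Λ (-β) * (Λ β * ‖T l.1 i‖ₑ ^ p) := by
            rw [← mul_assoc, mul_comm (Λ (-β)), ofReal_rpow_mul_ofReal_rpow_neg, one_mul]
        _ ≤ Λ (-β) * (C₂ * (A ^ p * (C₁ * Λ (-(β * (p - 1)))))) := by
            exact mul_le_mul_right (h7.trans (mul_le_mul_right (h8.trans h9) _)) _
        _ = C₂ * C₁ * A ^ p * (Λ (-β) * Λ (-(β * (p - 1)))) := by ring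
        _ = _ := by
            rw [ENNReal.mul_rpow_of_nonneg _ _ hp0.le, ENNReal.mul_rpow_of_nonneg _ _ hp0.le,
              ← ENNReal.rpow_mul, one_div_mul_cancel hp0.ne', ENNReal.rpow_one]
            congr 1
            simp only [hΛ]
            rw [← ENNReal.ofReal_mul (by positivity), ← Real.rpow_add hl,
              ENNReal.ofReal_rpow_of_nonneg (by positivity) hp0.le, ← Real.rpow_mul hl.le]
            congr 2
            ring
    rw [h6]
    exact (ENNReal.rpow_le_rpow_iff hp0).1 h11
  have hI : ∫⁻ w : Ball n, ‖repKernel α l.1 w.1‖ₑ ^ 2 ∂ν ≤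
      d * ((C₂ * C₁) ^ (1 / p) * A * Λ (-β)) := by
    have hre : ∀ w, (∑ i, ((‖repKernel α l.1 w.1‖ ^ 2 : ℝ) : ℂ) * W w i i).re =
        ‖repKernel α l.1 w.1‖ ^ 2 * (W w).trace.re := fun w => by
      rw [← Finset.mul_sum, Complex.re_ofReal_mul]
      rfl
    have hsum : Integrable (fun w : Ball n =>
        ∑ i, ((‖repKernel α l.1 w.1‖ ^ 2 : ℝ) : ℂ) * W w i i) ν :=
      integrable_finsetSum _ fun i _ => hint i
    calc ∫⁻ w : Ball n, ‖repKernel α l.1 w.1‖ₑ ^ 2 ∂ν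
        ≤ ∫⁻ w : Ball n, ENNReal.ofReal
            (RCLike.re (∑ i, ((‖repKernel α l.1 w.1‖ ^ 2 : ℝ) : ℂ) * W w i i)) ∂ν := by
          refine lintegral_mono_ae ?_
          filter_upwards [hW] with w hw
          rw [← ofReal_norm, ← ENNReal.ofReal_pow (norm_nonneg _), RCLike.re_eq_complex_re, hre]
          exact ENNReal.ofReal_le_ofReal (le_mul_of_one_le_right (by positivity) hw)
      _ = ENNReal.ofReal (RCLike.re (∫ w : Ball n,
            ∑ i, ((‖repKernel α l.1 w.1‖ ^ 2 : ℝ) : ℂ) * W w i i ∂ν)) := by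
          rw [← integral_re hsum, ofReal_integral_eq_lintegral_ofReal hsum.re]
          filter_upwards [hW] with w hw
          change 0 ≤ RCLike.re _
          rw [RCLike.re_eq_complex_re, hre]
          have : 0 ≤ (W w).trace.re := by linarith
          positivity
      _ ≤ ‖∫ w : Ball n, ∑ i, ((‖repKernel α l.1 w.1‖ ^ 2 : ℝ) : ℂ) * W w i i ∂ν‖ₑ := by
          rw [← ofReal_norm]
          exact ENNReal.ofReal_le_ofReal (RCLike.re_le_norm _)
      _ ≤ ∑ i, ‖∫ w : Ball n, ((‖repKernel α l.1 w.1‖ ^ 2 : ℝ) : ℂ) * W w i i ∂ν‖ₑ := by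
          rw [integral_finsetSum _ fun i _ => hint i]
          exact enorm_sum_le _ _
      _ ≤ ∑ _i : Fin d, (C₂ * C₁) ^ (1 / p) * A * Λ (-β) := Finset.sum_le_sum fun i _ => hbound i
      _ = _ := by simp
  calc ∫⁻ w : Ball n, ‖normKernel α l.1 w.1‖ₑ ^ 2 ∂ν
      = Λ β * ∫⁻ w : Ball n, ‖repKernel α l.1 w.1‖ₑ ^ 2 ∂ν := by
        rw [← lintegral_const_mul' _ _ ENNReal.ofReal_ne_top]
        exact lintegral_congr fun w => enorm_normKernel_sq l w
    _ ≤ Λ β * (d * ((C₂ * C₁) ^ (1 / p) * A * Λ (-β))) := by gcongr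
    _ = (Λ β * Λ (-β)) * (d * (C₂ * C₁) ^ (1 / p) * A) := by ring
    _ = _ := by
        rw [ofReal_rpow_mul_ofReal_rpow_neg, one_mul]
        push_cast [ENNReal.coe_rpow_of_nonneg _ hp1]
        rfl

end LowerBounds

/-! ### Positive semidefinite matrices -/

section Matrices

variable {n d : ℕ}

theorem norm_entry_le {A : Matrix (Fin d) (Fin d) ℂ} (hA : A.PosSemidef) (i j : Fin d) :
    ‖A i j‖ ≤ ((A i i).re + (A j j).re) / 2 := by
  open scoped MatrixOrder in
  obtain ⟨B, rfl⟩ := CStarAlgebra.nonneg_iff_eq_star_mul_self.mp hA.nonneg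
  have hdiag : ∀ k, ((star B * B) k k).re = ∑ l, ‖B l k‖ ^ 2 := fun k => by
    rw [Matrix.mul_apply, Complex.re_sum]
    refine Finset.sum_congr rfl fun l _ => ?_
    rw [Matrix.star_apply, ← Complex.normSq_eq_norm_sq, Complex.normSq_apply]
    simp [Complex.mul_re]
  rw [hdiag, hdiag, ← Finset.sum_add_distrib, Finset.sum_div, Matrix.mul_apply]
  refine (norm_sum_le _ _).trans (Finset.sum_le_sum fun l _ => ?_)
  rw [Matrix.star_apply, norm_mul, norm_star]
  nlinarith [sq_nonneg (‖B l i‖ - ‖B l j‖)]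

theorem re_diag_nonneg {A : Matrix (Fin d) (Fin d) ℂ} (hA : A.PosSemidef) (i : Fin d) :
    0 ≤ (A i i).re := by
  have := norm_entry_le hA i i
  linarith [norm_nonneg (A i i)]

theorem re_trace_eq (A : Matrix (Fin d) (Fin d) ℂ) : A.trace.re = ∑ i, (A i i).re := by
  simp [Matrix.trace]

theorem norm_entry_le_trace {A : Matrix (Fin d) (Fin d) ℂ} (hA : A.PosSemidef) (i j : Fin d) :
    ‖A i j‖ ≤ A.trace.re := by
  have h : ∀ k, (A k k).re ≤ A.trace.re := fun k => by
    rw [re_trace_eq]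
    exact Finset.single_le_sum (f := fun k => (A k k).re) (fun k _ => re_diag_nonneg hA k)
      (Finset.mem_univ k)
  linarith [norm_entry_le hA i j, h i, h j]

theorem norm_diag_eq {A : Matrix (Fin d) (Fin d) ℂ} (hA : A.PosSemidef) (i : Fin d) :
    ‖A i i‖ = (A i i).re := by
  refine le_antisymm ?_ (Complex.re_le_norm _)
  linarith [norm_entry_le hA i i]

theorem matNorm_le {A : Matrix (Fin d) (Fin d) ℂ} (hA : ∀ i j, ‖A i j‖ ≤ 1) : matNorm A ≤ d := by
  have : ‖Matrix.toEuclideanCLM (n := Fin d) (𝕜 := ℂ) A‖ ≤ d := by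
    refine ContinuousLinearMap.opNorm_le_bound _ (Nat.cast_nonneg d) fun v => ?_
    rw [← sq_le_sq₀ (norm_nonneg _) (by positivity), mul_pow, EuclideanSpace.norm_sq_eq,
      EuclideanSpace.norm_sq_eq]
    have key : ∀ i, ‖(Matrix.toEuclideanCLM (n := Fin d) (𝕜 := ℂ) A v) i‖ ^ 2 ≤
        d * ∑ j, ‖v j‖ ^ 2 := fun i => by
      have h1 : ‖(Matrix.toEuclideanCLM (n := Fin d) (𝕜 := ℂ) A v) i‖ ≤ ∑ j, ‖v j‖ := by
        rw [Matrix.ofLp_toEuclideanCLM, Matrix.mulVec, dotProduct]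
        refine (norm_sum_le _ _).trans (Finset.sum_le_sum fun j _ => ?_)
        rw [norm_mul]
        exact mul_le_of_le_one_left (norm_nonneg _) (hA i j)
      calc _ ≤ (∑ j, ‖v j‖) ^ 2 := by gcongr
        _ ≤ _ := by simpa using sq_sum_le_card_mul_sum_sq (s := Finset.univ) (f := fun j => ‖v j‖)
    refine (Finset.sum_le_sum fun i _ => key i).trans_eq ?_
    simp only [Finset.sum_const, Finset.card_univ, Fintype.card_fin, nsmul_eq_mul]
    ring
  rw [matNorm, ← ofReal_norm]
  exact (ENNReal.ofReal_le_ofReal this).trans_eq (by simp)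

theorem enorm_entry_le_matNorm (A : Matrix (Fin d) (Fin d) ℂ) (i j : Fin d) :
    ‖A i j‖ₑ ≤ matNorm A := by
  rw [matNorm, ← ofReal_norm, ← ofReal_norm]
  refine ENNReal.ofReal_le_ofReal ?_
  have h := (Matrix.toEuclideanCLM (n := Fin d) (𝕜 := ℂ) A).le_opNorm (EuclideanSpace.single j 1)
  have h2 := PiLp.norm_apply_le
    (Matrix.toEuclideanCLM (n := Fin d) (𝕜 := ℂ) A (EuclideanSpace.single j 1)) i
  simp [Matrix.ofLp_toEuclideanCLM] at h h2
  exact h2.trans h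

theorem one_le_mul_matNorm {A : Matrix (Fin d) (Fin d) ℂ} (htr : 1 ≤ A.trace.re) :
    1 ≤ d * matNorm A := by
  calc (1 : ℝ≥0∞) ≤ ENNReal.ofReal (A.trace.re) := ENNReal.one_le_ofReal.2 htr
    _ ≤ ‖A.trace‖ₑ := by
      rw [← ofReal_norm]; exact ENNReal.ofReal_le_ofReal (Complex.re_le_norm _)
    _ ≤ ∑ i, ‖A i i‖ₑ := enorm_sum_le _ _
    _ ≤ ∑ _i : Fin d, matNorm A := Finset.sum_le_sum fun i _ => enorm_entry_le_matNorm A i i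
    _ = _ := by simp

theorem cfc_apply_eq_sum {A : Matrix (Fin d) (Fin d) ℂ} (hA : A.IsHermitian) (f : ℝ → ℝ)
    (i j : Fin d) : cfc f A i j = ∑ k, (hA.eigenvectorUnitary : Matrix (Fin d) (Fin d) ℂ) i k *
      f (hA.eigenvalues k) * star ((hA.eigenvectorUnitary : Matrix (Fin d) (Fin d) ℂ) j k) := by
  rw [hA.cfc_eq, Matrix.IsHermitian.cfc, Unitary.conjStarAlgAut_apply, Matrix.mul_apply]
  simp [Matrix.mul_diagonal, Matrix.star_apply]

theorem sum_norm_sq_eigenvectorUnitary {A : Matrix (Fin d) (Fin d) ℂ} (hA : A.IsHermitian)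
    (i : Fin d) : ∑ k, ‖(hA.eigenvectorUnitary : Matrix (Fin d) (Fin d) ℂ) i k‖ ^ 2 = 1 := by
  have h : ((hA.eigenvectorUnitary : Matrix (Fin d) (Fin d) ℂ) *
      star (hA.eigenvectorUnitary : Matrix (Fin d) (Fin d) ℂ)) i i =
      (1 : Matrix (Fin d) (Fin d) ℂ) i i := by
    rw [Matrix.mem_unitaryGroup_iff.1 hA.eigenvectorUnitary.2]
  rw [Matrix.mul_apply, Matrix.one_apply_eq] at h
  have h' := congrArg Complex.re h
  rw [Complex.re_sum, Complex.one_re] at h'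
  rw [← h']
  refine Finset.sum_congr rfl fun k _ => ?_
  rw [Matrix.star_apply, ← Complex.normSq_eq_norm_sq, Complex.normSq_apply]
  simp [Complex.mul_re]

theorem re_cfc_diag {A : Matrix (Fin d) (Fin d) ℂ} (hA : A.IsHermitian) (f : ℝ → ℝ) (i : Fin d) :
    (cfc f A i i).re = ∑ k, ‖(hA.eigenvectorUnitary : Matrix (Fin d) (Fin d) ℂ) i k‖ ^ 2 *
      f (hA.eigenvalues k) := by
  rw [cfc_apply_eq_sum hA, Complex.re_sum]
  refine Finset.sum_congr rfl fun k _ => ?_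
  rw [← Complex.normSq_eq_norm_sq, Complex.normSq_apply]
  simp [Complex.mul_re]
  ring

theorem eigenvalues_mem_Icc {A : Matrix (Fin d) (Fin d) ℂ} (hA : A.PosSemidef)
    (htr : A.trace.re ≤ 1) (k : Fin d) : hA.1.eigenvalues k ∈ Set.Icc (0 : ℝ) 1 := by
  refine ⟨hA.eigenvalues_nonneg k, le_trans ?_ htr⟩
  rw [hA.1.trace_eq_sum_eigenvalues, Complex.re_sum]
  exact Finset.single_le_sum (f := fun k => ((hA.1.eigenvalues k : ℝ) : ℂ).re)
    (fun k _ => by simpa using hA.eigenvalues_nonneg k) (Finset.mem_univ k)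

theorem norm_cfc_le_one {A : Matrix (Fin d) (Fin d) ℂ} (hA : A.PosSemidef)
    (htr : A.trace.re ≤ 1) {f : ℝ → ℝ} (hf : ∀ x ∈ Set.Icc (0 : ℝ) 1, |f x| ≤ 1) (i j : Fin d) :
    ‖cfc f A i j‖ ≤ 1 := by
  rw [cfc_apply_eq_sum hA.1]
  set U := (hA.1.eigenvectorUnitary : Matrix (Fin d) (Fin d) ℂ)
  calc _ ≤ ∑ k, (‖U i k‖ ^ 2 + ‖U j k‖ ^ 2) / 2 := by
        refine (norm_sum_le _ _).trans (Finset.sum_le_sum fun k _ => ?_)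
        rw [norm_mul, norm_mul, norm_star, Complex.norm_real, Real.norm_eq_abs]
        have h := hf _ (eigenvalues_mem_Icc hA htr k)
        calc _ ≤ ‖U i k‖ * 1 * ‖U j k‖ := by gcongr
          _ ≤ _ := by nlinarith [sq_nonneg (‖U i k‖ - ‖U j k‖)]
    _ = 1 := by
        rw [← Finset.sum_div, Finset.sum_add_distrib, sum_norm_sq_eigenvectorUnitary,
          sum_norm_sq_eigenvectorUnitary]
        norm_num

theorem norm_diag_le_norm_cfc {A : Matrix (Fin d) (Fin d) ℂ} (hA : A.PosSemidef)
    (htr : A.trace.re ≤ 1) {f : ℝ → ℝ} (hf : ∀ x ∈ Set.Icc (0 : ℝ) 1, x ≤ f x) (i : Fin d) :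
    ‖A i i‖ ≤ ‖cfc f A i i‖ := by
  rw [norm_diag_eq hA]
  refine le_trans ?_ (Complex.re_le_norm _)
  have h := re_cfc_diag hA.1 id i
  rw [cfc_id ℝ A hA.1.isSelfAdjoint] at h
  rw [h, re_cfc_diag hA.1]
  exact Finset.sum_le_sum fun k _ => by
    gcongr
    exact hf _ (eigenvalues_mem_Icc hA htr k)

end Matrices

/-! ### PSD matrix-valued measures and their densities -/

section Density

variable {n d : ℕ}

namespace PSDMeasure

variable (μ : PSDMeasure n d)

theorem traceMeas_apply {s : Set (Ball n)} (hs : MeasurableSet s) :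
    μ.traceMeas s = ENNReal.ofReal (μ.toVM s).trace.re :=
  μ.scalarize_apply _ _ _ hs

instance isFiniteMeasure_traceMeas : IsFiniteMeasure μ.traceMeas :=
  ⟨by rw [traceMeas_apply μ MeasurableSet.univ]; exact ENNReal.ofReal_lt_top⟩

theorem entry_apply (i j : Fin d) (s : Set (Ball n)) : μ.entry i j s = μ.toVM s i j := by
  rw [entry, VectorMeasure.mapRange_apply]
  rfl

theorem enorm_entry_le (i j : Fin d) {s : Set (Ball n)} (hs : MeasurableSet s) :
    ‖μ.entry i j s‖ₑ ≤ μ.traceMeas s := by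
  rw [entry_apply, traceMeas_apply μ hs, ← ofReal_norm]
  exact ENNReal.ofReal_le_ofReal (norm_entry_le_trace (μ.posSemidef s hs) i j)

theorem integrable_density (i j : Fin d) :
    Integrable (fun z => μ.density z i j) μ.traceMeas :=
  ComplexMeasure.integrable_rnDeriv _ _

theorem entry_re_withDensity (i j : Fin d) :
    μ.traceMeas.withDensityᵥ ((μ.entry i j).re.rnDeriv μ.traceMeas) = (μ.entry i j).re := by
  refine SignedMeasure.withDensityᵥ_rnDeriv_eq _ _ (VectorMeasure.AbsolutelyContinuous.mk ?_)
  intro s hs h0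
  rw [Measure.toENNRealVectorMeasure_apply_measurable hs] at h0
  have h := μ.enorm_entry_le i j hs
  rw [h0, nonpos_iff_eq_zero, enorm_eq_zero] at h
  change (μ.entry i j s).re = 0
  rw [h, Complex.zero_re]

theorem entry_im_withDensity (i j : Fin d) :
    μ.traceMeas.withDensityᵥ ((μ.entry i j).im.rnDeriv μ.traceMeas) = (μ.entry i j).im := by
  refine SignedMeasure.withDensityᵥ_rnDeriv_eq _ _ (VectorMeasure.AbsolutelyContinuous.mk ?_)
  intro s hs h0
  rw [Measure.toENNRealVectorMeasure_apply_measurable hs] at h0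
  have h := μ.enorm_entry_le i j hs
  rw [h0, nonpos_iff_eq_zero, enorm_eq_zero] at h
  change (μ.entry i j s).im = 0
  rw [h, Complex.zero_im]

theorem setIntegral_density (i j : Fin d) {s : Set (Ball n)} (hs : MeasurableSet s) :
    ∫ z in s, μ.density z i j ∂μ.traceMeas = μ.toVM s i j := by
  rw [← entry_apply]
  have hi := (μ.integrable_density i j).integrableOn (s := s)
  apply Complex.ext
  · rw [← RCLike.re_eq_complex_re, ← integral_re hi]
    change ∫ z in s, (μ.entry i j).re.rnDeriv μ.traceMeas z ∂μ.traceMeas = _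
    rw [← withDensityᵥ_apply (SignedMeasure.integrable_rnDeriv _ _) hs, entry_re_withDensity]
    rfl
  · rw [← RCLike.im_eq_complex_im, ← integral_im hi]
    change ∫ z in s, (μ.entry i j).im.rnDeriv μ.traceMeas z ∂μ.traceMeas = _
    rw [← withDensityᵥ_apply (SignedMeasure.integrable_rnDeriv _ _) hs, entry_im_withDensity]
    rfl

theorem integrable_dotProduct_density (x : Fin d → ℂ) :
    Integrable (fun z => star x ⬝ᵥ (μ.density z).mulVec x) μ.traceMeas := by
  simp only [Matrix.mulVec, dotProduct]
  exact integrable_finsetSum _ fun i _ => (integrable_finsetSum _ fun j _ =>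
    (μ.integrable_density i j).mul_const _).const_mul _

theorem setIntegral_dotProduct_density (x : Fin d → ℂ) {s : Set (Ball n)} (hs : MeasurableSet s) :
    ∫ z in s, star x ⬝ᵥ (μ.density z).mulVec x ∂μ.traceMeas =
      star x ⬝ᵥ (μ.toVM s).mulVec x := by
  simp only [Matrix.mulVec, dotProduct]
  have hi : ∀ i j, Integrable (fun z => μ.density z i j * x j) (μ.traceMeas.restrict s) :=
    fun i j => ((μ.integrable_density i j).mul_const _).integrableOn
  rw [integral_finsetSum _ fun i _ => (integrable_finsetSum _ fun j _ => hi i j).const_mul _]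
  refine Finset.sum_congr rfl fun i _ => ?_
  rw [integral_const_mul, integral_finsetSum _ fun j _ => hi i j]
  congr 1
  refine Finset.sum_congr rfl fun j _ => ?_
  rw [integral_mul_const, μ.setIntegral_density i j hs]

theorem ae_isHermitian_density : ∀ᵐ z ∂μ.traceMeas, (μ.density z).IsHermitian := by
  have h : ∀ i j, ∀ᵐ z ∂μ.traceMeas, star (μ.density z j i) = μ.density z i j := fun i j => by
    refine Integrable.ae_eq_of_forall_setIntegral_eq _ _
      (((starL' ℝ : ℂ ≃L[ℝ] ℂ) : ℂ →L[ℝ] ℂ).integrable_comp (μ.integrable_density j i))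
      (μ.integrable_density i j) fun s hs _ => ?_
    have := ContinuousLinearMap.integral_comp_comm ((starL' ℝ : ℂ ≃L[ℝ] ℂ) : ℂ →L[ℝ] ℂ)
      ((μ.integrable_density j i).integrableOn (s := s))
    refine this.trans ?_
    rw [μ.setIntegral_density i j hs, μ.setIntegral_density j i hs]
    exact (μ.posSemidef s hs).1.apply i j
  filter_upwards [ae_all_iff.2 fun i => ae_all_iff.2 (h i)] with z hz
  exact Matrix.IsHermitian.ext hz

theorem ae_posSemidef_density : ∀ᵐ z ∂μ.traceMeas, (μ.density z).PosSemidef := by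
  have h : ∀ x : Fin d → ℂ, ∀ᵐ z ∂μ.traceMeas, 0 ≤ (star x ⬝ᵥ (μ.density z).mulVec x).re :=
    fun x => by
    have hi := μ.integrable_dotProduct_density x
    refine ae_nonneg_of_forall_setIntegral_nonneg hi.re fun s hs _ => ?_
    rw [show ∫ z in s, (star x ⬝ᵥ (μ.density z).mulVec x).re ∂μ.traceMeas =
      (∫ z in s, star x ⬝ᵥ (μ.density z).mulVec x ∂μ.traceMeas).re from
      integral_re hi.integrableOn, μ.setIntegral_dotProduct_density x hs]
    exact (Complex.nonneg_iff.1 ((μ.posSemidef s hs).dotProduct_mulVec_nonneg x)).1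
  filter_upwards [μ.ae_isHermitian_density,
    ae_all_iff.2 fun k => h (TopologicalSpace.denseSeq (Fin d → ℂ) k)] with z hz hk
  refine Matrix.PosSemidef.of_dotProduct_mulVec_nonneg hz fun x => ?_
  refine Complex.nonneg_iff.2 ⟨?_, ?_⟩
  · have hcl : IsClosed {x : Fin d → ℂ | 0 ≤ (star x ⬝ᵥ (μ.density z).mulVec x).re} :=
      isClosed_le continuous_const (Complex.continuous_re.comp
        (Continuous.dotProduct continuous_star
          (Continuous.matrix_mulVec continuous_const continuous_id)))
    exact (TopologicalSpace.denseRange_denseSeq (Fin d → ℂ)).induction_on x hcl hk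
  · exact (hz.im_star_dotProduct_mulVec_self x).symm

theorem ae_trace_density : ∀ᵐ z ∂μ.traceMeas, (μ.density z).trace.re = 1 := by
  have hi : Integrable (fun z => (μ.density z).trace) μ.traceMeas :=
    integrable_finsetSum _ fun i _ => μ.integrable_density i i
  refine Integrable.ae_eq_of_forall_setIntegral_eq _ _ hi.re (integrable_const 1)
    fun s hs _ => ?_
  rw [show ∫ z in s, (μ.density z).trace.re ∂μ.traceMeas =
      (∫ z in s, (μ.density z).trace ∂μ.traceMeas).re from integral_re hi.integrableOn,
    show ∫ z in s, (μ.density z).trace ∂μ.traceMeas = (μ.toVM s).trace by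
      simp only [Matrix.trace, Matrix.diag]
      rw [integral_finsetSum _ fun i _ => (μ.integrable_density i i).integrableOn]
      exact Finset.sum_congr rfl fun i _ => μ.setIntegral_density i i hs]
  rw [setIntegral_const, Measure.real, traceMeas_apply μ hs,
    ENNReal.toReal_ofReal
      (show 0 ≤ (μ.toVM s).trace.re from traceHom_nonneg _ (μ.posSemidef s hs))]
  simp

theorem traceMeas_le_totalVar : μ.traceMeas ≤ μ.totalVar := by
  refine Measure.le_intro fun s hs _ => ?_
  rw [traceMeas_apply μ hs]
  calc ENNReal.ofReal (μ.toVM s).trace.re ≤ ‖(μ.toVM s).trace‖ₑ := by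
        rw [← ofReal_norm]; exact ENNReal.ofReal_le_ofReal (Complex.re_le_norm _)
    _ ≤ ∑ i, ‖μ.entry i i s‖ₑ := by
        simp only [entry_apply]
        exact enorm_sum_le _ _
    _ ≤ ∑ i, ∑ j, (μ.entry i j).variation s := Finset.sum_le_sum fun i _ =>
        (VectorMeasure.enorm_measure_le_variation _ _).trans
          (Finset.single_le_sum (f := fun j => (μ.entry i j).variation s)
            (fun _ _ => zero_le) (Finset.mem_univ i))
    _ = μ.totalVar s := by simp [totalVar]

theorem totalVar_le : μ.totalVar ≤ ((d : ℝ≥0∞) * d) • μ.traceMeas := by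
  refine Measure.le_intro fun s hs _ => ?_
  simp only [totalVar, Measure.finsetSum_apply, Measure.smul_apply, smul_eq_mul]
  calc ∑ i, ∑ j, (μ.entry i j).variation s ≤ ∑ _i : Fin d, ∑ _j : Fin d, μ.traceMeas s :=
        Finset.sum_le_sum fun i _ => Finset.sum_le_sum fun j _ =>
          VectorMeasure.variation_le_of_forall_enorm_le (fun E hE => μ.enorm_entry_le i j hE) s
    _ = _ := by simp [mul_assoc]

instance isFiniteMeasure_totalVar : IsFiniteMeasure μ.totalVar := by
  refine ⟨(μ.totalVar_le _).trans_lt ?_⟩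
  rw [Measure.smul_apply, smul_eq_mul]
  exact ENNReal.mul_lt_top (by finiteness) (measure_lt_top _ _)

theorem quadMeas_apply (e : EuclideanSpace ℂ (Fin d)) {s : Set (Ball n)} (hs : MeasurableSet s) :
    μ.quadMeas e s = ENNReal.ofReal (star e.ofLp ⬝ᵥ (μ.toVM s).mulVec e.ofLp).re :=
  μ.scalarize_apply _ _ _ hs

theorem quadMeas_le {e : EuclideanSpace ℂ (Fin d)} (he : ‖e‖ = 1) :
    μ.quadMeas e ≤ ((d : ℝ≥0∞) * d) • μ.traceMeas := by
  refine Measure.le_intro fun s hs _ => ?_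
  rw [quadMeas_apply μ e hs, Measure.smul_apply, traceMeas_apply μ hs, smul_eq_mul,
    ← ENNReal.ofReal_natCast, ← ENNReal.ofReal_mul (by positivity),
    ← ENNReal.ofReal_mul (by positivity)]
  refine ENNReal.ofReal_le_ofReal ((Complex.re_le_norm _).trans ?_)
  have he1 : ∀ i, ‖e i‖ ≤ 1 := fun i => he ▸ PiLp.norm_apply_le e i
  have ht : 0 ≤ (μ.toVM s).trace.re := traceHom_nonneg _ (μ.posSemidef s hs)
  simp only [Matrix.mulVec, dotProduct]
  calc _ ≤ ∑ _i : Fin d, ∑ _j : Fin d, (μ.toVM s).trace.re := by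
        refine (norm_sum_le _ _).trans (Finset.sum_le_sum fun i _ => ?_)
        rw [norm_mul, Pi.star_apply, norm_star]
        refine (mul_le_of_le_one_left (norm_nonneg _) (he1 i)).trans
          ((norm_sum_le _ _).trans (Finset.sum_le_sum fun j _ => ?_))
        rw [norm_mul]
        exact (mul_le_of_le_one_right (norm_nonneg _) (he1 j)).trans
          (norm_entry_le_trace (μ.posSemidef s hs) i j)
    _ = _ := by simp [mul_assoc]

theorem traceMeas_eq_sum_quadMeas :
    μ.traceMeas = ∑ i, μ.quadMeas (EuclideanSpace.single i 1) := by
  ext s hs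
  rw [Measure.finsetSum_apply, traceMeas_apply μ hs, re_trace_eq,
    ENNReal.ofReal_sum_of_nonneg fun i _ => re_diag_nonneg (μ.posSemidef s hs) i]
  refine Finset.sum_congr rfl fun i _ => ?_
  rw [quadMeas_apply μ _ hs]
  simp [EuclideanSpace.single, Pi.star_single]

end PSDMeasure

end Density

/-! ### Comparison of the quantities -/

section Equivalence

variable {n d : ℕ}

theorem scalarGeo_le_of_le_smul {α r : ℝ} {ν ν' : Measure (Ball n)} {c : ℝ≥0∞}
    (h : ν ≤ c • ν') : scalarGeo α r ν ≤ c * scalarGeo α r ν' := by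
  refine iSup_le fun l => ?_
  calc _ ≤ (c * ν' (bergBall l r)) * ENNReal.ofReal ((1 - ‖l.1‖ ^ 2) ^ (-(n + 1 + α))) := by
        gcongr
        exact h _
    _ ≤ c * scalarGeo α r ν' := by
        rw [mul_assoc]
        gcongr
        exact le_iSup (fun l : Ball n =>
          ν' (bergBall l r) * ENNReal.ofReal ((1 - ‖l.1‖ ^ 2) ^ (-(n + 1 + α)))) l

theorem lintegral_normKernel_le_scalarRkm {α : ℝ} {ν ν' : Measure (Ball n)} {c : ℝ≥0∞}
    (h : ν ≤ c • ν') (l : Ball n) :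
    ∫⁻ z, ‖normKernel α l.1 z.1‖ₑ ^ 2 ∂ν ≤ c * scalarRkm α ν' := by
  calc _ ≤ ∫⁻ z, ‖normKernel α l.1 z.1‖ₑ ^ 2 ∂(c • ν') := lintegral_mono' h le_rfl
    _ = c * ∫⁻ z, ‖normKernel α l.1 z.1‖ₑ ^ 2 ∂ν' := lintegral_smul_measure _ _
    _ ≤ _ := by
        gcongr
        exact le_iSup (fun l : Ball n => ∫⁻ z, ‖normKernel α l.1 z.1‖ₑ ^ 2 ∂ν') l

/-- A measure whose averages over the balls of a lattice are bounded has bounded averages over all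
balls of the same radius. -/
theorem exists_scalarGeo_le_iSup_lattice (n : ℕ) (α : ℝ) {r : ℝ} (hr : 0 < r) (N : ℕ) :
    ∃ C : ℝ≥0, ∀ (ν : Measure (Ball n)) (a : ℕ → Ball n), IsLattice r N a →
      scalarGeo α r ν ≤ C * ⨆ k, ν (bergBall (a k) r) *
        ENNReal.ofReal ((1 - ‖(a k).1‖ ^ 2) ^ (-(n + 1 + α))) := by
  set K : ℝ := (4 * Real.cosh (4 * r) ^ 2) ^ |(-(n + 1 + α) : ℝ)|
  have hK : 0 ≤ K := by positivity
  refine ⟨N * K.toNNReal, fun ν a ha => iSup_le fun l => ?_⟩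
  set X := ⨆ k, ν (bergBall (a k) r) * ENNReal.ofReal ((1 - ‖(a k).1‖ ^ 2) ^ (-(n + 1 + α)))
  set S : Set ℕ := {k | l ∈ bergBall (a k) (4 * r)}
  have hSN : S.encard ≤ N := ha.overlap l
  have hS : S.Finite := Set.finite_of_encard_le_coe hSN
  have hcard : hS.toFinset.card ≤ N := by
    rw [hS.encard_eq_coe_toFinset_card] at hSN
    exact_mod_cast hSN
  have hsub : bergBall l r ⊆ ⋃ k ∈ hS.toFinset, bergBall (a k) r := fun w hw => by
    obtain ⟨k, hk⟩ := Set.mem_iUnion.1 (ha.cover ▸ Set.mem_univ w)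
    refine Set.mem_iUnion₂.2 ⟨k, hS.mem_toFinset.2 ?_, hk⟩
    have h1 : bergDist (a k) w < r := hk
    have h2 : bergDist w l < r := (mem_bergBall_comm l w).1 hw
    have h3 := bergDist_triangle (a k) w l
    change bergDist (a k) l < 4 * r
    linarith
  calc _ ≤ (∑ k ∈ hS.toFinset, ν (bergBall (a k) r)) *
          ENNReal.ofReal ((1 - ‖l.1‖ ^ 2) ^ (-(n + 1 + α))) := by
        gcongr
        exact (measure_mono hsub).trans (measure_biUnion_finset_le _ _)
    _ = ∑ k ∈ hS.toFinset, ν (bergBall (a k) r) *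
          ENNReal.ofReal ((1 - ‖l.1‖ ^ 2) ^ (-(n + 1 + α))) := Finset.sum_mul _ _ _
    _ ≤ ∑ _k ∈ hS.toFinset, K.toNNReal * X := by
        refine Finset.sum_le_sum fun k hk => ?_
        have hkl : l ∈ bergBall (a k) (4 * r) := hS.mem_toFinset.1 hk
        have hle := rpow_one_sub_norm_sq_le (by linarith) hkl (-(n + 1 + α))
        calc _ ≤ ν (bergBall (a k) r) *
              (K.toNNReal * ENNReal.ofReal ((1 - ‖(a k).1‖ ^ 2) ^ (-(n + 1 + α)))) := by
              gcongr
              change _ ≤ ENNReal.ofReal K * _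
              rw [← ENNReal.ofReal_mul hK]
              exact ENNReal.ofReal_le_ofReal hle
          _ = K.toNNReal * (ν (bergBall (a k) r) *
              ENNReal.ofReal ((1 - ‖(a k).1‖ ^ 2) ^ (-(n + 1 + α)))) := by ring
          _ ≤ _ := by
              gcongr
              exact le_iSup (fun k => ν (bergBall (a k) r) *
                ENNReal.ofReal ((1 - ‖(a k).1‖ ^ 2) ^ (-(n + 1 + α)))) k
    _ = hS.toFinset.card * (K.toNNReal * X) := by simp
    _ ≤ N * (K.toNNReal * X) := by gcongr
    _ = _ := by
        push_cast
        ring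

theorem scalarEmbConst_eq (α p : ℝ) (ν : Measure (Ball n)) :
    scalarEmbConst d α p ν = weightedEmbConst α p ν fun _ => (1 : Matrix (Fin d) (Fin d) ℂ) := by
  simp [scalarEmbConst, weightedEmbConst]

theorem norm_one_entry_le (i j : Fin d) : ‖(1 : Matrix (Fin d) (Fin d) ℂ) i j‖ ≤ 1 := by
  rw [Matrix.one_apply]
  split_ifs <;> simp

theorem isUnitWeight_one (ν : Measure (Ball n)) :
    IsUnitWeight ν fun _ => (1 : Matrix (Fin d) (Fin d) ℂ) where
  aestronglyMeasurable _ _ := aestronglyMeasurable_const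
  norm_le := .of_forall fun _ => norm_one_entry_le

theorem exists_scalarRkm_le_scalarEmbConst (hn : 1 ≤ n) (hd : 1 ≤ d) {α p : ℝ} (hα : -1 < α)
    (hp : 1 < p) : ∃ C : ℝ≥0, ∀ ν : Measure (Ball n),
      scalarRkm α ν ≤ C * scalarEmbConst d α p ν := by
  obtain ⟨C, hC⟩ := exists_scalarRkm_le_weightedEmbConst d hn hα hp 1
  refine ⟨C, fun ν => ?_⟩
  rw [scalarEmbConst_eq]
  refine hC ν _ (fun _ _ => 1) (fun _ => aemeasurable_const) (.of_forall fun z i => ?_)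
    (.of_forall fun z => ?_)
  · rw [Matrix.one_mulVec, lpPow_single (by linarith)]
    simp
  · simpa using hd

theorem exists_scalarEmbConst_le_scalarGeo (d : ℕ) (hn : 1 ≤ n) {α p r : ℝ} (hα : -1 < α)
    (hp : 1 < p) (hr : 0 < r) : ∃ C : ℝ≥0, ∀ (ν : Measure (Ball n)) [SFinite ν],
      scalarEmbConst d α p ν ≤ C * scalarGeo α r ν := by
  obtain ⟨C, hC⟩ := exists_weightedEmbConst_le_scalarGeo d hn hα hp hr
  refine ⟨C, fun ν _ => ?_⟩
  rw [scalarEmbConst_eq]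
  exact hC ν _ (.of_forall fun _ => norm_one_entry_le)

theorem exists_scalarRkm_le_scalarOpNorm (hn : 1 ≤ n) (hd : 1 ≤ d) {α p : ℝ} (hα : -1 < α)
    (hp : 1 < p) : ∃ C : ℝ≥0, ∀ ν : Measure (Ball n),
      scalarRkm α ν ≤ C * scalarOpNorm d α p ν := by
  obtain ⟨C, hC⟩ := exists_scalarRkm_le_toeplitzNorm d hn hα hp
  exact ⟨C, fun ν => hC ν _ (.of_forall fun _ => by simpa using hd)⟩

theorem exists_scalarOpNorm_le_scalarGeo (d : ℕ) (hn : 1 ≤ n) {α p r : ℝ} (hα : -1 < α)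
    (hp : 1 < p) (hr : 0 < r) : ∃ C : ℝ≥0, ∀ (ν : Measure (Ball n)) [SFinite ν],
      scalarOpNorm d α p ν ≤ C * scalarGeo α r ν := by
  obtain ⟨C, hC⟩ := exists_toeplitzNorm_le_scalarGeo d hn hα hp hr
  exact ⟨C, fun ν _ => hC ν _ (isUnitWeight_one ν)⟩

namespace PSDMeasure

variable (μ : PSDMeasure n d)

theorem ae_norm_density_le : ∀ᵐ z ∂μ.traceMeas, ∀ i j, ‖μ.density z i j‖ ≤ 1 := by
  filter_upwards [μ.ae_posSemidef_density, μ.ae_trace_density] with z hz htr i j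
  exact htr ▸ norm_entry_le_trace hz i j

theorem isUnitWeight_density : IsUnitWeight μ.traceMeas μ.density where
  aestronglyMeasurable i j := (μ.integrable_density i j).aestronglyMeasurable
  norm_le := μ.ae_norm_density_le

theorem ae_norm_densityRoot_le {p : ℝ} (hp : 1 < p) :
    ∀ᵐ z ∂μ.traceMeas, ∀ i j, ‖μ.densityRoot p z i j‖ ≤ 1 := by
  filter_upwards [μ.ae_posSemidef_density, μ.ae_trace_density] with z hz htr i j
  refine norm_cfc_le_one hz htr.le (fun x hx => ?_) i j
  rw [abs_of_nonneg (Real.rpow_nonneg hx.1 _)]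
  exact Real.rpow_le_one hx.1 hx.2 (by positivity)

theorem ae_enorm_density_rpow_le {p : ℝ} (hp : 1 < p) : ∀ᵐ z ∂μ.traceMeas, ∀ i,
    ‖μ.density z i i‖ₑ ^ p ≤ lpPow p ((μ.densityRoot p z).mulVec (Pi.single i 1)) := by
  filter_upwards [μ.ae_posSemidef_density, μ.ae_trace_density] with z hz htr i
  have h : ‖μ.density z i i‖ ≤ ‖μ.densityRoot p z i i‖ :=
    norm_diag_le_norm_cfc hz htr.le (fun x hx => Real.self_le_rpow_of_le_one hx.1 hx.2
      (by rw [div_le_one (by linarith)]; exact hp.le)) i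
  calc _ ≤ ‖μ.densityRoot p z i i‖ₑ ^ p := by
        rw [← ofReal_norm, ← ofReal_norm]
        gcongr
    _ = ‖(μ.densityRoot p z).mulVec (Pi.single i 1) i‖ₑ ^ p := by
        rw [Matrix.mulVec_single_one, Matrix.col_apply]
    _ ≤ _ := Finset.single_le_sum
        (f := fun k => ‖(μ.densityRoot p z).mulVec (Pi.single i 1) k‖ₑ ^ p)
        (fun _ _ => zero_le) (Finset.mem_univ i)

theorem ae_one_le_sum_enorm_density_rpow {p : ℝ} (hp : 1 < p) : ∀ᵐ z ∂μ.traceMeas,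
    1 ≤ (((d : ℝ≥0) ^ (p - 1) : ℝ≥0) : ℝ≥0∞) * ∑ i, ‖μ.density z i i‖ₑ ^ p := by
  filter_upwards [μ.ae_trace_density] with z htr
  have h1 : 1 ≤ ∑ i, ‖μ.density z i i‖ₑ :=
    calc (1 : ℝ≥0∞) ≤ ENNReal.ofReal (μ.density z).trace.re := by simp [htr]
      _ ≤ ‖(μ.density z).trace‖ₑ := by
        rw [← ofReal_norm]; exact ENNReal.ofReal_le_ofReal (Complex.re_le_norm _)
      _ ≤ _ := enorm_sum_le _ _
  calc (1 : ℝ≥0∞) ≤ (∑ i, ‖μ.density z i i‖ₑ) ^ p := ENNReal.one_le_rpow h1 (by linarith)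
    _ ≤ _ := sum_rpow_le hp.le _
    _ = _ := by rw [ENNReal.coe_rpow_of_nonneg _ (sub_nonneg.2 hp.le), ENNReal.coe_natCast]

theorem exists_embConst_le_scalarGeo (n d : ℕ) (hn : 1 ≤ n) {α p r : ℝ} (hα : -1 < α)
    (hp : 1 < p) (hr : 0 < r) : ∃ C : ℝ≥0, ∀ μ : PSDMeasure n d,
      μ.embConst α p ≤ C * scalarGeo α r μ.traceMeas := by
  obtain ⟨C, hC⟩ := exists_weightedEmbConst_le_scalarGeo d hn hα hp hr
  exact ⟨C, fun μ => hC _ _ (μ.ae_norm_densityRoot_le hp)⟩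

theorem exists_scalarRkm_le_embConst (n d : ℕ) (hn : 1 ≤ n) {α p : ℝ} (hα : -1 < α)
    (hp : 1 < p) : ∃ C : ℝ≥0, ∀ μ : PSDMeasure n d,
      scalarRkm α μ.traceMeas ≤ C * μ.embConst α p := by
  obtain ⟨C, hC⟩ := exists_scalarRkm_le_weightedEmbConst d hn hα hp ((d : ℝ≥0) ^ (p - 1))
  exact ⟨C, fun μ => hC _ _ (fun i z => ‖μ.density z i i‖ₑ ^ p)
    (fun i => (μ.integrable_density i i).aestronglyMeasurable.enorm.pow_const p)
    (μ.ae_enorm_density_rpow_le hp) (μ.ae_one_le_sum_enorm_density_rpow hp)⟩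

theorem exists_opNorm_le_scalarGeo (n d : ℕ) (hn : 1 ≤ n) {α p r : ℝ} (hα : -1 < α)
    (hp : 1 < p) (hr : 0 < r) : ∃ C : ℝ≥0, ∀ μ : PSDMeasure n d,
      μ.opNorm α p ≤ C * scalarGeo α r μ.traceMeas := by
  obtain ⟨C, hC⟩ := exists_toeplitzNorm_le_scalarGeo d hn hα hp hr
  exact ⟨C, fun μ => hC _ _ μ.isUnitWeight_density⟩

theorem exists_scalarRkm_le_opNorm (n d : ℕ) (hn : 1 ≤ n) {α p : ℝ} (hα : -1 < α)
    (hp : 1 < p) : ∃ C : ℝ≥0, ∀ μ : PSDMeasure n d,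
      scalarRkm α μ.traceMeas ≤ C * μ.opNorm α p := by
  obtain ⟨C, hC⟩ := exists_scalarRkm_le_toeplitzNorm d hn hα hp
  exact ⟨C, fun μ => hC _ _ (μ.ae_trace_density.mono fun _ h => h.ge)⟩

theorem rkm_le_scalarRkm (α : ℝ) : μ.rkm α ≤ (d * d : ℝ≥0) * scalarRkm α μ.traceMeas := by
  refine iSup₂_le fun e l => ?_
  push_cast
  exact lintegral_normKernel_le_scalarRkm (μ.quadMeas_le e.2) l

theorem scalarRkm_le_rkm (α : ℝ) : scalarRkm α μ.traceMeas ≤ (d : ℝ≥0) * μ.rkm α := by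
  refine iSup_le fun l => ?_
  rw [traceMeas_eq_sum_quadMeas, lintegral_finsetSum_measure]
  calc _ ≤ ∑ _i : Fin d, μ.rkm α := Finset.sum_le_sum fun i _ =>
        le_iSup₂ (f := fun (e : {e : EuclideanSpace ℂ (Fin d) // ‖e‖ = 1}) (l : Ball n) =>
          ∫⁻ z, ‖normKernel α l.1 z.1‖ₑ ^ 2 ∂(μ.quadMeas e.1))
          ⟨EuclideanSpace.single i 1, by simp⟩ l
    _ = _ := by simp

theorem geoAvg_le (α r : ℝ) (l : Ball n) : μ.geoAvg α r l ≤ (d : ℝ≥0) *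
    (μ.traceMeas (bergBall l r) * ENNReal.ofReal ((1 - ‖l.1‖ ^ 2) ^ (-(n + 1 + α)))) := by
  rw [geoAvg, ← mul_assoc]
  gcongr
  calc _ ≤ ∫⁻ _z in bergBall l r, (d : ℝ≥0∞) ∂μ.traceMeas := lintegral_mono_ae
        (ae_restrict_of_ae (μ.ae_norm_density_le.mono fun z hz => matNorm_le hz))
    _ = _ := by simp

theorem le_geoAvg (α r : ℝ) (l : Ball n) :
    μ.traceMeas (bergBall l r) * ENNReal.ofReal ((1 - ‖l.1‖ ^ 2) ^ (-(n + 1 + α))) ≤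
      (d : ℝ≥0) * μ.geoAvg α r l := by
  rw [geoAvg, ← mul_assoc]
  gcongr
  calc _ = ∫⁻ _z in bergBall l r, 1 ∂μ.traceMeas := by simp
    _ ≤ ∫⁻ z in bergBall l r, d * matNorm (μ.density z) ∂μ.traceMeas := lintegral_mono_ae
        (ae_restrict_of_ae (μ.ae_trace_density.mono fun z hz => one_le_mul_matNorm hz.ge))
    _ = _ := by rw [lintegral_const_mul' _ _ (by finiteness)]; simp

theorem geo_le_scalarGeo (α r : ℝ) : μ.geo α r ≤ (d : ℝ≥0) * scalarGeo α r μ.traceMeas :=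
  iSup_le fun l => (μ.geoAvg_le α r l).trans (by gcongr; exact le_iSup (fun l : Ball n =>
    μ.traceMeas (bergBall l r) * ENNReal.ofReal ((1 - ‖l.1‖ ^ 2) ^ (-(n + 1 + α)))) l)

theorem scalarGeo_le_geo (α r : ℝ) : scalarGeo α r μ.traceMeas ≤ (d : ℝ≥0) * μ.geo α r :=
  iSup_le fun l => (μ.le_geoAvg α r l).trans (by gcongr; exact le_iSup (μ.geoAvg α r) l)

theorem geoSeq_le_geo (α r : ℝ) (a : ℕ → Ball n) : μ.geoSeq α r a ≤ μ.geo α r :=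
  iSup_le fun k => le_iSup (μ.geoAvg α r) (a k)

end PSDMeasure

/-- `X` is bounded by a constant multiple of `Y`. -/
def Dominated {ι : Type*} (X Y : ι → ℝ≥0∞) : Prop := ∃ C : ℝ≥0, ∀ i, X i ≤ C * Y i

theorem Dominated.trans {ι : Type*} {X Y Z : ι → ℝ≥0∞} (h : Dominated X Y) (h' : Dominated Y Z) :
    Dominated X Z := by
  obtain ⟨C, hC⟩ := h
  obtain ⟨C', hC'⟩ := h'
  refine ⟨C * C', fun i => (hC i).trans ?_⟩
  push_cast
  rw [mul_assoc]
  gcongr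
  exact hC' i

theorem Dominated.comp {ι κ : Type*} {X Y : ι → ℝ≥0∞} (h : Dominated X Y) (f : κ → ι) :
    Dominated (X ∘ f) (Y ∘ f) :=
  h.imp fun _ hC i => hC (f i)

theorem Dominated.exists_forall {ι J : Type*} [Fintype J] {X Y : J → ι → ℝ≥0∞}
    (h : ∀ j, Dominated (X j) (Y j)) : ∃ C : ℝ≥0, ∀ j i, X j i ≤ C * Y j i := by
  choose C hC using h
  refine ⟨∑ j, C j, fun j i => (hC j i).trans ?_⟩
  gcongr
  exact Finset.single_le_sum (f := C) (fun _ _ => zero_le) (Finset.mem_univ j)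

/-- The quantities attached to a PSD measure that do not involve a lattice. -/
def quantities (n d : ℕ) (α p r : ℝ) : Fin 8 → PSDMeasure n d → ℝ≥0∞ :=
  ![fun μ => μ.rkm α, fun μ => μ.embConst α p, fun μ => μ.geo α r, fun μ => μ.opNorm α p,
    fun μ => scalarRkm α μ.totalVar, fun μ => scalarEmbConst d α p μ.totalVar,
    fun μ => scalarGeo α r μ.totalVar, fun μ => scalarOpNorm d α p μ.totalVar]

section Comparison

variable {α p r : ℝ}

theorem dominated_scalarRkm (hn : 1 ≤ n) (hd : 1 ≤ d) (hα : -1 < α) (hp : 1 < p) (hr : 0 < r) :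
    Dominated (fun μ : PSDMeasure n d => scalarRkm α μ.traceMeas)
      (fun μ => scalarGeo α r μ.traceMeas) := by
  obtain ⟨C, hC⟩ := exists_scalarRkm_le_scalarEmbConst hn hd hα hp
  obtain ⟨C', hC'⟩ := exists_scalarEmbConst_le_scalarGeo d hn hα hp hr
  exact Dominated.trans ⟨C, fun μ => hC μ.traceMeas⟩ ⟨C', fun μ => hC' μ.traceMeas⟩

theorem scalarGeo_totalVar_dominated : Dominated
    (fun μ : PSDMeasure n d => scalarGeo α r μ.totalVar)
    (fun μ => scalarGeo α r μ.traceMeas) :=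
  ⟨d * d, fun μ => by push_cast; exact scalarGeo_le_of_le_smul μ.totalVar_le⟩

theorem dominated_scalarGeo_totalVar : Dominated
    (fun μ : PSDMeasure n d => scalarGeo α r μ.traceMeas)
    (fun μ => scalarGeo α r μ.totalVar) :=
  ⟨1, fun μ => scalarGeo_le_of_le_smul (by simpa using μ.traceMeas_le_totalVar)⟩

theorem quantities_dominated (hn : 1 ≤ n) (hd : 1 ≤ d) (hα : -1 < α) (hp : 1 < p) (hr : 0 < r)
    (k : Fin 8) : Dominated (quantities n d α p r k) (fun μ => scalarGeo α r μ.traceMeas) := by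
  have hrkm := dominated_scalarRkm (n := n) (d := d) hn hd hα hp hr
  fin_cases k
  · exact Dominated.trans ⟨d * d, fun μ => μ.rkm_le_scalarRkm α⟩ hrkm
  · exact PSDMeasure.exists_embConst_le_scalarGeo n d hn hα hp hr
  · exact ⟨d, fun μ => μ.geo_le_scalarGeo α r⟩
  · exact PSDMeasure.exists_opNorm_le_scalarGeo n d hn hα hp hr
  · refine Dominated.trans ⟨d * d, fun μ => iSup_le fun l => ?_⟩ hrkm
    push_cast
    exact lintegral_normKernel_le_scalarRkm μ.totalVar_le l
  · obtain ⟨C, hC⟩ := exists_scalarEmbConst_le_scalarGeo d hn hα hp hr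
    exact Dominated.trans ⟨C, fun μ => hC μ.totalVar⟩ scalarGeo_totalVar_dominated
  · exact scalarGeo_totalVar_dominated
  · obtain ⟨C, hC⟩ := exists_scalarOpNorm_le_scalarGeo d hn hα hp hr
    exact Dominated.trans ⟨C, fun μ => hC μ.totalVar⟩ scalarGeo_totalVar_dominated

theorem dominated_quantities (hn : 1 ≤ n) (hd : 1 ≤ d) (hα : -1 < α) (hp : 1 < p) (hr : 0 < r)
    (k : Fin 8) : Dominated (fun μ => scalarGeo α r μ.traceMeas) (quantities n d α p r k) := by
  obtain ⟨C, hC⟩ := exists_scalarGeo_le_scalarRkm (n := n) hα hr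
  have hgeo : Dominated (fun μ : PSDMeasure n d => scalarGeo α r μ.traceMeas)
    (fun μ => scalarRkm α μ.traceMeas) := ⟨C, fun μ => hC μ.traceMeas⟩
  have hgeo' : Dominated (fun μ : PSDMeasure n d => scalarGeo α r μ.traceMeas)
    (fun μ => scalarRkm α μ.totalVar) :=
    dominated_scalarGeo_totalVar.trans ⟨C, fun μ => hC μ.totalVar⟩
  fin_cases k
  · exact hgeo.trans ⟨d, fun μ => μ.scalarRkm_le_rkm α⟩
  · exact hgeo.trans (PSDMeasure.exists_scalarRkm_le_embConst n d hn hα hp)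
  · exact ⟨d, fun μ => μ.scalarGeo_le_geo α r⟩
  · exact hgeo.trans (PSDMeasure.exists_scalarRkm_le_opNorm n d hn hα hp)
  · exact hgeo'
  · obtain ⟨C', hC'⟩ := exists_scalarRkm_le_scalarEmbConst hn hd hα hp
    exact hgeo'.trans ⟨C', fun μ => hC' μ.totalVar⟩
  · exact dominated_scalarGeo_totalVar
  · obtain ⟨C', hC'⟩ := exists_scalarRkm_le_scalarOpNorm hn hd hα hp
    exact hgeo'.trans ⟨C', fun μ => hC' μ.totalVar⟩

theorem geoSeq_dominated (n d : ℕ) (α r : ℝ) (N : ℕ) : Dominated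
    (fun q : PSDMeasure n d × {a : ℕ → Ball n // IsLattice r N a} => q.1.geoSeq α r q.2.1)
    (fun q => scalarGeo α r q.1.traceMeas) :=
  ⟨d, fun q => (q.1.geoSeq_le_geo α r q.2.1).trans (q.1.geo_le_scalarGeo α r)⟩

theorem dominated_geoSeq (n d : ℕ) (α : ℝ) (hr : 0 < r) (N : ℕ) : Dominated
    (fun q : PSDMeasure n d × {a : ℕ → Ball n // IsLattice r N a} => scalarGeo α r q.1.traceMeas)
    (fun q => q.1.geoSeq α r q.2.1) := by
  obtain ⟨C, hC⟩ := exists_scalarGeo_le_iSup_lattice n α hr N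
  refine Dominated.trans ⟨C, fun q => hC q.1.traceMeas q.2.1 q.2.2⟩
    ⟨d, fun q => iSup_le fun k => (q.1.le_geoAvg α r _).trans ?_⟩
  gcongr
  exact le_iSup (fun k => q.1.geoAvg α r (q.2.1 k)) k

end Comparison

theorem exists_mem_quantities {α p r : ℝ} {μ : PSDMeasure n d} {x : ℝ≥0∞}
    (hx : x ∈ ({μ.rkm α, μ.embConst α p, μ.geo α r, μ.opNorm α p,
      scalarRkm α μ.totalVar, scalarEmbConst d α p μ.totalVar,
      scalarGeo α r μ.totalVar, scalarOpNorm d α p μ.totalVar} : Set ℝ≥0∞)) :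
    ∃ k, x = quantities n d α p r k μ := by
  rcases hx with h | h | h | h | h | h | h | h
  exacts [⟨0, h⟩, ⟨1, h⟩, ⟨2, h⟩, ⟨3, h⟩, ⟨4, h⟩, ⟨5, h⟩, ⟨6, h⟩, ⟨7, h⟩]

end Equivalence

end Carleson

end

theorem lemma2p9 (n d : ℕ) (hn : 1 ≤ n) (hd : 1 ≤ d) (α p r : ℝ) (hα : -1 < α) (hp : 1 < p)
    (hr : 0 < r) (N : ℕ) :
    ∃ C : NNReal, ∀ μ : Carleson.PSDMeasure n d,
      ∀ x ∈ ({μ.rkm α, μ.embConst α p, μ.geo α r, μ.opNorm α p,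
          Carleson.scalarRkm α μ.totalVar, Carleson.scalarEmbConst d α p μ.totalVar,
          Carleson.scalarGeo α r μ.totalVar, Carleson.scalarOpNorm d α p μ.totalVar} :
          Set ENNReal),
        (∀ y ∈ ({μ.rkm α, μ.embConst α p, μ.geo α r, μ.opNorm α p,
            Carleson.scalarRkm α μ.totalVar, Carleson.scalarEmbConst d α p μ.totalVar,
            Carleson.scalarGeo α r μ.totalVar, Carleson.scalarOpNorm d α p μ.totalVar} :
            Set ENNReal), x ≤ C * y) ∧
        ∀ a : ℕ → Carleson.Ball n, Carleson.IsLattice r N a →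
          x ≤ C * μ.geoSeq α r a ∧ μ.geoSeq α r a ≤ C * x := by
  have hQG := Carleson.quantities_dominated hn hd hα hp hr
  have hGQ := Carleson.dominated_quantities hn hd hα hp hr
  have hSG := Carleson.geoSeq_dominated n d α r N
  have hGS := Carleson.dominated_geoSeq n d α hr N
  obtain ⟨C₁, hC₁⟩ := Carleson.Dominated.exists_forall
    fun q : Fin 8 × Fin 8 => (hQG q.1).trans (hGQ q.2)
  obtain ⟨C₂, hC₂⟩ := Carleson.Dominated.exists_forall
    fun k => ((hQG k).comp Prod.fst).trans hGS
  obtain ⟨C₃, hC₃⟩ := Carleson.Dominated.exists_forall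
    fun k => hSG.trans ((hGQ k).comp Prod.fst)
  refine ⟨C₁ + C₂ + C₃, fun μ x hx => ?_⟩
  obtain ⟨k, rfl⟩ := Carleson.exists_mem_quantities hx
  push_cast
  refine ⟨fun y hy => ?_, fun a ha => ⟨?_, ?_⟩⟩
  · obtain ⟨m, rfl⟩ := Carleson.exists_mem_quantities hy
    exact (hC₁ (k, m) μ).trans (by gcongr; rw [add_assoc]; exact le_self_add)
  · refine (hC₂ k (μ, ⟨a, ha⟩)).trans ?_
    gcongr
    exact le_add_self.trans le_self_add
  · refine (hC₃ k (μ, ⟨a, ha⟩)).trans ?_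
    gcongr
    exacts [le_add_self, le_rfl]
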